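/- **Setting.** All spaces are complex and $\mathbb{Z}/2$-graded; $|\cdot|$ denotes parity. Let $V=\mathbb{C}^{2|1}$ have the homogeneous basis $u_1,u_2$ (even), $u_3$ (odd) and the even $(-1)$-supersymmetric form $B$ with $B(u_1,u_2)=-B(u_2,u_1)=1$, $B(u_3,u_3)=1$, all other values $0$. Let $V'=\mathbb{C}^{2|2}$ have the homogeneous basis $v_1,v_2$ (even), $w_1,w_2$ (odd) and the even supersymmetric form $B'$ with $B'(v_1,v_2)=B'(v_2,v_1)=1$, $B'(w_1,w_2)=-B'(w_2,w_1)=1$, all other values $0$. Let $\mathfrak{spo}(2|1)$ and $\mathfrak{osp}(2|2)$ be the Lie superalgebras of endomorphisms $X$ of $V$, resp. $V'$, preserving the form, i.e. $B(Xa,b)+(-1)^{|X||a|}B(a,Xb)=0$, resp. the same for $B'$. Put $X'=\mathbb{C}v_1\oplus\mathbb{C}w_1$, $Y'=\mathbb{C}v_2\oplus\mathbb{C}w_2$, $$\mathfrak{k}'=\{T\in\mathfrak{osp}(2|2): TX'\subseteq X',\ TY'\subseteq Y'\},\qquad \mathfrak{n}'^{+}=\{T\in\mathfrak{osp}(2|2):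 TX'\subseteq Y',\ TY'=0\},$$ and identify $\mathfrak{k}'$ with $\mathfrak{gl}(1|1)=\mathfrak{gl}(X')$ by restriction to $X'$ (basis $v_1,w_1$). On $\widetilde E=V\otimes V'$ consider the form $\widetilde B(a\otimes a',b\otimes b')=(-1)^{|a'||b|}B(a,b)B'(a',b')$ and the actions $X(a\otimes a')=Xa\otimes a'$ of $\mathfrak{spo}(2|1)$ and $T(a\otimes a')=(-1)^{|T||a|}a\otimes Ta'$ of $\mathfrak{osp}(2|2)$, which embed both into $\mathfrak{spo}(\widetilde E,\widetilde B)$. Let $E=V\otimes X'$ and let $S(E)=\bigoplus_{d\ge 0}S^d(E)$ be its supersymmetric algebra. Let $\iota:\widetilde E\to\operatorname{End}S(E)$ send $e\in E$ to multiplication by $e$ and $y\in V\otimes Y'$ to the superderivation extending the linear form $\widetilde B(y,\cdot)$ on $E$. Then $\mathfrak{spo}(\widetilde E,\widetilde B)$ acts on $S(E)$ by the spinor-oscillator representation $$\omega(Z)=\tfrac12\sum_a\iota(Ze_a)\,\iota(e^a),$$ where $(e_a)$ is a homogeneous basis of $\widetilde E$ and $(e^a)$ the dual basis, $\widetilde B(e^a,e_b)=\delta_{ab}$.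 Let $S^d(E)^{\mathfrak{n}'^{+}}$ be the space of elements of $S^d(E)$ annihilated by $\omega(\mathfrak{n}'^{+})$. Let $V^{2|1}_{(\alpha)}$ be the irreducible $\mathfrak{spo}(2|1)$-module with a homogeneous highest weight vector killed by $E_{12}$ and $E_{13}+E_{32}$ on which $E_{11}-E_{22}$ acts by $\alpha$, and let $V^{1|1}_{(\beta,\gamma)}$ be the irreducible $\mathfrak{gl}(1|1)$-module with a homogeneous highest weight vector killed by $E_{12}$ on which $E_{11},E_{22}$ act by $\beta,\gamma$. These modules are considered up to a change of parity; on a tensor product, $X\in\mathfrak{spo}(2|1)$ acts by $X(v\otimes w)=Xv\otimes w$ and $A\in\mathfrak{gl}(1|1)$ by $A(v\otimes w)=(-1)^{|A||v|}v\otimes Aw$. **Theorem.** All the modules named below exist, and there are isomorphisms of $\mathfrak{spo}(2|1)+\mathfrak{gl}(1|1)$-modules, homogeneous (parity preserving or parity reversing) on each summand, as follows. For every $d\ge4$, $$S^{d}(E)^{\mathfrak{n}'^{+}}\cong V^{2|1}_{(d)}\otimes V^{1|1}_{(d+\frac12,-\frac12)}\ \oplus\ V^{2|1}_{(d-1)}\otimes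 V^{1|1}_{(d-\frac12,\frac12)}.$$ Moreover, - $S^{0}(E)^{\mathfrak{n}'^{+}}\cong V^{2|1}_{(0)}\otimes V^{1|1}_{(\frac12,-\frac12)}$; - $S^{1}(E)^{\mathfrak{n}'^{+}}\cong V^{2|1}_{(1)}\otimes V^{1|1}_{(\frac32,-\frac12)}$; - $S^{2}(E)^{\mathfrak{n}'^{+}}\cong V^{2|1}_{(2)}\otimes V^{1|1}_{(\frac52,-\frac12)}\oplus V^{2|1}_{(1)}\otimes V^{1|1}_{(\frac32,\frac12)}$; - $S^{3}(E)^{\mathfrak{n}'^{+}}\cong V^{2|1}_{(3)}\otimes V^{1|1}_{(\frac72,-\frac12)}\oplus V^{2|1}_{(2)}\otimes V^{1|1}_{(\frac52,\frac12)}\oplus V^{2|1}_{(0)}\otimes V^{1|1}_{(\frac32,\frac32)}$. -/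

import Mathlib

open scoped TensorProduct DirectSum Matrix

noncomputable section

namespace SpoOsp

/-! ### Lie superalgebras of matrices and their representations -/

/-- The sign `(-1)^p` of a parity `p`. -/
def sgn (p : ZMod 2) : ℂ := (-1) ^ p.val

theorem sgn_add (p q : ZMod 2) : sgn (p + q) = sgn p * sgn q := by
  have h : ∀ p q : ZMod 2, (p + q).val % 2 = (p.val + q.val) % 2 := by decide
  rw [sgn, sgn, sgn, ← pow_add, neg_one_pow_eq_pow_mod_two, h, ← neg_one_pow_eq_pow_mod_two]

theorem sgn_mul_self (p : ZMod 2) : sgn p * sgn p = 1 := by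
  rw [sgn, ← mul_pow]
  simp

section Superalgebras

variable {n : Type*} [Fintype n]

/-- The homogeneous part of parity `p` of `End(ℂ^n)`, where the basis vector `e_i` of the
superspace `ℂ^n` has parity `par i`. -/
def homPart (par : n → ZMod 2) (p : ZMod 2) : Submodule ℂ (Matrix n n ℂ) where
  carrier := {X | ∀ i j, par i + par j ≠ p → X i j = 0}
  add_mem' := by
    intro X Y hX hY i j h
    simp [hX i j h, hY i j h]
  zero_mem' := by
    intro i j _
    rfl
  smul_mem' := by
    intro c X hX i j h
    simp [hX i j h]

/-- The supercommutator `XY - (-1)^{pq} YX` of `X` of parity `p` and `Y` of parity `q`. -/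
def superBracket (p q : ZMod 2) (X Y : Matrix n n ℂ) : Matrix n n ℂ :=
  X * Y - sgn (p * q) • (Y * X)

theorem mul_mem_homPart (par : n → ZMod 2) {p q : ZMod 2} {X Y : Matrix n n ℂ}
    (hX : X ∈ homPart par p) (hY : Y ∈ homPart par q) : X * Y ∈ homPart par (p + q) := by
  intro i j h
  rw [Matrix.mul_apply]
  refine Finset.sum_eq_zero fun k _ => ?_
  by_cases h1 : par i + par k = p
  · by_cases h2 : par k + par j = q
    · exfalso
      apply h
      rw [← h1, ← h2]
      have h3 : par k + par k = 0 := CharTwo.add_self_eq_zero _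
      linear_combination -h3
    · rw [hY k j h2, mul_zero]
  · rw [hX i k h1, zero_mul]

theorem superBracket_mem_homPart (par : n → ZMod 2) {p q : ZMod 2} {X Y : Matrix n n ℂ}
    (hX : X ∈ homPart par p) (hY : Y ∈ homPart par q) :
    superBracket p q X Y ∈ homPart par (p + q) :=
  Submodule.sub_mem _ (mul_mem_homPart par hX hY)
    (Submodule.smul_mem _ _ (add_comm q p ▸ mul_mem_homPart par hY hX))

/-- A Lie sub-superalgebra of `gl(ℂ^n)`, given by its even part `part 0` and its odd part
`part 1`. -/
structure MatrixSuperalgebra (par : n → ZMod 2) where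
  part : ZMod 2 → Submodule ℂ (Matrix n n ℂ)
  homogeneous : ∀ p, part p ≤ homPart par p
  bracket_mem : ∀ {p q X Y}, X ∈ part p → Y ∈ part q → superBracket p q X Y ∈ part (p + q)

/-- The general linear Lie superalgebra. -/
def gl (par : n → ZMod 2) : MatrixSuperalgebra par where
  part := homPart par
  homogeneous _ := le_rfl
  bracket_mem hX hY := superBracket_mem_homPart par hX hY

/-- The elements `X` of parity `p` with `B(X v, w) + (-1)^{p|v|} B(v, X w) = 0` for all
basis vectors `v = e_i`, `w = e_j`, where `B(e_i, e_j) = B i j`. -/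
def preservingPart (par : n → ZMod 2) (B : Matrix n n ℂ) (p : ZMod 2) :
    Submodule ℂ (Matrix n n ℂ) where
  carrier := {X | X ∈ homPart par p ∧
    ∀ i j, ∑ k, X k i * B k j + sgn (p * par i) * ∑ k, B i k * X k j = 0}
  add_mem' := by
    rintro X Y ⟨hX, hX'⟩ ⟨hY, hY'⟩
    refine ⟨Submodule.add_mem _ hX hY, fun i j => ?_⟩
    simp only [Matrix.add_apply, add_mul, mul_add, Finset.sum_add_distrib]
    linear_combination hX' i j + hY' i j
  zero_mem' := ⟨Submodule.zero_mem _, fun i j => by simp⟩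
  smul_mem' := by
    rintro c X ⟨hX, hX'⟩
    refine ⟨Submodule.smul_mem _ c hX, fun i j => ?_⟩
    have h := congrArg (fun z => c * z) (hX' i j)
    simp only [mul_add, mul_zero, Finset.mul_sum] at h
    simp only [Matrix.smul_apply, smul_eq_mul, Finset.mul_sum]
    rw [← h]
    congr 1 <;> refine Finset.sum_congr rfl fun k _ => ?_ <;> ring

theorem preserving_mul (par : n → ZMod 2) (B : Matrix n n ℂ) {p q : ZMod 2}
    {X Y : Matrix n n ℂ} (hX : X ∈ preservingPart par B p) (hY : Y ∈ preservingPart par B q)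
    (i j : n) :
    ∑ k, (X * Y) k i * B k j = sgn (p * q) * sgn ((p + q) * par i) * ∑ k, B i k * (Y * X) k j := by
  have key : ∀ l, Y l i * ∑ k, X k l * B k j
      = - (sgn (p * (q + par i)) * (Y l i * ∑ k, B l k * X k j)) := by
    intro l
    by_cases h : par l + par i = q
    · have h3 : par i + par i = 0 := CharTwo.add_self_eq_zero _
      have h4 : par l = q + par i := by linear_combination h - h3
      have h5 := hX.2 l j
      rw [h4] at h5
      linear_combination Y l i * h5
    · rw [hY.1 l i h]
      ring
  have e1 : ∑ k, (X * Y) k i * B k j = ∑ l, Y l i * ∑ k, X k l * B k j := by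
    simp only [Matrix.mul_apply, Finset.sum_mul, Finset.mul_sum]
    rw [Finset.sum_comm]
    refine Finset.sum_congr rfl fun l _ => Finset.sum_congr rfl fun k _ => ?_
    ring
  have e2 : ∑ l, Y l i * ∑ k, B l k * X k j = ∑ k, (∑ l, Y l i * B l k) * X k j := by
    simp only [Finset.sum_mul, Finset.mul_sum]
    rw [Finset.sum_comm]
    refine Finset.sum_congr rfl fun l _ => Finset.sum_congr rfl fun k _ => ?_
    ring
  have e3 : ∑ k, (∑ l, Y l i * B l k) * X k j
      = - (sgn (q * par i) * ∑ k, B i k * (Y * X) k j) := by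
    have e4 : ∑ k, B i k * (Y * X) k j = ∑ k, (∑ l, B i l * Y l k) * X k j := by
      simp only [Matrix.mul_apply, Finset.sum_mul, Finset.mul_sum]
      rw [Finset.sum_comm]
      refine Finset.sum_congr rfl fun l _ => Finset.sum_congr rfl fun k _ => ?_
      ring
    rw [e4, Finset.mul_sum, ← Finset.sum_neg_distrib]
    refine Finset.sum_congr rfl fun k _ => ?_
    linear_combination X k j * hY.2 i k
  rw [e1, Finset.sum_congr rfl fun l _ => key l, Finset.sum_neg_distrib, ← Finset.mul_sum, e2, e3,
    add_mul, sgn_add, mul_add, sgn_add]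
  ring

/-- The Lie superalgebra of all endomorphisms that preserve the even bilinear form `B`:
`spo(V, B)` if `B` is `(-1)`-supersymmetric, `osp(V, B)` if `B` is supersymmetric. -/
def orthosymplectic (par : n → ZMod 2) (B : Matrix n n ℂ) : MatrixSuperalgebra par where
  part := preservingPart par B
  homogeneous _ _ hX := hX.1
  bracket_mem := by
    intro p q X Y hX hY
    refine ⟨superBracket_mem_homPart par hX.1 hY.1, fun i j => ?_⟩
    have h1 := preserving_mul par B hX hY i j
    have h2 := preserving_mul par B hY hX i j
    have h3 := sgn_mul_self (p * q)
    rw [mul_comm q p, add_comm q p] at h2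
    simp only [superBracket, Matrix.sub_apply, Matrix.smul_apply, smul_eq_mul, sub_mul, mul_sub,
      Finset.sum_sub_distrib]
    have a1 : ∑ k, sgn (p * q) * (Y * X) k i * B k j
        = sgn (p * q) * ∑ k, (Y * X) k i * B k j := by
      rw [Finset.mul_sum]
      exact Finset.sum_congr rfl fun k _ => by ring
    have a2 : ∑ k, B i k * (sgn (p * q) * (Y * X) k j)
        = sgn (p * q) * ∑ k, B i k * (Y * X) k j := by
      rw [Finset.mul_sum]
      exact Finset.sum_congr rfl fun k _ => by ring
    rw [a1, a2, h1, h2]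
    linear_combination (-(sgn ((p + q) * par i)) * ∑ k, B i k * (X * Y) k j) * h3

/-- A representation of the Lie superalgebra `𝔰` on a `ℤ/2`-graded complex vector space. -/
structure SuperRep {par : n → ZMod 2} (𝔰 : MatrixSuperalgebra par)
    (M : Type*) [AddCommGroup M] [Module ℂ M] where
  grading : ZMod 2 → Submodule ℂ M
  isInternal : DirectSum.IsInternal grading
  act : ∀ p, 𝔰.part p →ₗ[ℂ] Module.End ℂ M
  act_mem : ∀ {p q} (X : 𝔰.part p) {m : M}, m ∈ grading q → act p X m ∈ grading (p + q)
  act_bracket : ∀ {p q} (X : 𝔰.part p) (Y : 𝔰.part q),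
    act (p + q) ⟨superBracket p q X Y, 𝔰.bracket_mem X.2 Y.2⟩
      = act p X * act q Y - sgn (p * q) • (act q Y * act p X)

/-- Irreducibility: the space is nonzero, and `0` and the whole space are the only graded
invariant subspaces. -/
def SuperRep.IsIrreducible {par : n → ZMod 2} {𝔰 : MatrixSuperalgebra par}
    {M : Type*} [AddCommGroup M] [Module ℂ M] (ρ : SuperRep 𝔰 M) : Prop :=
  Nontrivial M ∧ ∀ N : Submodule ℂ M, N = ⨆ p, N ⊓ ρ.grading p →
    (∀ p (X : 𝔰.part p), ∀ m ∈ N, ρ.act p X m ∈ N) → N = ⊥ ∨ N = ⊤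

end Superalgebras

/-! ### The superspaces `V = ℂ^{2|1}` and `V' = ℂ^{2|2}` -/

/-- Parities of the basis `u₁, u₂, u₃` of `V`. -/
def parV : Fin 3 → ZMod 2 := ![0, 0, 1]

/-- The form `B` on `V` in the basis `u₁, u₂, u₃`. -/
def formV : Matrix (Fin 3) (Fin 3) ℂ := !![0, 1, 0; -1, 0, 0; 0, 0, 1]

/-- Parities of the basis `v₁, v₂, w₁, w₂` of `V'`. -/
def parV' : Fin 4 → ZMod 2 := ![0, 0, 1, 1]

/-- The form `B'` on `V'` in the basis `v₁, v₂, w₁, w₂`. -/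
def formV' : Matrix (Fin 4) (Fin 4) ℂ := !![0, 1, 0, 0; 1, 0, 0, 0; 0, 0, 0, 1; 0, 0, -1, 0]

/-- `𝔤 = spo(2|1)`. -/
def spo21 : MatrixSuperalgebra parV := orthosymplectic parV formV

/-- `𝔤' = osp(2|2)`. -/
def osp22 : MatrixSuperalgebra parV' := orthosymplectic parV' formV'

/-- The isotropic subspace `X' = ℂ v₁ ⊕ ℂ w₁` of `V'`. -/
def subX : Submodule ℂ (Fin 4 → ℂ) := Submodule.span ℂ {Pi.single 0 1, Pi.single 2 1}

/-- The isotropic subspace `Y' = ℂ v₂ ⊕ ℂ w₂` of `V'`. -/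
def subY : Submodule ℂ (Fin 4 → ℂ) := Submodule.span ℂ {Pi.single 1 1, Pi.single 3 1}

/-- The part of parity `p` of `𝔨' = {T ∈ 𝔤' : T X' ⊆ X', T Y' ⊆ Y'}`. -/
def kPart (p : ZMod 2) : Set (Matrix (Fin 4) (Fin 4) ℂ) :=
  {T | T ∈ osp22.part p ∧ subX.map T.toLin' ≤ subX ∧ subY.map T.toLin' ≤ subY}

/-- The part of parity `p` of `𝔫'⁺ = {T ∈ 𝔤' : T X' ⊆ Y', T Y' = 0}`. -/
def nPlusPart (p : ZMod 2) : Set (Matrix (Fin 4) (Fin 4) ℂ) :=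
  {T | T ∈ osp22.part p ∧ subX.map T.toLin' ≤ subY ∧ subY.map T.toLin' = ⊥}

/-- Parities of the basis `e = v₁, f = w₁` of `X'`. -/
def parX : Fin 2 → ZMod 2 := ![0, 1]

/-- `gl(1|1) = gl(X')`. -/
def gl11 : MatrixSuperalgebra parX := gl parX

/-- The restriction `𝔨' → gl(X')`, in the basis `v₁, w₁` of `X'`. -/
def restrictX (T : Matrix (Fin 4) (Fin 4) ℂ) : Matrix (Fin 2) (Fin 2) ℂ :=
  T.submatrix ![0, 2] ![0, 2]

/-! ### The spinor-oscillator representation -/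

/-- The index `(i, a)` stands for the basis vector `u_i ⊗ v'_a` of `Ẽ = V ⊗ V'`, where
`v'` is the basis `v₁, v₂, w₁, w₂`. -/
abbrev Idx : Type := Fin 3 × Fin 4

/-- The form `B̃(v₁ ⊗ v₁', v₂ ⊗ v₂') = (-1)^{|v₁'||v₂|} B(v₁, v₂) B'(v₁', v₂')` on `Ẽ`. -/
def formE : Matrix Idx Idx ℂ :=
  fun a b => sgn (parV' a.2 * parV b.1) * formV a.1 b.1 * formV' a.2 b.2

/-- The action `X (v ⊗ v') = X v ⊗ v'` of `𝔤` on `Ẽ`. -/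
def actG (X : Matrix (Fin 3) (Fin 3) ℂ) : Matrix Idx Idx ℂ :=
  fun a b => X a.1 b.1 * (1 : Matrix (Fin 4) (Fin 4) ℂ) a.2 b.2

/-- The action `T (v ⊗ v') = (-1)^{p|v|} v ⊗ T v'` on `Ẽ` of an element `T` of `𝔤'` of
parity `p`. -/
def actG' (p : ZMod 2) (T : Matrix (Fin 4) (Fin 4) ℂ) : Matrix Idx Idx ℂ :=
  fun a b => sgn (p * parV b.1) * (1 : Matrix (Fin 3) (Fin 3) ℂ) a.1 b.1 * T a.2 b.2

/-- The even basis vectors `x₁ = u₁ ⊗ v₁`, `x₂ = u₂ ⊗ v₁`, `x₃ = u₃ ⊗ w₁` of `E = V ⊗ X'`. -/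
def xIdx : Fin 3 → Idx := ![(0, 0), (1, 0), (2, 2)]

/-- The odd basis vectors `η₁ = u₁ ⊗ w₁`, `η₂ = u₂ ⊗ w₁`, `η₃ = u₃ ⊗ v₁` of `E = V ⊗ X'`. -/
def etaIdx : Fin 3 → Idx := ![(0, 2), (1, 2), (2, 0)]

/-- The exterior algebra of the odd part of `E`, on `η₁, η₂, η₃`. -/
abbrev Ext : Type := ExteriorAlgebra ℂ (Fin 3 → ℂ)

/-- The supersymmetric algebra `S(E)`: the tensor product of the symmetric algebra of the even
part of `E`, i.e. the polynomials in `x₁, x₂, x₃`, and the exterior algebra of the odd part. -/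
abbrev SE : Type := MvPolynomial (Fin 3) ℂ ⊗[ℂ] Ext

/-- Multiplication by `x_i`. -/
def mulX (i : Fin 3) : Module.End ℂ SE :=
  TensorProduct.map (LinearMap.mulLeft ℂ (MvPolynomial.X i)) LinearMap.id

/-- Multiplication by `η_i`. -/
def mulEta (i : Fin 3) : Module.End ℂ SE :=
  TensorProduct.map LinearMap.id
    (LinearMap.mulLeft ℂ (ExteriorAlgebra.ι ℂ (Pi.single i 1 : Fin 3 → ℂ)))

/-- The derivation `∂/∂x_i`. -/
def dX (i : Fin 3) : Module.End ℂ SE :=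
  TensorProduct.map (MvPolynomial.pderiv i).toLinearMap LinearMap.id

/-- The odd (left) derivation `∂/∂η_i`. -/
def dEta (i : Fin 3) : Module.End ℂ SE :=
  TensorProduct.map LinearMap.id
    (CliffordAlgebra.contractLeft (Q := (0 : QuadraticForm ℂ (Fin 3 → ℂ)))
      (LinearMap.proj i : (Fin 3 → ℂ) →ₗ[ℂ] ℂ))

/-- The embedding `ι` of `Ẽ = E ⊕ (V ⊗ Y')` into `End S(E)`: an element of `E` acts by
multiplication, and `y ∈ V ⊗ Y'`, identified with the linear form `B̃(y, ·)` on `E`, acts by the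
superderivation extending this linear form. (As `E` is isotropic, `B̃(c, ·)` restricted to `E`
depends only on the component of `c` in `V ⊗ Y'`.) The supercommutator of `ι(c)` and `ι(c')` is
the scalar `B̃(c, c')`. -/
def iota (c : Idx → ℂ) : Module.End ℂ SE :=
  ∑ i, (c (xIdx i) • mulX i + c (etaIdx i) • mulEta i
    + (∑ a, c a * formE a (xIdx i)) • dX i + (∑ a, c a * formE a (etaIdx i)) • dEta i)

/-- The spinor-oscillator representation `ω` of `spo(Ẽ, B̃)` on `S(E)`:
`ω(Z) = ½ ∑_a ι(Z e_a) ι(e^a)`, where `(e_a)` is the standard basis of `Ẽ` and `(e^a)` its dual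
basis, `B̃(e^a, e_b) = δ_{ab}`, i.e. `e^a = ∑_b (B̃⁻¹)_{ab} e_b`. For `Z` in `spo(Ẽ, B̃)` this is the
quadratic element of the Weyl-Clifford algebra with `[ω(Z), ι(c)] = ι(Z c)` for all `c`. -/
def omega (Z : Matrix Idx Idx ℂ) : Module.End ℂ SE :=
  (1 / 2 : ℂ) • ∑ a, ∑ b, formE⁻¹ a b • (iota (fun k => Z k a) * iota (Pi.single b 1))

/-- The degree `d` part `S^d(E)`. -/
def degreePart (d : ℕ) : Submodule ℂ SE :=
  ⨆ (i : ℕ) (j : ℕ) (_ : i + j = d),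
    Submodule.map₂ (TensorProduct.mk ℂ (MvPolynomial (Fin 3) ℂ) Ext)
      (MvPolynomial.homogeneousSubmodule (Fin 3) ℂ i) (⋀[ℂ]^j (Fin 3 → ℂ))

/-- The part of `S(E)` of parity `p`. -/
def parityPart (p : ZMod 2) : Submodule ℂ SE :=
  Submodule.map₂ (TensorProduct.mk ℂ (MvPolynomial (Fin 3) ℂ) Ext) ⊤
    (CliffordAlgebra.evenOdd (0 : QuadraticForm ℂ (Fin 3 → ℂ)) p)

/-- The harmonic tensors of degree `d`: the elements of `S^d(E)` annihilated by `𝔫'⁺`. -/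
def harmonics (d : ℕ) : Submodule ℂ SE :=
  degreePart d ⊓ ⨅ p, ⨅ T ∈ nPlusPart p, LinearMap.ker (omega (actG' p T))

/-! ### Highest weight modules -/

/-- `E₁₁ - E₂₂`, spanning the Cartan subalgebra of `spo(2|1)`. -/
def spoH : spo21.part 0 := ⟨!![1, 0, 0; 0, -1, 0; 0, 0, 0], by
  refine ⟨fun i j => ?_, fun i j => ?_⟩ <;> fin_cases i <;> fin_cases j <;>
    simp [parV, formV, sgn, Fin.sum_univ_three]⟩

/-- The even positive root vector `E₁₂` of `spo(2|1)`. -/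
def spoE : spo21.part 0 := ⟨!![0, 1, 0; 0, 0, 0; 0, 0, 0], by
  refine ⟨fun i j => ?_, fun i j => ?_⟩ <;> fin_cases i <;> fin_cases j <;>
    simp [parV, formV, sgn, Fin.sum_univ_three]⟩

/-- The odd positive root vector `E₁₃ + E₃₂` of `spo(2|1)`. -/
def spoQ : spo21.part 1 := ⟨!![0, 0, 1; 0, 0, 0; 0, 1, 0], by
  refine ⟨fun i j => ?_, fun i j => ?_⟩ <;> fin_cases i <;> fin_cases j <;>
    simp [parV, formV, sgn, Fin.sum_univ_three, ZMod.val_one]⟩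

/-- `ρ` is the irreducible `spo(2|1)`-module `V_{(α)}` of highest weight `α`. -/
def IsSpoIrrep {M : Type*} [AddCommGroup M] [Module ℂ M] (ρ : SuperRep spo21 M) (α : ℂ) : Prop :=
  ρ.IsIrreducible ∧ ∃ p, ∃ v ∈ ρ.grading p, v ≠ 0 ∧
    ρ.act 0 spoE v = 0 ∧ ρ.act 1 spoQ v = 0 ∧ ρ.act 0 spoH v = α • v

/-- The matrix unit `E₁₁` of `gl(1|1)`. -/
def glE11 : gl11.part 0 := ⟨!![1, 0; 0, 0], by
  intro i j
  fin_cases i <;> fin_cases j <;> simp [parX]⟩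

/-- The matrix unit `E₂₂` of `gl(1|1)`. -/
def glE22 : gl11.part 0 := ⟨!![0, 0; 0, 1], by
  intro i j
  fin_cases i <;> fin_cases j <;> simp [parX]
  decide⟩

/-- The matrix unit `E₁₂`, the positive root vector of `gl(1|1)`. -/
def glE12 : gl11.part 1 := ⟨!![0, 1; 0, 0], by
  intro i j
  fin_cases i <;> fin_cases j <;> simp [parX]⟩

/-- `τ` is the irreducible `gl(1|1)`-module `V_{(β, γ)}` of highest weight `μ = (β, γ)`. -/
def IsGlIrrep {M : Type*} [AddCommGroup M] [Module ℂ M] (τ : SuperRep gl11 M) (μ : ℂ × ℂ) : Prop :=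
  τ.IsIrreducible ∧ ∃ p, ∃ v ∈ τ.grading p, v ≠ 0 ∧
    τ.act 1 glE12 v = 0 ∧ τ.act 0 glE11 v = μ.1 • v ∧ τ.act 0 glE22 v = μ.2 • v

universe u

/-- As a module over `spo(2|1) + gl(1|1)`, where `gl(1|1) = gl(X')` is identified with `𝔨'`, the
harmonics of degree `d` are the direct sum of the `V_{(α i)} ⊗ V_{(μ i)}` over `i < r`: all these
irreducible modules exist, and for every choice of them (each is determined up to isomorphism and
a change of parity) there is an isomorphism `Φ`. It intertwines the actions
`X (v ⊗ w) = X v ⊗ w` and `A (v ⊗ w) = (-1)^{|A||v|} v ⊗ A w` with the actions on `S(E)`, and on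
each summand it preserves or reverses the parity. -/
def HarmonicsDecomposeAs (d : ℕ) {r : ℕ} (α : Fin r → ℂ) (μ : Fin r → ℂ × ℂ) : Prop :=
  (∀ i, ∃ (M : Type) (_ : AddCommGroup M) (_ : Module ℂ M) (ρ : SuperRep spo21 M),
    IsSpoIrrep ρ (α i)) ∧
  (∀ i, ∃ (M : Type) (_ : AddCommGroup M) (_ : Module ℂ M) (τ : SuperRep gl11 M),
    IsGlIrrep τ (μ i)) ∧
  ∀ (V W : Fin r → Type u) [∀ i, AddCommGroup (V i)] [∀ i, Module ℂ (V i)]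
    [∀ i, AddCommGroup (W i)] [∀ i, Module ℂ (W i)]
    (ρ : ∀ i, SuperRep spo21 (V i)) (τ : ∀ i, SuperRep gl11 (W i)),
    (∀ i, IsSpoIrrep (ρ i) (α i)) → (∀ i, IsGlIrrep (τ i) (μ i)) →
    ∃ Φ : (⨁ i, V i ⊗[ℂ] W i) ≃ₗ[ℂ] harmonics d,
      (∀ i p (X : spo21.part p) (v : V i) (w : W i),
        omega (actG X) (Φ (DirectSum.lof ℂ _ (fun i => V i ⊗[ℂ] W i) i (v ⊗ₜ w)))
          = Φ (DirectSum.lof ℂ _ (fun i => V i ⊗[ℂ] W i) i ((ρ i).act p X v ⊗ₜ w))) ∧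
      (∀ i p (A : gl11.part p), ∀ T ∈ kPart p, restrictX T = A →
        ∀ q, ∀ v ∈ (ρ i).grading q, ∀ w : W i,
          omega (actG' p T) (Φ (DirectSum.lof ℂ _ (fun i => V i ⊗[ℂ] W i) i (v ⊗ₜ w)))
            = sgn (p * q) •
              Φ (DirectSum.lof ℂ _ (fun i => V i ⊗[ℂ] W i) i (v ⊗ₜ (τ i).act p A w))) ∧
      ∀ i, ∃ ε : ZMod 2, ∀ p q, ∀ v ∈ (ρ i).grading p, ∀ w ∈ (τ i).grading q,
        (Φ (DirectSum.lof ℂ _ (fun i => V i ⊗[ℂ] W i) i (v ⊗ₜ w)) : SE) ∈ parityPart (p + q + ε)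

end SpoOsp

end

noncomputable section

namespace SpoOsp

/-! ### Weyl-Clifford relations -/

/-! Notation: `mulX 0` is multiplication by x₁, `mulEta 0` by η₁, and so on. In S(E) = ℂ[x₁,x₂,x₃] ⊗
Λ(η₁,η₂,η₃) the representation ω is given by quadratic operators. The algebra spo(2|1) is generated
by its odd root vectors, which act by `opP` and `opN`. The algebra gl(1|1) acts by `opE`, `opF` and
the partial degrees `deg₁`, `deg₂` shifted by 1/2 and -1/2, whence the half-integers in the weights.
Finally 𝔫'⁺ acts by multiples of `opD` and `opL`, so the harmonics of degree d are the common kernel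
of these two operators. The decomposition follows from an upper bound for the dimension that is met
by explicit vectors.

Upper bound. Since `opE` squares to zero and preserves the harmonics, their dimension is at most
twice that of the kernel of `opE` on them, the space `singular d` (`finrank_harmonics_le`). As `opL`
is the anticommutator of `opD` and `opE`, a singular vector is just a solution of D z = E z = 0.
Along the products of the η_i this is a linear differential system for eight polynomials
(`singular_components`). The η₁η₂-component vanishes and the top component is constant, hence zero
unless d = 3. Once it is zero, the scalar component and the η₃-component are at most linear in x₃,
and they determine the rest (`singular_eq_zero`). Counting coefficients gives 4d for d ≥ 1, d ≠ 3,
sharpened to 3 for d = 1, and 13 for d = 3. Degree 0 is treated directly.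

Lower bound. The vectors x₁^d, x₁^(d-1) x₃ + x₁^(d-2) η₁η₃ (for d ≥ 2) and one further cubic vector
for d = 3 are highest for both algebras. If h is one of them, of spo-weight n, the vectors N^k F^j h
with k ≤ 2n and j ≤ 1 (only j = 0 if d = 0) are nonzero. Over all h they are eigenvectors of a
single operator with distinct eigenvalues (`linearIndependent_descend`). Their number equals the
upper bound, so they form a basis of the harmonics.

Identification. The irreducible spo(2|1)-module of highest weight n has the basis N^k v, k ≤ 2n
(`exists_spo_basis`). The gl(1|1)-module of weight (β,γ) has the basis w, Fw, or only w if β+γ = 0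
(`exists_gl_basis`); here β+γ = d for every summand. Sending the products of these basis vectors to
N^k F^j h, with a sign that accounts for the parity of v, intertwines both actions. Existence of the
modules is shown by explicit models. -/

theorem mulX_tmul (i : Fin 3) (p : MvPolynomial (Fin 3) ℂ) (y : Ext) :
    mulX i (p ⊗ₜ y) = (MvPolynomial.X i * p) ⊗ₜ y := rfl

theorem dX_tmul (i : Fin 3) (p : MvPolynomial (Fin 3) ℂ) (y : Ext) :
    dX i (p ⊗ₜ y) = (MvPolynomial.pderiv i p) ⊗ₜ y := rfl

theorem mulEta_tmul (i : Fin 3) (p : MvPolynomial (Fin 3) ℂ) (y : Ext) :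
    mulEta i (p ⊗ₜ y) = p ⊗ₜ (ExteriorAlgebra.ι ℂ (Pi.single i 1) * y) := rfl

theorem dEta_tmul (i : Fin 3) (p : MvPolynomial (Fin 3) ℂ) (y : Ext) :
    dEta i (p ⊗ₜ y) = p ⊗ₜ (CliffordAlgebra.contractLeft
      (Q := (0 : QuadraticForm ℂ (Fin 3 → ℂ))) (LinearMap.proj i) y) := rfl

/-- Two linear maps on `S(E)` agree if they agree on pure tensors. -/
theorem SE_ext {M : Type*} [AddCommGroup M] [Module ℂ M] {A B : SE →ₗ[ℂ] M}
    (h : ∀ p y, A (p ⊗ₜ y) = B (p ⊗ₜ y)) (z : SE) : A z = B z :=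
  LinearMap.congr_fun (TensorProduct.ext' h) z

theorem dX_mulX_self (i : Fin 3) (z : SE) : dX i (mulX i z) = mulX i (dX i z) + z := by
  refine SE_ext (A := dX i * mulX i) (B := mulX i * dX i + 1) (fun p y => ?_) z
  simp only [Module.End.mul_apply, LinearMap.add_apply, Module.End.one_apply, mulX_tmul, dX_tmul,
    Derivation.leibniz, MvPolynomial.pderiv_X_self, smul_eq_mul, mul_one, ← TensorProduct.add_tmul]

theorem dX_mulX_of_ne {i j : Fin 3} (h : i ≠ j) (z : SE) :
    dX i (mulX j z) = mulX j (dX i z) := by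
  refine SE_ext (A := dX i * mulX j) (B := mulX j * dX i) (fun p y => ?_) z
  simp only [Module.End.mul_apply, mulX_tmul, dX_tmul, Derivation.leibniz,
    MvPolynomial.pderiv_X_of_ne h.symm, smul_eq_mul, mul_zero, add_zero]

theorem mulX_comm (i j : Fin 3) (z : SE) : mulX i (mulX j z) = mulX j (mulX i z) := by
  refine SE_ext (A := mulX i * mulX j) (B := mulX j * mulX i) (fun p y => ?_) z
  simp only [Module.End.mul_apply, mulX_tmul, mul_left_comm]

theorem pderiv_comm (i j : Fin 3) (p : MvPolynomial (Fin 3) ℂ) :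
    MvPolynomial.pderiv i (MvPolynomial.pderiv j p)
      = MvPolynomial.pderiv j (MvPolynomial.pderiv i p) := by
  ext m
  simp only [MvPolynomial.coeff_pderiv]
  rcases eq_or_ne i j with rfl | h
  · rfl
  · rw [add_right_comm m]
    simp only [Finsupp.add_apply, Finsupp.single_apply, h, h.symm, if_false, add_zero]
    ring

theorem dX_comm (i j : Fin 3) (z : SE) : dX i (dX j z) = dX j (dX i z) := by
  refine SE_ext (A := dX i * dX j) (B := dX j * dX i) (fun p y => ?_) z
  simp only [Module.End.mul_apply, dX_tmul, pderiv_comm i j]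

theorem mulEta_mulX (i j : Fin 3) (z : SE) : mulEta i (mulX j z) = mulX j (mulEta i z) :=
  SE_ext (A := mulEta i * mulX j) (B := mulX j * mulEta i) (fun _ _ => rfl) z

theorem dEta_mulX (i j : Fin 3) (z : SE) : dEta i (mulX j z) = mulX j (dEta i z) :=
  SE_ext (A := dEta i * mulX j) (B := mulX j * dEta i) (fun _ _ => rfl) z

theorem dX_mulEta (i j : Fin 3) (z : SE) : dX i (mulEta j z) = mulEta j (dX i z) :=
  SE_ext (A := dX i * mulEta j) (B := mulEta j * dX i) (fun _ _ => rfl) z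

theorem dEta_dX (i j : Fin 3) (z : SE) : dEta i (dX j z) = dX j (dEta i z) :=
  SE_ext (A := dEta i * dX j) (B := dX j * dEta i) (fun _ _ => rfl) z

theorem ι_mul_ι_mul (v w : Fin 3 → ℂ) (y : Ext) :
    ExteriorAlgebra.ι ℂ v * (ExteriorAlgebra.ι ℂ w * y)
      = -(ExteriorAlgebra.ι ℂ w * (ExteriorAlgebra.ι ℂ v * y)) := by
  rw [← mul_assoc, ← mul_assoc, eq_neg_iff_add_eq_zero, ← add_mul, ExteriorAlgebra.ι_add_mul_swap,
    zero_mul]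

theorem mulEta_comm (i j : Fin 3) (z : SE) : mulEta i (mulEta j z) = -mulEta j (mulEta i z) := by
  refine SE_ext (A := mulEta i * mulEta j) (B := -(mulEta j * mulEta i)) (fun p y => ?_) z
  simp only [Module.End.mul_apply, LinearMap.neg_apply, mulEta_tmul]
  rw [ι_mul_ι_mul, TensorProduct.tmul_neg]

theorem mulEta_self (i : Fin 3) (z : SE) : mulEta i (mulEta i z) = 0 := by
  refine SE_ext (A := mulEta i * mulEta i) (B := 0) (fun p y => ?_) z
  simp only [Module.End.mul_apply, LinearMap.zero_apply, mulEta_tmul]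
  rw [← mul_assoc, ExteriorAlgebra.ι_sq_zero, zero_mul, TensorProduct.tmul_zero]

theorem dEta_comm (i j : Fin 3) (z : SE) : dEta i (dEta j z) = -dEta j (dEta i z) := by
  refine SE_ext (A := dEta i * dEta j) (B := -(dEta j * dEta i)) (fun p y => ?_) z
  simp only [Module.End.mul_apply, LinearMap.neg_apply, dEta_tmul]
  rw [CliffordAlgebra.contractLeft_comm, TensorProduct.tmul_neg]

theorem dEta_self (i : Fin 3) (z : SE) : dEta i (dEta i z) = 0 := by
  refine SE_ext (A := dEta i * dEta i) (B := 0) (fun p y => ?_) z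
  simp only [Module.End.mul_apply, LinearMap.zero_apply, dEta_tmul]
  rw [CliffordAlgebra.contractLeft_contractLeft, TensorProduct.tmul_zero]

theorem dEta_mulEta_self (i : Fin 3) (z : SE) : dEta i (mulEta i z) = z - mulEta i (dEta i z) := by
  refine SE_ext (A := dEta i * mulEta i) (B := 1 - mulEta i * dEta i) (fun p y => ?_) z
  simp only [Module.End.mul_apply, LinearMap.sub_apply, Module.End.one_apply, mulEta_tmul,
    dEta_tmul]
  rw [← TensorProduct.tmul_sub, CliffordAlgebra.contractLeft_ι_mul]
  simp

theorem dEta_mulEta_of_ne {i j : Fin 3} (h : i ≠ j) (z : SE) :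
    dEta i (mulEta j z) = -mulEta j (dEta i z) := by
  refine SE_ext (A := dEta i * mulEta j) (B := -(mulEta j * dEta i)) (fun p y => ?_) z
  simp only [Module.End.mul_apply, LinearMap.neg_apply, mulEta_tmul, dEta_tmul]
  rw [CliffordAlgebra.contractLeft_ι_mul, ← TensorProduct.tmul_neg]
  simp [h]

/-! ### The representation in terms of the generators -/

/-- The form pairs each basis vector with exactly one basis vector, with value 1 or -1. Its matrix
is therefore a signed permutation matrix, which is inverted by transposition. -/
theorem formE_inv : formE⁻¹ = Matrix.transpose formE := by
  refine Matrix.inv_eq_right_inv ?_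
  ext ⟨i, a⟩ ⟨j, b⟩
  rw [Matrix.mul_apply, Fintype.sum_prod_type]
  fin_cases i <;> fin_cases a <;> fin_cases j <;> fin_cases b <;>
    simp [Matrix.transpose_apply, formE, formV, formV', parV, parV', sgn, Fin.sum_univ_three,
      Fin.sum_univ_four, ZMod.val_one]

/-- The operators `ι(u_i ⊗ v'_a)`. -/
def gen (b : Idx) : Module.End ℂ SE :=
  (![![mulX 0, dX 1, mulEta 0, -dEta 1], ![mulX 1, -dX 0, mulEta 1, dEta 0],
    ![mulEta 2, dEta 2, mulX 2, dX 2]] : Fin 3 → Fin 4 → Module.End ℂ SE) b.1 b.2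

/-- The operators `ι(e^a)` for the basis dual to `u_i ⊗ v'_a`. -/
def dualGen (b : Idx) : Module.End ℂ SE :=
  (![![dX 0, -mulX 1, dEta 0, -mulEta 1], ![dX 1, mulX 0, dEta 1, mulEta 0],
    ![dEta 2, mulEta 2, dX 2, -mulX 2]] : Fin 3 → Fin 4 → Module.End ℂ SE) b.1 b.2

theorem iota_eq_sum (c : Idx → ℂ) : iota c = ∑ b, c b • gen b := by
  simp only [iota, Fintype.sum_prod_type, Fin.sum_univ_three, Fin.sum_univ_four, gen, formE,
    xIdx, etaIdx]
  simp [formV, formV', parV, parV', sgn, ZMod.val_one]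
  module

theorem dualGen_eq_sum (a : Idx) : dualGen a = ∑ b, formE b a • gen b := by
  obtain ⟨i, a⟩ := a
  rw [Fintype.sum_prod_type]
  fin_cases i <;> fin_cases a <;>
    simp [Fin.sum_univ_three, Fin.sum_univ_four, gen, dualGen, formE, formV, formV', parV, parV',
      sgn, ZMod.val_one] <;> module

/-- The inner sum against the inverse form collapses to ι(e^a), tabulated in `dualGen`. This turns ω
into an explicit quadratic expression in multiplications and derivations. -/
theorem omega_eq (Z : Matrix Idx Idx ℂ) :
    omega Z = (1 / 2 : ℂ) • ∑ a, ∑ k, Z k a • (gen k * dualGen a) := by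
  rw [omega, formE_inv]
  refine congrArg _ (Finset.sum_congr rfl fun a _ => ?_)
  have h : ∀ b, iota (Pi.single b 1) = gen b := fun b => by
    rw [iota_eq_sum, Finset.sum_eq_single b] <;> simp +contextual
  rw [dualGen_eq_sum, ← Finset.sum_congr rfl fun k _ => smul_mul_assoc (Z k a) (gen k) _,
    ← Finset.sum_mul, ← iota_eq_sum, Finset.mul_sum]
  refine Finset.sum_congr rfl fun b _ => ?_
  rw [h, Matrix.transpose_apply, mul_smul_comm]

theorem omega_add (Z W : Matrix Idx Idx ℂ) : omega (Z + W) = omega Z + omega W := by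
  simp only [omega_eq, Matrix.add_apply, add_smul, Finset.sum_add_distrib, smul_add]

theorem omega_smul (c : ℂ) (Z : Matrix Idx Idx ℂ) : omega (c • Z) = c • omega Z := by
  simp only [omega_eq, Matrix.smul_apply, smul_eq_mul, mul_smul, ← Finset.smul_sum,
    smul_comm c (1 / 2 : ℂ)]


theorem sum_actG {A : Type*} [Ring A] [Module ℂ A] (g h : Idx → A)
    (X : Matrix (Fin 3) (Fin 3) ℂ) :
    ∑ a, ∑ k, actG X k a • (g k * h a) = ∑ j, ∑ i, X i j • ∑ a, g (i, a) * h (j, a) := by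
  rw [Fintype.sum_prod_type]
  refine Finset.sum_congr rfl fun j _ => ?_
  simp only [Fintype.sum_prod_type, actG, Finset.smul_sum]
  rw [Finset.sum_comm]
  refine Finset.sum_congr rfl fun i _ => Finset.sum_congr rfl fun a _ => ?_
  rw [Finset.sum_eq_single a]
  · simp
  · intro b _ hb
    simp [hb]
  · simp

theorem sum_actG' {A : Type*} [Ring A] [Module ℂ A] (g h : Idx → A) (p : ZMod 2)
    (T : Matrix (Fin 4) (Fin 4) ℂ) :
    ∑ a, ∑ k, actG' p T k a • (g k * h a)
      = ∑ b, ∑ a, T a b • ∑ i, sgn (p * parV i) • (g (i, a) * h (i, b)) := by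
  rw [Fintype.sum_prod_type_right]
  refine Finset.sum_congr rfl fun b _ => ?_
  simp only [Fintype.sum_prod_type, actG', Finset.smul_sum]
  rw [Finset.sum_comm (s := Finset.univ (α := Fin 4))]
  refine Finset.sum_congr rfl fun i _ => ?_
  rw [Finset.sum_eq_single i]
  · refine Finset.sum_congr rfl fun a _ => ?_
    rw [Matrix.one_apply_eq, mul_one, mul_smul, smul_comm]
  · intro j _ hj
    simp [hj]
  · simp

/-- `ω(X)` for `X` in `gl(V)`. -/
theorem omega_actG (X : Matrix (Fin 3) (Fin 3) ℂ) : omega (actG X) =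
    (1 / 2 : ℂ) • ∑ j, ∑ i, X i j • ∑ a, gen (i, a) * dualGen (j, a) :=
  (omega_eq _).trans (congrArg ((1 / 2 : ℂ) • ·) (sum_actG gen dualGen X))

/-- `ω(T)` for `T` in `gl(V')` of parity `p`. -/
theorem omega_actG' (p : ZMod 2) (T : Matrix (Fin 4) (Fin 4) ℂ) : omega (actG' p T) =
    (1 / 2 : ℂ) • ∑ b, ∑ a, T a b • ∑ i, sgn (p * parV i) • (gen (i, a) * dualGen (i, b)) :=
  (omega_eq _).trans (congrArg ((1 / 2 : ℂ) • ·) (sum_actG' gen dualGen p T))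

/-! ### Bases of the Lie superalgebras -/

/-- The even negative root vector `E₂₁` of `spo(2|1)`. -/
def spoF : spo21.part 0 := ⟨!![0, 0, 0; 1, 0, 0; 0, 0, 0], by
  refine ⟨fun i j => ?_, fun i j => ?_⟩ <;> fin_cases i <;> fin_cases j <;>
    simp [parV, formV, sgn, Fin.sum_univ_three]⟩

/-- The odd negative root vector `E₂₃ - E₃₁` of `spo(2|1)`. -/
def spoN : spo21.part 1 := ⟨!![0, 0, 0; 0, 0, 1; -1, 0, 0], by
  refine ⟨fun i j => ?_, fun i j => ?_⟩ <;> fin_cases i <;> fin_cases j <;>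
    simp [parV, formV, sgn, Fin.sum_univ_three, ZMod.val_one]⟩

/-- Parity kills the mixed entries. Invariance of the pairs (u₁,u₂) and (u₃,u₃) gives X₂₂ = -X₁₁ and
X₃₃ = 0. -/
theorem spo_even_eq (X : spo21.part 0) :
    X = X.1 0 0 • spoH + X.1 0 1 • spoE + X.1 1 0 • spoF := by
  obtain ⟨X, hX, hX'⟩ := X
  have h01 := hX' 0 1
  have h22 := hX' 2 2
  have a := hX 0 2 (by decide)
  have b := hX 1 2 (by decide)
  have c := hX 2 0 (by decide)
  have d := hX 2 1 (by decide)
  simp [formV, parV, sgn, Fin.sum_univ_three] at h01 h22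
  ext i j
  fin_cases i <;> fin_cases j <;> simp [spoH, spoE, spoF, a, b, c, d]
  · linear_combination h01
  · exact h22

theorem spo_odd_eq (X : spo21.part 1) : X = X.1 0 2 • spoQ + X.1 1 2 • spoN := by
  obtain ⟨X, hX, hX'⟩ := X
  have h02 := hX' 0 2
  have h12 := hX' 1 2
  have a := hX 0 0 (by decide)
  have b := hX 0 1 (by decide)
  have c := hX 1 0 (by decide)
  have d := hX 1 1 (by decide)
  have e := hX 2 2 (by decide)
  simp [formV, parV, sgn, Fin.sum_univ_three] at h02 h12
  ext i j
  fin_cases i <;> fin_cases j <;> simp [spoQ, spoN, a, b, c, d, e]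
  · linear_combination h02
  · linear_combination h12

/-- The matrix unit `E₂₁` of `gl(1|1)`. -/
def glE21 : gl11.part 1 := ⟨!![0, 0; 1, 0], by
  intro i j
  fin_cases i <;> fin_cases j <;> simp [parX]⟩

theorem gl_even_eq (A : gl11.part 0) : A = A.1 0 0 • glE11 + A.1 1 1 • glE22 := by
  obtain ⟨A, hA⟩ := A
  have a := hA 0 1 (by decide)
  have b := hA 1 0 (by decide)
  ext i j
  fin_cases i <;> fin_cases j <;> simp [glE11, glE22, a, b]

theorem gl_odd_eq (A : gl11.part 1) : A = A.1 0 1 • glE12 + A.1 1 0 • glE21 := by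
  obtain ⟨A, hA⟩ := A
  have a := hA 0 0 (by decide)
  have b := hA 1 1 (by decide)
  ext i j
  fin_cases i <;> fin_cases j <;> simp [glE12, glE21, a, b]

/-! ### The operators of the dual pair -/

/-- `ω(E₁₃ + E₃₂)` for `spo(2|1)`. -/
def opP : Module.End ℂ SE :=
  mulX 0 * dEta 2 + mulEta 2 * dX 1 + mulEta 0 * dX 2 + mulX 2 * dEta 1

/-- `ω(E₂₃ - E₃₁)` for `spo(2|1)`. -/
def opN : Module.End ℂ SE :=
  mulX 1 * dEta 2 - mulEta 2 * dX 0 + mulEta 1 * dX 2 - mulX 2 * dEta 0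

/-- `ω(E₁₁ - E₂₂)` for `spo(2|1)`. -/
def opH : Module.End ℂ SE :=
  mulX 0 * dX 0 - mulX 1 * dX 1 + mulEta 0 * dEta 0 - mulEta 1 * dEta 1

/-- `ω(E₁₂)` for `gl(1|1)`. -/
def opE : Module.End ℂ SE := mulX 0 * dEta 0 + mulX 1 * dEta 1 - mulEta 2 * dX 2

/-- `ω(E₂₁)` for `gl(1|1)`. -/
def opF : Module.End ℂ SE := mulEta 0 * dX 0 + mulEta 1 * dX 1 - mulX 2 * dEta 2

/-- `ω(E₁₁) - 1/2` for `gl(1|1)`. -/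
def deg₁ : Module.End ℂ SE := mulX 0 * dX 0 + mulX 1 * dX 1 + mulEta 2 * dEta 2

/-- `ω(E₂₂) + 1/2` for `gl(1|1)`. -/
def deg₂ : Module.End ℂ SE := mulEta 0 * dEta 0 + mulEta 1 * dEta 1 + mulX 2 * dX 2

/-- The odd generator of `ω(𝔫'⁺)`. -/
def opD : Module.End ℂ SE := dX 1 * dEta 0 - dX 0 * dEta 1 - dX 2 * dEta 2

/-- Twice the even generator of `ω(𝔫'⁺)`. -/
def opL : Module.End ℂ SE := dX 2 * dX 2 + (2 : ℂ) • (dEta 0 * dEta 1)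

theorem opP_apply (z : SE) : opP z =
    mulX 0 (dEta 2 z) + mulEta 2 (dX 1 z) + mulEta 0 (dX 2 z) + mulX 2 (dEta 1 z) := rfl

theorem opN_apply (z : SE) : opN z =
    mulX 1 (dEta 2 z) - mulEta 2 (dX 0 z) + mulEta 1 (dX 2 z) - mulX 2 (dEta 0 z) := rfl

theorem opH_apply (z : SE) : opH z =
    mulX 0 (dX 0 z) - mulX 1 (dX 1 z) + mulEta 0 (dEta 0 z) - mulEta 1 (dEta 1 z) := rfl

theorem opE_apply (z : SE) : opE z =
    mulX 0 (dEta 0 z) + mulX 1 (dEta 1 z) - mulEta 2 (dX 2 z) := rfl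

theorem opF_apply (z : SE) : opF z =
    mulEta 0 (dX 0 z) + mulEta 1 (dX 1 z) - mulX 2 (dEta 2 z) := rfl

theorem deg₁_apply (z : SE) : deg₁ z =
    mulX 0 (dX 0 z) + mulX 1 (dX 1 z) + mulEta 2 (dEta 2 z) := rfl

theorem deg₂_apply (z : SE) : deg₂ z =
    mulEta 0 (dEta 0 z) + mulEta 1 (dEta 1 z) + mulX 2 (dX 2 z) := rfl

theorem opD_apply (z : SE) : opD z = dX 1 (dEta 0 z) - dX 0 (dEta 1 z) - dX 2 (dEta 2 z) := rfl

theorem opL_apply (z : SE) : opL z = dX 2 (dX 2 z) + (2 : ℂ) • dEta 0 (dEta 1 z) := rfl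

/-- The rewriting rules to the normal order `x, η, ∂/∂x, ∂/∂η` of operators. -/
theorem normalOrder (z : SE) :
    (∀ i j, mulEta i (mulX j z) = mulX j (mulEta i z)) ∧
    (∀ i j, dEta i (mulX j z) = mulX j (dEta i z)) ∧
    (∀ i j, dX i (mulEta j z) = mulEta j (dX i z)) ∧
    (∀ i j, dEta i (dX j z) = dX j (dEta i z)) ∧
    (∀ i j, dX i (mulX j z) = mulX j (dX i z) + if i = j then z else 0) ∧
    (∀ i j, dEta i (mulEta j z) = -mulEta j (dEta i z) + if i = j then z else 0) ∧
    mulX 1 (mulX 0 z) = mulX 0 (mulX 1 z) ∧ mulX 2 (mulX 0 z) = mulX 0 (mulX 2 z) ∧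
    mulX 2 (mulX 1 z) = mulX 1 (mulX 2 z) ∧ dX 1 (dX 0 z) = dX 0 (dX 1 z) ∧
    dX 2 (dX 0 z) = dX 0 (dX 2 z) ∧ dX 2 (dX 1 z) = dX 1 (dX 2 z) ∧
    mulEta 1 (mulEta 0 z) = -mulEta 0 (mulEta 1 z) ∧
    mulEta 2 (mulEta 0 z) = -mulEta 0 (mulEta 2 z) ∧
    mulEta 2 (mulEta 1 z) = -mulEta 1 (mulEta 2 z) ∧ dEta 1 (dEta 0 z) = -dEta 0 (dEta 1 z) ∧
    dEta 2 (dEta 0 z) = -dEta 0 (dEta 2 z) ∧ dEta 2 (dEta 1 z) = -dEta 1 (dEta 2 z) ∧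
    (∀ i, mulEta i (mulEta i z) = 0) ∧ ∀ i, dEta i (dEta i z) = 0 := by
  refine ⟨fun i j => mulEta_mulX i j z, fun i j => dEta_mulX i j z, fun i j => dX_mulEta i j z,
    fun i j => dEta_dX i j z, fun i j => ?_, fun i j => ?_, mulX_comm 1 0 z, mulX_comm 2 0 z,
    mulX_comm 2 1 z, dX_comm 1 0 z, dX_comm 2 0 z, dX_comm 2 1 z, mulEta_comm 1 0 z,
    mulEta_comm 2 0 z, mulEta_comm 2 1 z, dEta_comm 1 0 z, dEta_comm 2 0 z, dEta_comm 2 1 z,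
    fun i => mulEta_self i z, fun i => dEta_self i z⟩
  · split_ifs with h
    · rw [h, dX_mulX_self]
    · rw [dX_mulX_of_ne h, add_zero]
  · split_ifs with h
    · rw [h, dEta_mulEta_self, sub_eq_neg_add]
    · rw [dEta_mulEta_of_ne h, add_zero]

/-! ### Commutation relations of the two algebras and of 𝔫'⁺, by normal ordering. -/

section Relations

set_option linter.unusedSimpArgs false

/-- As for all relations of this section, `normalOrder` brings both sides to the order x, η, ∂/∂x,
∂/∂η. The cubic and quartic terms then cancel and only a linear identity is left. -/
theorem opP_opN (z : SE) : opP (opN z) = -opN (opP z) - opH z := by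
  simp only [opP_apply, opN_apply, opH_apply, map_add, map_sub, map_neg, map_zero, neg_zero,
    normalOrder, Fin.reduceEq, if_true, if_false, add_zero, sub_zero]
  abel

theorem opH_opN (z : SE) : opH (opN z) = opN (opH z) - opN z := by
  simp only [opH_apply, opN_apply, map_add, map_sub, map_neg, map_zero, neg_zero,
    normalOrder, Fin.reduceEq, if_true, if_false, add_zero, sub_zero]
  abel

theorem opH_opP (z : SE) : opH (opP z) = opP (opH z) + opP z := by
  simp only [opH_apply, opP_apply, map_add, map_sub, map_neg, map_zero, neg_zero,
    normalOrder, Fin.reduceEq, if_true, if_false, add_zero, sub_zero]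
  abel

theorem opE_opF (z : SE) : opE (opF z) = -opF (opE z) + (deg₁ z + deg₂ z) := by
  simp only [opE_apply, opF_apply, deg₁_apply, deg₂_apply, map_add, map_sub, map_neg, map_zero,
    neg_zero,
    normalOrder, Fin.reduceEq, if_true, if_false, add_zero, sub_zero]
  abel

theorem opE_opE (z : SE) : opE (opE z) = 0 := by
  simp only [opE_apply, map_add, map_sub, map_neg, map_zero, neg_zero,
    normalOrder, Fin.reduceEq, if_true, if_false, add_zero, sub_zero]
  abel

theorem opF_opF (z : SE) : opF (opF z) = 0 := by
  simp only [opF_apply, map_add, map_sub, map_neg, map_zero, neg_zero,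
    normalOrder, Fin.reduceEq, if_true, if_false, add_zero, sub_zero]
  abel

theorem deg₁_opF (z : SE) : deg₁ (opF z) = opF (deg₁ z) - opF z := by
  simp only [deg₁_apply, opF_apply, map_add, map_sub, map_neg, map_zero, neg_zero,
    normalOrder, Fin.reduceEq, if_true, if_false, add_zero, sub_zero]
  abel

theorem deg₂_opF (z : SE) : deg₂ (opF z) = opF (deg₂ z) + opF z := by
  simp only [deg₂_apply, opF_apply, map_add, map_sub, map_neg, map_zero, neg_zero,
    normalOrder, Fin.reduceEq, if_true, if_false, add_zero, sub_zero]
  abel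

theorem deg₁_opE (z : SE) : deg₁ (opE z) = opE (deg₁ z) + opE z := by
  simp only [deg₁_apply, opE_apply, map_add, map_sub, map_neg, map_zero, neg_zero,
    normalOrder, Fin.reduceEq, if_true, if_false, add_zero, sub_zero]
  abel

theorem deg₂_opE (z : SE) : deg₂ (opE z) = opE (deg₂ z) - opE z := by
  simp only [deg₂_apply, opE_apply, map_add, map_sub, map_neg, map_zero, neg_zero,
    normalOrder, Fin.reduceEq, if_true, if_false, add_zero, sub_zero]
  abel

theorem opE_opN (z : SE) : opE (opN z) = -opN (opE z) := by
  simp only [opE_apply, opN_apply, map_add, map_sub, map_neg, map_zero, neg_zero,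
    normalOrder, Fin.reduceEq, if_true, if_false, add_zero, sub_zero]
  abel

theorem opF_opN (z : SE) : opF (opN z) = -opN (opF z) := by
  simp only [opF_apply, opN_apply, map_add, map_sub, map_neg, map_zero, neg_zero,
    normalOrder, Fin.reduceEq, if_true, if_false, add_zero, sub_zero]
  abel

theorem opF_opP (z : SE) : opF (opP z) = -opP (opF z) := by
  simp only [opF_apply, opP_apply, map_add, map_sub, map_neg, map_zero, neg_zero,
    normalOrder, Fin.reduceEq, if_true, if_false, add_zero, sub_zero]
  abel

theorem deg₁_opN (z : SE) : deg₁ (opN z) = opN (deg₁ z) := by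
  simp only [deg₁_apply, opN_apply, map_add, map_sub, map_neg, map_zero, neg_zero,
    normalOrder, Fin.reduceEq, if_true, if_false, add_zero, sub_zero]
  abel

theorem deg₂_opN (z : SE) : deg₂ (opN z) = opN (deg₂ z) := by
  simp only [deg₂_apply, opN_apply, map_add, map_sub, map_neg, map_zero, neg_zero,
    normalOrder, Fin.reduceEq, if_true, if_false, add_zero, sub_zero]
  abel

theorem opD_opN (z : SE) : opD (opN z) = -opN (opD z) := by
  simp only [opD_apply, opN_apply, map_add, map_sub, map_neg, map_zero, neg_zero,
    normalOrder, Fin.reduceEq, if_true, if_false, add_zero, sub_zero]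
  abel

theorem opD_opF (z : SE) : opD (opF z) = -opF (opD z) := by
  simp only [opD_apply, opF_apply, map_add, map_sub, map_neg, map_zero, neg_zero,
    normalOrder, Fin.reduceEq, if_true, if_false, add_zero, sub_zero]
  abel

/-- The even generator of 𝔫'⁺ arises as the anticommutator of the odd one with E. On the kernel of
`opE` the condition for `opL` is thus implied by the one for `opD`. -/
theorem opD_opE (z : SE) : opD (opE z) = -opE (opD z) + opL z := by
  simp only [opD_apply, opE_apply, opL_apply, map_add, map_sub, map_neg, map_zero, map_smul,
    neg_zero,
    normalOrder, Fin.reduceEq, if_true, if_false, add_zero, sub_zero]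
  module

theorem opL_opN (z : SE) : opL (opN z) = opN (opL z) := by
  simp only [opL_apply, opN_apply, map_add, map_sub, map_neg, map_zero, map_smul, neg_zero,
    normalOrder, Fin.reduceEq, if_true, if_false, add_zero, sub_zero]
  module

theorem opL_opF (z : SE) : opL (opF z) = opF (opL z) + (2 : ℂ) • opD z := by
  simp only [opL_apply, opF_apply, opD_apply, map_add, map_sub, map_neg, map_zero, map_smul,
    neg_zero,
    normalOrder, Fin.reduceEq, if_true, if_false, add_zero, sub_zero]
  module

theorem opL_opE (z : SE) : opL (opE z) = opE (opL z) := by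
  simp only [opL_apply, opE_apply, map_add, map_sub, map_neg, map_zero, map_smul, neg_zero,
    normalOrder, Fin.reduceEq, if_true, if_false, add_zero, sub_zero]
  module

/-! ### The representation in terms of the operators -/

theorem omega_spoQ : omega (actG spoQ.1) = opP := by
  refine LinearMap.ext fun z => ?_
  rw [omega_actG]
  simp [Fin.sum_univ_three, Fin.sum_univ_four, spoQ, gen, dualGen, opP_apply, normalOrder]
  module

theorem omega_spoN : omega (actG spoN.1) = opN := by
  refine LinearMap.ext fun z => ?_
  rw [omega_actG]
  simp [Fin.sum_univ_three, Fin.sum_univ_four, spoN, gen, dualGen, opN_apply, normalOrder]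
  module

theorem omega_spoH : omega (actG spoH.1) = opH := by
  refine LinearMap.ext fun z => ?_
  rw [omega_actG]
  simp [Fin.sum_univ_three, Fin.sum_univ_four, spoH, gen, dualGen, opH_apply, normalOrder]
  module

/-- E₁₂ is half the superbracket of E₁₃ + E₃₂ with itself, so it acts by the square of `opP`.
Likewise E₂₁ acts by minus the square of `opN`. Hence intertwining needs to be checked only for the
odd root vectors. -/
theorem omega_spoE : omega (actG spoE.1) = opP * opP := by
  refine LinearMap.ext fun z => ?_
  rw [omega_actG]
  simp [Fin.sum_univ_three, Fin.sum_univ_four, spoE, gen, dualGen, opP_apply, normalOrder]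
  module

theorem omega_spoF : omega (actG spoF.1) = -(opN * opN) := by
  refine LinearMap.ext fun z => ?_
  rw [omega_actG]
  simp [Fin.sum_univ_three, Fin.sum_univ_four, spoF, gen, dualGen, opN_apply, normalOrder]
  module

end Relations

theorem parity_cases : ∀ p : ZMod 2, p = 0 ∨ p = 1 := by decide

theorem actG_add (X Y : Matrix (Fin 3) (Fin 3) ℂ) : actG (X + Y) = actG X + actG Y := by
  ext a b
  simp [actG, add_mul]

theorem actG_smul (c : ℂ) (X : Matrix (Fin 3) (Fin 3) ℂ) : actG (c • X) = c • actG X := by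
  ext a b
  simp [actG, mul_assoc]

theorem omega_spo_even (X : spo21.part 0) : omega (actG X.1) =
    X.1 0 0 • opH + X.1 0 1 • (opP * opP) - X.1 1 0 • (opN * opN) := by
  conv_lhs => rw [spo_even_eq X]
  simp only [Submodule.coe_add, Submodule.coe_smul, actG_add, actG_smul, omega_add, omega_smul,
    omega_spoH, omega_spoE, omega_spoF]
  module

theorem omega_spo_odd (X : spo21.part 1) : omega (actG X.1) =
    X.1 0 2 • opP + X.1 1 2 • opN := by
  conv_lhs => rw [spo_odd_eq X]
  simp only [Submodule.coe_add, Submodule.coe_smul, actG_add, actG_smul, omega_add, omega_smul,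
    omega_spoQ, omega_spoN]

/-! ### The operators of 𝔨' and 𝔫'⁺. -/

theorem eq_zero_of_mem_subX {v : Fin 4 → ℂ} (h : v ∈ subX) : v 1 = 0 ∧ v 3 = 0 := by
  obtain ⟨a, b, rfl⟩ := Submodule.mem_span_pair.1 h
  simp

theorem eq_zero_of_mem_subY {v : Fin 4 → ℂ} (h : v ∈ subY) : v 0 = 0 ∧ v 2 = 0 := by
  obtain ⟨a, b, rfl⟩ := Submodule.mem_span_pair.1 h
  simp

theorem single_mem_subX : (Pi.single 0 1 : Fin 4 → ℂ) ∈ subX ∧ (Pi.single 2 1 : Fin 4 → ℂ) ∈ subX :=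
  ⟨Submodule.subset_span (by simp), Submodule.subset_span (by simp)⟩

theorem single_mem_subY : (Pi.single 1 1 : Fin 4 → ℂ) ∈ subY ∧ (Pi.single 3 1 : Fin 4 → ℂ) ∈ subY :=
  ⟨Submodule.subset_span (by simp), Submodule.subset_span (by simp)⟩

theorem kPart_blocks {p : ZMod 2} {T : Matrix (Fin 4) (Fin 4) ℂ} (hT : T ∈ kPart p) :
    T 1 0 = 0 ∧ T 3 0 = 0 ∧ T 1 2 = 0 ∧ T 3 2 = 0 ∧ T 0 1 = 0 ∧ T 2 1 = 0 ∧ T 0 3 = 0 ∧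
      T 2 3 = 0 := by
  obtain ⟨-, hX, hY⟩ := hT
  have a := eq_zero_of_mem_subX (hX (Submodule.mem_map_of_mem single_mem_subX.1))
  have b := eq_zero_of_mem_subX (hX (Submodule.mem_map_of_mem single_mem_subX.2))
  have c := eq_zero_of_mem_subY (hY (Submodule.mem_map_of_mem single_mem_subY.1))
  have d := eq_zero_of_mem_subY (hY (Submodule.mem_map_of_mem single_mem_subY.2))
  simp only [Matrix.toLin'_apply, Matrix.mulVec_single_one, Matrix.col_apply] at a b c d
  exact ⟨a.1, a.2, b.1, b.2, c.1, c.2, d.1, d.2⟩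

theorem nPlusPart_blocks {p : ZMod 2} {T : Matrix (Fin 4) (Fin 4) ℂ} (hT : T ∈ nPlusPart p) :
    (T 0 0 = 0 ∧ T 2 0 = 0 ∧ T 0 2 = 0 ∧ T 2 2 = 0) ∧ ∀ i, T i 1 = 0 ∧ T i 3 = 0 := by
  obtain ⟨-, hX, hY⟩ := hT
  have a := eq_zero_of_mem_subY (hX (Submodule.mem_map_of_mem single_mem_subX.1))
  have b := eq_zero_of_mem_subY (hX (Submodule.mem_map_of_mem single_mem_subX.2))
  have c := (Submodule.mem_bot ℂ).1 (hY ▸ Submodule.mem_map_of_mem single_mem_subY.1)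
  have d := (Submodule.mem_bot ℂ).1 (hY ▸ Submodule.mem_map_of_mem single_mem_subY.2)
  simp only [Matrix.toLin'_apply, Matrix.mulVec_single_one, Matrix.col_apply] at a b c d
  exact ⟨⟨a.1, a.2, b.1, b.2⟩, fun i => ⟨congrFun c i, congrFun d i⟩⟩

/-- The operator of the matrix unit `E_{ab}` in the formula for `ω` on `gl(V')`. -/
def block (p : ZMod 2) (a b : Fin 4) : Module.End ℂ SE :=
  ∑ i, sgn (p * parV i) • (gen (i, a) * dualGen (i, b))

theorem block_even (z : SE) : block 0 0 0 z = deg₁ z ∧ block 0 1 1 z = -deg₁ z - z ∧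
    block 0 2 2 z = deg₂ z ∧ block 0 3 3 z = z - deg₂ z ∧ block 0 3 2 z = opL z := by
  simp only [block, Fin.sum_univ_three, zero_mul, LinearMap.add_apply, LinearMap.smul_apply,
    Module.End.mul_apply]
  refine ⟨?_, ?_, ?_, ?_, ?_⟩ <;>
    simp [sgn, gen, dualGen, deg₁_apply, deg₂_apply, opL_apply, normalOrder] <;> module

theorem block_odd (z : SE) : block 1 0 2 z = opE z ∧ block 1 3 1 z = opE z ∧
    block 1 2 0 z = opF z ∧ block 1 1 3 z = -opF z ∧ block 1 3 0 z = opD z ∧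
    block 1 1 2 z = opD z := by
  simp only [block, Fin.sum_univ_three, one_mul, LinearMap.add_apply, LinearMap.smul_apply,
    Module.End.mul_apply]
  refine ⟨?_, ?_, ?_, ?_, ?_, ?_⟩ <;>
    simp [sgn, parV, ZMod.val_one, gen, dualGen, opE_apply, opF_apply, opD_apply, normalOrder] <;>
    module

theorem omega_actG'_apply (p : ZMod 2) (T : Matrix (Fin 4) (Fin 4) ℂ) (z : SE) :
    omega (actG' p T) z = (1 / 2 : ℂ) • ∑ b, ∑ a, T a b • block p a b z := by
  rw [omega_actG']
  simp only [LinearMap.smul_apply, LinearMap.sum_apply]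
  rfl

/-- Invariance of B' gives T₁₁ = -T₀₀ and T₃₃ = -T₂₂, so the contributions of X' and Y' agree up to
reordering. The scalars left by the reordering, halved, are the shifts 1/2 and -1/2. -/
theorem omega_k_even {T : Matrix (Fin 4) (Fin 4) ℂ} (hT : T ∈ kPart 0) (z : SE) :
    omega (actG' 0 T) z
      = T 0 0 • (deg₁ z + (1 / 2 : ℂ) • z) + T 2 2 • (deg₂ z - (1 / 2 : ℂ) • z) := by
  have hb := kPart_blocks hT
  have h1 := hT.1.2 0 1
  have h2 := hT.1.2 2 3
  have h3 := hT.1.1 0 2 (by decide)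
  have h4 := hT.1.1 2 0 (by decide)
  have h5 := hT.1.1 1 3 (by decide)
  have h6 := hT.1.1 3 1 (by decide)
  simp [formV', parV', sgn, Fin.sum_univ_four] at h1 h2
  have h1 := eq_neg_of_add_eq_zero_right h1
  have h2 := eq_neg_of_add_eq_zero_right h2
  simp only [omega_actG'_apply, Fin.sum_univ_four, hb, h1, h2, h3, h4, h5, h6, zero_smul,
    block_even, add_zero, zero_add]
  module

theorem omega_k_odd {T : Matrix (Fin 4) (Fin 4) ℂ} (hT : T ∈ kPart 1) (z : SE) :
    omega (actG' 1 T) z = T 0 2 • opE z + T 2 0 • opF z := by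
  have hb := kPart_blocks hT
  have h1 := hT.1.2 0 3
  have h2 := hT.1.2 2 1
  have h3 := hT.1.1 0 0 (by decide)
  have h4 := hT.1.1 1 1 (by decide)
  have h5 := hT.1.1 2 2 (by decide)
  have h6 := hT.1.1 3 3 (by decide)
  simp [formV', parV', sgn, Fin.sum_univ_four, ZMod.val_one] at h1 h2
  have h1 := eq_neg_of_add_eq_zero_right h1
  have h2 : T 3 1 = T 0 2 := by linear_combination -h2
  simp only [omega_actG'_apply, Fin.sum_univ_four, hb, h1, h2, h3, h4, h5, h6, zero_smul,
    block_odd, add_zero, zero_add]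
  module

theorem omega_nPlus_even {T : Matrix (Fin 4) (Fin 4) ℂ} (hT : T ∈ nPlusPart 0) (z : SE) :
    omega (actG' 0 T) z = (T 3 2 / 2) • opL z := by
  have hb := nPlusPart_blocks hT
  have h1 := hT.1.2 0 0
  have h2 := hT.1.1 3 0 (by decide)
  have h3 := hT.1.1 1 2 (by decide)
  simp [formV', parV', sgn, Fin.sum_univ_four] at h1
  simp only [omega_actG'_apply, Fin.sum_univ_four, hb, h1, h2, h3, zero_smul, block_even, add_zero,
    zero_add]
  module

theorem omega_nPlus_odd {T : Matrix (Fin 4) (Fin 4) ℂ} (hT : T ∈ nPlusPart 1) (z : SE) :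
    omega (actG' 1 T) z = T 3 0 • opD z := by
  have hb := nPlusPart_blocks hT
  have h1 := hT.1.2 0 2
  have h2 := hT.1.1 1 0 (by decide)
  have h3 := hT.1.1 3 2 (by decide)
  simp [formV', parV', sgn, Fin.sum_univ_four] at h1
  have h1 : T 1 2 = T 3 0 := by linear_combination h1
  simp only [omega_actG'_apply, Fin.sum_univ_four, hb, h1, h2, h3, zero_smul, block_odd, add_zero,
    zero_add]
  module

theorem mem_nPlusPart {p : ZMod 2} {T : Matrix (Fin 4) (Fin 4) ℂ} (hT : T ∈ osp22.part p)
    (h : T 0 0 = 0 ∧ T 2 0 = 0 ∧ T 0 2 = 0 ∧ T 2 2 = 0) (h' : ∀ i, T i 1 = 0 ∧ T i 3 = 0) :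
    T ∈ nPlusPart p := by
  refine ⟨hT, ?_, ?_⟩
  · rw [subX, Submodule.map_span_le]
    rintro v (rfl | rfl) <;> refine Submodule.mem_span_pair.2 ?_
    · refine ⟨T 1 0, T 3 0, ?_⟩
      ext i
      fin_cases i <;> simp [h]
    · refine ⟨T 1 2, T 3 2, ?_⟩
      ext i
      fin_cases i <;> simp [h]
  · rw [← le_bot_iff, subY, Submodule.map_span_le]
    rintro v (rfl | rfl) <;> rw [Submodule.mem_bot] <;> ext i <;> simp [h' i]

/-- The even generator of `𝔫'⁺`. -/
theorem nPlus_even_mem : (!![0, 0, 0, 0; 0, 0, 0, 0; 0, 0, 0, 0; 0, 0, 1, 0] :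
    Matrix (Fin 4) (Fin 4) ℂ) ∈ nPlusPart 0 := by
  refine mem_nPlusPart ⟨fun i j => ?_, fun i j => ?_⟩ (by simp) (fun i => ?_)
  · fin_cases i <;> fin_cases j <;> simp [parV']
    decide
  · fin_cases i <;> fin_cases j <;> simp [parV', formV', sgn, Fin.sum_univ_four]
  · fin_cases i <;> simp

/-- The odd generator of `𝔫'⁺`. -/
theorem nPlus_odd_mem : (!![0, 0, 0, 0; 0, 0, 1, 0; 0, 0, 0, 0; 1, 0, 0, 0] :
    Matrix (Fin 4) (Fin 4) ℂ) ∈ nPlusPart 1 := by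
  refine mem_nPlusPart ⟨fun i j => ?_, fun i j => ?_⟩ (by simp) (fun i => ?_)
  · fin_cases i <;> fin_cases j <;> simp [parV']
  · fin_cases i <;> fin_cases j <;> simp [parV', formV', sgn, Fin.sum_univ_four, ZMod.val_one]
  · fin_cases i <;> simp

/-- Both the even and the odd part of 𝔫'⁺ are lines, spanned by the two matrices above, so one
equation for each parity remains. -/
theorem mem_harmonics {d : ℕ} {z : SE} :
    z ∈ harmonics d ↔ z ∈ degreePart d ∧ opD z = 0 ∧ opL z = 0 := by
  simp only [harmonics, Submodule.mem_inf, Submodule.mem_iInf, LinearMap.mem_ker]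
  refine and_congr_right fun _ => ⟨fun h => ⟨?_, ?_⟩, fun h p T hT => ?_⟩
  · simpa [omega_nPlus_odd nPlus_odd_mem] using h 1 _ nPlus_odd_mem
  · simpa [omega_nPlus_even nPlus_even_mem] using h 0 _ nPlus_even_mem
  · obtain rfl | rfl := parity_cases p
    · simp [omega_nPlus_even hT, h.2]
    · simp [omega_nPlus_odd hT, h.1]

/-! ### Components of the elements of `S(E)` -/

/-- The component in degree `0` with respect to the odd variables. -/
def vac : SE →ₗ[ℂ] MvPolynomial (Fin 3) ℂ :=
  (TensorProduct.rid ℂ (MvPolynomial (Fin 3) ℂ)).toLinearMap ∘ₗ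
    TensorProduct.map LinearMap.id ExteriorAlgebra.algebraMapInv.toLinearMap

/-- The inclusion of the polynomials in the even variables into `S(E)`. -/
def ofPoly : MvPolynomial (Fin 3) ℂ →ₗ[ℂ] SE :=
  (TensorProduct.mk ℂ (MvPolynomial (Fin 3) ℂ) Ext).flip 1

theorem vac_tmul (p : MvPolynomial (Fin 3) ℂ) (y : Ext) :
    vac (p ⊗ₜ y) = ExteriorAlgebra.algebraMapInv y • p := rfl

theorem vac_mulX (i : Fin 3) (z : SE) : vac (mulX i z) = MvPolynomial.X i * vac z := by
  refine SE_ext (A := vac ∘ₗ mulX i)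
    (B := LinearMap.mulLeft ℂ (MvPolynomial.X i) ∘ₗ vac) (fun p y => ?_) z
  simp [vac_tmul, mulX_tmul]

theorem vac_dX (i : Fin 3) (z : SE) : vac (dX i z) = MvPolynomial.pderiv i (vac z) := by
  refine SE_ext (A := vac ∘ₗ dX i)
    (B := (MvPolynomial.pderiv i).toLinearMap ∘ₗ vac) (fun p y => ?_) z
  simp [vac_tmul, dX_tmul]

theorem vac_mulEta (i : Fin 3) (z : SE) : vac (mulEta i z) = 0 := by
  refine SE_ext (A := vac ∘ₗ mulEta i) (B := 0) (fun p y => ?_) z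
  simp [vac_tmul, mulEta_tmul, ExteriorAlgebra.algebraMapInv]

theorem ofPoly_apply (p : MvPolynomial (Fin 3) ℂ) : ofPoly p = p ⊗ₜ 1 := rfl

theorem vac_ofPoly (p : MvPolynomial (Fin 3) ℂ) : vac (ofPoly p) = p := by
  simp [ofPoly_apply, vac_tmul]

theorem dEta_ofPoly (i : Fin 3) (p : MvPolynomial (Fin 3) ℂ) : dEta i (ofPoly p) = 0 := by
  simp [ofPoly_apply, dEta_tmul]

theorem dX_ofPoly (i : Fin 3) (p : MvPolynomial (Fin 3) ℂ) :
    dX i (ofPoly p) = ofPoly (MvPolynomial.pderiv i p) := rfl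

theorem mulX_ofPoly (i : Fin 3) (p : MvPolynomial (Fin 3) ℂ) :
    mulX i (ofPoly p) = ofPoly (MvPolynomial.X i * p) := rfl

theorem tmul_ι_mul (p : MvPolynomial (Fin 3) ℂ) (v : Fin 3 → ℂ) (y : Ext) :
    p ⊗ₜ[ℂ] (ExteriorAlgebra.ι ℂ v * y) = ∑ i, v i • mulEta i (p ⊗ₜ y) := by
  conv_lhs => rw [pi_eq_sum_univ' v]
  simp only [map_sum, map_smul, Finset.sum_mul, TensorProduct.tmul_sum, smul_mul_assoc,
    TensorProduct.tmul_smul, mulEta_tmul]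

/-- An induction principle: a subspace that contains the polynomials and is stable under
multiplication by the `η_i` is everything. -/
theorem SE_induction (U : Submodule ℂ SE) (h0 : ∀ p, ofPoly p ∈ U)
    (h1 : ∀ i, ∀ z ∈ U, mulEta i z ∈ U) (z : SE) : z ∈ U := by
  have key : ∀ (p : MvPolynomial (Fin 3) ℂ) (y : Ext), p ⊗ₜ[ℂ] y ∈ U := by
    intro p y
    induction y using CliffordAlgebra.left_induction with
    | algebraMap r =>
      rw [Algebra.algebraMap_eq_smul_one, TensorProduct.tmul_smul]
      exact U.smul_mem r (h0 p)
    | add x y hx hy =>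
      rw [TensorProduct.tmul_add]
      exact U.add_mem hx hy
    | ι_mul y v hy =>
      have := tmul_ι_mul p v y
      refine this ▸ U.sum_mem fun i _ => U.smul_mem _ (h1 i _ hy)
  induction z using TensorProduct.induction_on with
  | zero => exact U.zero_mem
  | tmul p y => exact key p y
  | add x y hx hy => exact U.add_mem hx hy

/-- The sum of the components. -/
def compSum : Module.End ℂ SE :=
  let π := ofPoly ∘ₗ vac
  π + mulEta 0 * π * dEta 0 + mulEta 1 * π * dEta 1 + mulEta 2 * π * dEta 2
    -- The derivations are applied in the order opposite to the one that strips η₁η₂ without a sign.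
    -- Thus ∂₁∂₂(η₁η₂) = -1, and likewise ∂₁∂₂∂₃(η₁η₂η₃) = -1.
    - mulEta 0 * mulEta 1 * π * dEta 0 * dEta 1 - mulEta 0 * mulEta 2 * π * dEta 0 * dEta 2
    - mulEta 1 * mulEta 2 * π * dEta 1 * dEta 2
    - mulEta 0 * mulEta 1 * mulEta 2 * π * dEta 0 * dEta 1 * dEta 2

theorem compSum_apply (z : SE) : compSum z = ofPoly (vac z)
    + mulEta 0 (ofPoly (vac (dEta 0 z))) + mulEta 1 (ofPoly (vac (dEta 1 z)))
    + mulEta 2 (ofPoly (vac (dEta 2 z)))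
    - mulEta 0 (mulEta 1 (ofPoly (vac (dEta 0 (dEta 1 z)))))
    - mulEta 0 (mulEta 2 (ofPoly (vac (dEta 0 (dEta 2 z)))))
    - mulEta 1 (mulEta 2 (ofPoly (vac (dEta 1 (dEta 2 z)))))
    - mulEta 0 (mulEta 1 (mulEta 2 (ofPoly (vac (dEta 0 (dEta 1 (dEta 2 z))))))) := rfl

/-- The identity holds on polynomials, and normal ordering carries it from z to η_i z. By
`SE_induction` it holds everywhere, so a vector vanishes as soon as its eight components do. -/
theorem compSum_eq (z : SE) : compSum z = z := by
  refine sub_eq_zero.1 (LinearMap.mem_ker.1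
    (SE_induction (LinearMap.ker (compSum - 1)) (fun p => ?_) (fun i z hz => ?_) z))
  · simp only [LinearMap.mem_ker, LinearMap.sub_apply, Module.End.one_apply, compSum_apply,
      dEta_ofPoly, map_zero, vac_ofPoly, add_zero, sub_zero, sub_self]
  · replace hz : compSum z = z := sub_eq_zero.1 (LinearMap.mem_ker.1 hz)
    rw [LinearMap.mem_ker, LinearMap.sub_apply, sub_eq_zero, Module.End.one_apply]
    conv_rhs => rw [← hz]
    fin_cases i <;>
    · simp only [compSum_apply, map_add, map_sub, map_neg, map_zero, neg_zero, normalOrder,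
        Fin.reduceEq, Fin.zero_eta, Fin.mk_one, Fin.reduceFinMk, if_true, if_false, add_zero,
        sub_zero, vac_mulEta, zero_add, neg_neg]
      abel

/-! ### The degree -/

theorem coeff_euler (p : MvPolynomial (Fin 3) ℂ) (m : Fin 3 →₀ ℕ) :
    MvPolynomial.coeff m (∑ i, MvPolynomial.X i * MvPolynomial.pderiv i p)
      = (m.degree : ℂ) * MvPolynomial.coeff m p := by
  rw [MvPolynomial.coeff_sum, Finsupp.degree_eq_sum, Nat.cast_sum, Finset.sum_mul]
  refine Finset.sum_congr rfl fun i _ => ?_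
  rw [MvPolynomial.coeff_X_mul']
  split_ifs with h
  · have h1 : Finsupp.single i 1 ≤ m := by
      simpa [Nat.one_le_iff_ne_zero] using h
    have h2 : 1 ≤ m i := by simpa using h1 i
    rw [MvPolynomial.coeff_pderiv, tsub_add_cancel_of_le h1]
    simp [Nat.cast_sub h2, mul_comm]
  · simp only [Finsupp.mem_support_iff, not_not] at h
    simp [h]

theorem isHomogeneous_of_euler {p : MvPolynomial (Fin 3) ℂ} {n : ℕ}
    (h : ∑ i, MvPolynomial.X i * MvPolynomial.pderiv i p = (n : ℂ) • p) : p.IsHomogeneous n := by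
  intro m hm
  have := coeff_euler p m
  rw [h, MvPolynomial.coeff_smul, smul_eq_mul] at this
  refine (DFunLike.congr_fun Finsupp.degree_eq_weight_one m).symm.trans ?_
  exact_mod_cast (mul_right_cancel₀ hm this).symm

/-- The eigenvalues of the Euler operator on polynomials are degrees, hence never negative. This
removes components of negative formal degree and also solves the system in `eq_zero_of_curl`. -/
theorem eq_zero_of_euler {p : MvPolynomial (Fin 3) ℂ} {n : ℕ}
    (h : ∑ i, MvPolynomial.X i * MvPolynomial.pderiv i p = (-(n : ℂ) - 1) • p) : p = 0 := by
  ext m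
  have := coeff_euler p m
  rw [h, MvPolynomial.coeff_smul, smul_eq_mul] at this
  have h1 : ((m.degree + n + 1 : ℕ) : ℂ) * MvPolynomial.coeff m p = 0 := by
    push_cast
    linear_combination -this
  exact (mul_eq_zero.1 h1).resolve_left (Nat.cast_ne_zero.2 (Nat.succ_ne_zero _))

/-- The total degree `∑ x_i ∂/∂x_i + ∑ η_i ∂/∂η_i`. -/
def deg : Module.End ℂ SE := deg₁ + deg₂

theorem deg_apply (z : SE) : deg z = deg₁ z + deg₂ z := rfl

theorem vac_deg (z : SE) :
    vac (deg z) = ∑ i, MvPolynomial.X i * MvPolynomial.pderiv i (vac z) := by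
  simp only [deg_apply, deg₁_apply, deg₂_apply, map_add, vac_mulX, vac_dX, vac_mulEta,
    Fin.sum_univ_three]
  ring

set_option linter.unusedSimpArgs false in
theorem dEta_deg (i : Fin 3) (z : SE) : dEta i (deg z) = deg (dEta i z) + dEta i z := by
  fin_cases i <;>
  · simp only [deg_apply, deg₁_apply, deg₂_apply, map_add, map_neg, map_zero, neg_zero, normalOrder,
      Fin.reduceEq, Fin.zero_eta, Fin.mk_one, Fin.reduceFinMk, if_true, if_false, add_zero]
    abel

set_option linter.unusedSimpArgs false in
theorem deg_mulEta (i : Fin 3) (z : SE) : deg (mulEta i z) = mulEta i (deg z) + mulEta i z := by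
  fin_cases i <;>
  · simp only [deg_apply, deg₁_apply, deg₂_apply, map_add, map_neg, map_zero, neg_zero, normalOrder,
      Fin.reduceEq, Fin.zero_eta, Fin.mk_one, Fin.reduceFinMk, if_true, if_false, add_zero]
    abel

theorem deg_ofPoly (p : MvPolynomial (Fin 3) ℂ) :
    deg (ofPoly p) = ofPoly (∑ i, MvPolynomial.X i * MvPolynomial.pderiv i p) := by
  simp only [deg_apply, deg₁_apply, deg₂_apply, dEta_ofPoly, dX_ofPoly, mulX_ofPoly, map_zero,
    Fin.sum_univ_three, map_add]
  abel

theorem deg_tmul {i j : ℕ} {p : MvPolynomial (Fin 3) ℂ} (hp : p.IsHomogeneous i) {y : Ext}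
    (hy : y ∈ ⋀[ℂ]^j (Fin 3 → ℂ)) : deg (p ⊗ₜ y) = ((i + j : ℕ) : ℂ) • (p ⊗ₜ y) := by
  induction hy using Submodule.pow_induction_on_left' with
  | algebraMap r =>
    rw [Algebra.algebraMap_eq_smul_one, TensorProduct.tmul_smul, map_smul, ← ofPoly_apply,
      deg_ofPoly, hp.sum_X_mul_pderiv, map_nsmul, ← Nat.cast_smul_eq_nsmul ℂ, add_zero, smul_comm]
  | add x y j hx hy ihx ihy =>
    rw [TensorProduct.tmul_add, map_add, ihx, ihy, smul_add]
  | mem_mul v hv j y hy ih =>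
    obtain ⟨v, rfl⟩ := hv
    rw [tmul_ι_mul]
    simp only [map_sum, map_smul, deg_mulEta, ih, Finset.smul_sum]
    refine Finset.sum_congr rfl fun k _ => ?_
    push_cast
    module

theorem deg_eq_of_mem_degreePart {d : ℕ} {z : SE} (hz : z ∈ degreePart d) :
    deg z = (d : ℂ) • z := by
  have : degreePart d ≤ LinearMap.ker (deg - (d : ℂ) • 1) := by
    refine iSup_le fun i => iSup_le fun j => iSup_le fun h => Submodule.map₂_le.2 ?_
    intro p hp y hy
    rw [LinearMap.mem_ker, LinearMap.sub_apply, TensorProduct.mk_apply, deg_tmul hp hy, h]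
    exact sub_self _
  exact sub_eq_zero.1 (LinearMap.mem_ker.1 (this hz))

theorem mem_degreePart_add {i j : ℕ} {p : MvPolynomial (Fin 3) ℂ} (hp : p.IsHomogeneous i) {y : Ext}
    (hy : y ∈ ⋀[ℂ]^j (Fin 3 → ℂ)) : p ⊗ₜ y ∈ degreePart (i + j) :=
  Submodule.mem_iSup_of_mem i (Submodule.mem_iSup_of_mem j (Submodule.mem_iSup_of_mem rfl
    (Submodule.apply_mem_map₂ _ hp hy)))

/-- The products of `k` of the `η_i` map a polynomial `p` into degree `d` if the Euler operator
acts on `p` by `d - k`. -/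
theorem tmul_mem_degreePart {d k : ℕ} {p : MvPolynomial (Fin 3) ℂ} {y : Ext}
    (hp : ∑ i, MvPolynomial.X i * MvPolynomial.pderiv i p = ((d : ℂ) - k) • p)
    (hy : y ∈ ⋀[ℂ]^k (Fin 3 → ℂ)) : p ⊗ₜ y ∈ degreePart d := by
  rcases le_or_gt k d with h | h
  · obtain ⟨i, rfl⟩ := Nat.exists_eq_add_of_le' h
    refine mem_degreePart_add (isHomogeneous_of_euler ?_) hy
    rw [hp]
    push_cast
    module
  · obtain ⟨i, rfl⟩ := Nat.exists_eq_add_of_lt h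
    rw [eq_zero_of_euler (p := p) (n := i), TensorProduct.zero_tmul]
    · exact Submodule.zero_mem _
    · rw [hp]
      push_cast
      module

/-- Membership in S^d(E) becomes an eigenvalue equation, which is easy to transport through the
operators. For the converse, the component along k of the η_i has Euler eigenvalue d - k. It is thus
homogeneous of that degree, or zero if k > d, and `compSum_eq` reassembles the vector. -/
theorem mem_degreePart {d : ℕ} {z : SE} : z ∈ degreePart d ↔ deg z = (d : ℂ) • z := by
  refine ⟨deg_eq_of_mem_degreePart, fun hz => ?_⟩
  have key : ∀ (k : ℕ) (w : SE), deg w = ((d : ℂ) - k) • w →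
      ∑ i, MvPolynomial.X i * MvPolynomial.pderiv i (vac w) = ((d : ℂ) - k) • vac w := by
    intro k w hw
    rw [← vac_deg, hw, map_smul]
  have step : ∀ (i : Fin 3) (k : ℕ) (w : SE), deg w = ((d : ℂ) - k) • w →
      deg (dEta i w) = ((d : ℂ) - (k + 1 : ℕ)) • dEta i w := by
    intro i k w hw
    have := dEta_deg i w
    rw [hw, map_smul] at this
    rw [eq_sub_of_add_eq this.symm]
    push_cast
    module
  have h0 : deg z = ((d : ℂ) - (0 : ℕ)) • z := by simpa using hz
  have one : ∀ i, ExteriorAlgebra.ι ℂ (Pi.single i 1 : Fin 3 → ℂ) * 1 ∈ ⋀[ℂ]^1 (Fin 3 → ℂ) := by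
    intro i
    rw [mul_one, ExteriorAlgebra.exteriorPower, pow_one]
    exact LinearMap.mem_range_self _ _
  have succ : ∀ i k, ∀ y ∈ ⋀[ℂ]^k (Fin 3 → ℂ),
      ExteriorAlgebra.ι ℂ (Pi.single i 1 : Fin 3 → ℂ) * y ∈ ⋀[ℂ]^(k + 1) (Fin 3 → ℂ) := by
    intro i k y hy
    rw [ExteriorAlgebra.exteriorPower, pow_succ']
    exact Submodule.mul_mem_mul (LinearMap.mem_range_self _ _) hy
  rw [← compSum_eq z, compSum_apply]
  simp only [ofPoly_apply, mulEta_tmul]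
  refine Submodule.sub_mem _ (Submodule.sub_mem _ (Submodule.sub_mem _ (Submodule.sub_mem _
    (Submodule.add_mem _ (Submodule.add_mem _ (Submodule.add_mem _ ?_ ?_) ?_) ?_) ?_) ?_) ?_) ?_
  · exact tmul_mem_degreePart (key 0 _ h0) (Submodule.one_le.1 (pow_zero _).ge)
  · exact tmul_mem_degreePart (key 1 _ (step _ _ _ h0)) (one _)
  · exact tmul_mem_degreePart (key 1 _ (step _ _ _ h0)) (one _)
  · exact tmul_mem_degreePart (key 1 _ (step _ _ _ h0)) (one _)
  · exact tmul_mem_degreePart (key 2 _ (step _ _ _ (step _ _ _ h0))) (succ _ _ _ (one _))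
  · exact tmul_mem_degreePart (key 2 _ (step _ _ _ (step _ _ _ h0))) (succ _ _ _ (one _))
  · exact tmul_mem_degreePart (key 2 _ (step _ _ _ (step _ _ _ h0))) (succ _ _ _ (one _))
  · exact tmul_mem_degreePart (key 3 _ (step _ _ _ (step _ _ _ (step _ _ _ h0))))
      (succ _ _ _ (succ _ _ _ (one _)))

/-! ### The parity -/

theorem contractLeft_mem_evenOdd {p : ZMod 2} (i : Fin 3) {y : Ext}
    (hy : y ∈ CliffordAlgebra.evenOdd (0 : QuadraticForm ℂ (Fin 3 → ℂ)) p) :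
    CliffordAlgebra.contractLeft (Q := (0 : QuadraticForm ℂ (Fin 3 → ℂ))) (LinearMap.proj i) y
      ∈ CliffordAlgebra.evenOdd (0 : QuadraticForm ℂ (Fin 3 → ℂ)) (1 + p) := by
  induction y, hy using CliffordAlgebra.evenOdd_induction with
  | range_ι_pow v h =>
    obtain rfl | rfl := parity_cases p
    · obtain ⟨r, rfl⟩ := Submodule.mem_one.1 (show v ∈ (1 : Submodule ℂ Ext) by simpa using h)
      rw [CliffordAlgebra.contractLeft_algebraMap]
      exact Submodule.zero_mem _
    · obtain ⟨r, rfl⟩ : v ∈ LinearMap.range (CliffordAlgebra.ι _) := by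
        simpa [ZMod.val_one] using h
      rw [CliffordAlgebra.contractLeft_ι]
      exact CliffordAlgebra.one_le_evenOdd_zero _ (Submodule.algebraMap_mem _)
  | add x y hx hy ihx ihy =>
    rw [map_add]
    exact Submodule.add_mem _ ihx ihy
  -- The contraction rule is applied twice. Each resulting term has changed parity by one, because
  -- passing two vectors does not affect it.
  | ι_mul_ι_mul a b x hx ih =>
    rw [mul_assoc, CliffordAlgebra.contractLeft_ι_mul, CliffordAlgebra.contractLeft_ι_mul]
    have h1 : ∀ (v : Fin 3 → ℂ) {q : ZMod 2} {w : Ext},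
        w ∈ CliffordAlgebra.evenOdd (0 : QuadraticForm ℂ (Fin 3 → ℂ)) q →
        CliffordAlgebra.ι 0 v * w
          ∈ CliffordAlgebra.evenOdd (0 : QuadraticForm ℂ (Fin 3 → ℂ)) (1 + q) :=
      fun v q w hw => SetLike.mul_mem_graded (CliffordAlgebra.ι_mem_evenOdd_one _ v) hw
    refine Submodule.sub_mem _ (Submodule.smul_mem _ _ (h1 _ hx)) (h1 a ?_)
    have h2 : 1 + (1 + p) = p := by rw [← add_assoc, show (1 + 1 : ZMod 2) = 0 from rfl, zero_add]
    have h3 := h1 b ih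
    rw [h2] at h3
    exact Submodule.sub_mem _ (Submodule.smul_mem _ _ hx) h3

theorem parityPart_le {p : ZMod 2} {U : Submodule ℂ SE}
    (h : ∀ q, ∀ y ∈ CliffordAlgebra.evenOdd (0 : QuadraticForm ℂ (Fin 3 → ℂ)) p, q ⊗ₜ y ∈ U) :
    parityPart p ≤ U :=
  Submodule.map₂_le.2 fun q _ y hy => h q y hy

theorem tmul_mem_parityPart {p : ZMod 2} (q : MvPolynomial (Fin 3) ℂ) {y : Ext}
    (hy : y ∈ CliffordAlgebra.evenOdd (0 : QuadraticForm ℂ (Fin 3 → ℂ)) p) :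
    q ⊗ₜ y ∈ parityPart p :=
  Submodule.apply_mem_map₂ _ Submodule.mem_top hy

theorem ofPoly_mem (q : MvPolynomial (Fin 3) ℂ) : ofPoly q ∈ parityPart 0 :=
  tmul_mem_parityPart q (Submodule.one_le.1 (CliffordAlgebra.one_le_evenOdd_zero _))

theorem mulX_mem {p : ZMod 2} (i : Fin 3) {z : SE} (hz : z ∈ parityPart p) :
    mulX i z ∈ parityPart p :=
  parityPart_le (U := (parityPart p).comap (mulX i)) (fun _ _ hy => tmul_mem_parityPart _ hy) hz

theorem dX_mem {p : ZMod 2} (i : Fin 3) {z : SE} (hz : z ∈ parityPart p) :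
    dX i z ∈ parityPart p :=
  parityPart_le (U := (parityPart p).comap (dX i)) (fun _ _ hy => tmul_mem_parityPart _ hy) hz

theorem mulEta_mem {p : ZMod 2} (i : Fin 3) {z : SE} (hz : z ∈ parityPart p) :
    mulEta i z ∈ parityPart (1 + p) :=
  parityPart_le (U := (parityPart (1 + p)).comap (mulEta i)) (fun _ _ hy => tmul_mem_parityPart _
    (SetLike.mul_mem_graded (CliffordAlgebra.ι_mem_evenOdd_one _ _) hy)) hz

theorem dEta_mem {p : ZMod 2} (i : Fin 3) {z : SE} (hz : z ∈ parityPart p) :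
    dEta i z ∈ parityPart (1 + p) :=
  parityPart_le (U := (parityPart (1 + p)).comap (dEta i)) (fun _ _ hy => tmul_mem_parityPart _
    (contractLeft_mem_evenOdd i hy)) hz

theorem opN_mem {p : ZMod 2} {z : SE} (hz : z ∈ parityPart p) : opN z ∈ parityPart (1 + p) :=
  Submodule.sub_mem _ (Submodule.add_mem _ (Submodule.sub_mem _ (mulX_mem _ (dEta_mem _ hz))
    (mulEta_mem _ (dX_mem _ hz))) (mulEta_mem _ (dX_mem _ hz))) (mulX_mem _ (dEta_mem _ hz))

theorem opF_mem {p : ZMod 2} {z : SE} (hz : z ∈ parityPart p) : opF z ∈ parityPart (1 + p) :=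
  Submodule.sub_mem _ (Submodule.add_mem _ (mulEta_mem _ (dX_mem _ hz))
    (mulEta_mem _ (dX_mem _ hz))) (mulX_mem _ (dEta_mem _ hz))

/-! ### The dimension of the harmonics -/

theorem mem_harmonics_iff {d : ℕ} {z : SE} :
    z ∈ harmonics d ↔ deg z = (d : ℂ) • z ∧ opD z = 0 ∧ opL z = 0 := by
  rw [mem_harmonics, mem_degreePart]

/-- The harmonics of degree `d` annihilated by the positive root vector of `gl(1|1)`. -/
def singular (d : ℕ) : Submodule ℂ SE := harmonics d ⊓ LinearMap.ker opE

theorem mem_singular {d : ℕ} {z : SE} :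
    z ∈ singular d ↔ deg z = (d : ℂ) • z ∧ opD z = 0 ∧ opE z = 0 := by
  rw [singular, Submodule.mem_inf, mem_harmonics_iff, LinearMap.mem_ker]
  refine ⟨fun h => ⟨h.1.1, h.1.2.1, h.2⟩, fun h => ⟨⟨h.1, h.2.1, ?_⟩, h.2.2⟩⟩
  -- The relation D E + E D = L shows that L annihilates z as soon as D and E do.
  have := opD_opE z
  rwa [h.2.1, h.2.2, map_zero, map_zero, neg_zero, zero_add, eq_comm] at this

theorem deg_opE (z : SE) : deg (opE z) = opE (deg z) := by
  rw [deg_apply, deg₁_opE, deg₂_opE, deg_apply, map_add]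
  abel

theorem deg_opF (z : SE) : deg (opF z) = opF (deg z) := by
  rw [deg_apply, deg₁_opF, deg₂_opF, deg_apply, map_add]
  abel

theorem deg_opN (z : SE) : deg (opN z) = opN (deg z) := by
  rw [deg_apply, deg₁_opN, deg₂_opN, deg_apply, map_add]

theorem opE_mem_harmonics {d : ℕ} {z : SE} (hz : z ∈ harmonics d) : opE z ∈ harmonics d := by
  rw [mem_harmonics_iff] at hz ⊢
  simp [deg_opE, opD_opE, opL_opE, hz]

theorem opF_mem_harmonics {d : ℕ} {z : SE} (hz : z ∈ harmonics d) : opF z ∈ harmonics d := by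
  rw [mem_harmonics_iff] at hz ⊢
  simp [deg_opF, opD_opF, opL_opF, hz]

theorem opN_mem_harmonics {d : ℕ} {z : SE} (hz : z ∈ harmonics d) : opN z ∈ harmonics d := by
  rw [mem_harmonics_iff] at hz ⊢
  simp [deg_opN, opD_opN, opL_opN, hz]

theorem opN_mem_singular {d : ℕ} {z : SE} (hz : z ∈ singular d) : opN z ∈ singular d :=
  ⟨opN_mem_harmonics hz.1, by simp [opE_opN, LinearMap.mem_ker.1 hz.2]⟩

theorem finite_harmonics {d : ℕ} [Module.Finite ℂ (singular d)] : Module.Finite ℂ (harmonics d) :=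
    by
  have h : (harmonics d).map opE ≤ singular d := by
    rintro _ ⟨z, hz, rfl⟩
    exact ⟨opE_mem_harmonics hz, by simp [opE_opE]⟩
  have := Submodule.finiteDimensional_of_le h
  exact Module.Finite.iff_fg.2 (Submodule.fg_of_fg_map_of_fg_inf_ker opE
    (Module.Finite.iff_fg.1 this) (Module.Finite.iff_fg.1 ‹_›))

/-- Rank and nullity of E on the harmonics: the kernel is the singular space, and the image lies in
it because E² = 0. -/
theorem finrank_harmonics_le {d : ℕ} [Module.Finite ℂ (singular d)] :
    Module.finrank ℂ (harmonics d) ≤ 2 * Module.finrank ℂ (singular d) := by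
  have := finite_harmonics (d := d)
  let g : harmonics d →ₗ[ℂ] SE := opE.domRestrict (harmonics d)
  have h1 : LinearMap.range g ≤ singular d := by
    rintro _ ⟨z, rfl⟩
    exact ⟨opE_mem_harmonics z.2, by simp [g, opE_opE]⟩
  have h2 : Module.finrank ℂ (LinearMap.ker g) ≤ Module.finrank ℂ (singular d) := by
    rw [← Submodule.finrank_map_subtype_eq]
    refine Submodule.finrank_mono ?_
    rintro _ ⟨z, hz, rfl⟩
    exact ⟨z.2, hz⟩
  have := LinearMap.finrank_range_add_finrank_ker (K := ℂ) (V := harmonics d) (V₂ := SE) g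
  have := Submodule.finrank_mono h1
  omega

/-! ### The differential system satisfied by the components of a singular vector. -/

theorem eq_zero_of_curl {a b : MvPolynomial (Fin 3) ℂ}
    (h : MvPolynomial.X 0 * a + MvPolynomial.X 1 * b = 0)
    (h' : MvPolynomial.pderiv 1 a = MvPolynomial.pderiv 0 b) (ha : MvPolynomial.pderiv 2 a = 0)
    (hb : MvPolynomial.pderiv 2 b = 0) : a = 0 ∧ b = 0 := by
  have h0 := congrArg (MvPolynomial.pderiv 0) h
  have h1 := congrArg (MvPolynomial.pderiv 1) h
  simp only [map_add, Derivation.leibniz, MvPolynomial.pderiv_X_self, smul_eq_mul, map_zero,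
    MvPolynomial.pderiv_X_of_ne (show (1 : Fin 3) ≠ 0 by decide),
    MvPolynomial.pderiv_X_of_ne (show (0 : Fin 3) ≠ 1 by decide)] at h0 h1
  -- Differentiating x₁a + x₂b = 0 by x₁ and replacing ∂₁b by ∂₂a turns it into a + (x₁∂₁ + x₂∂₂)a =
  -- 0. So a has Euler eigenvalue -1, and b is treated in the same way with x₂.
  constructor <;> refine eq_zero_of_euler (n := 0) ?_
  · simp only [Fin.sum_univ_three, ha, h', Nat.cast_zero, neg_zero, zero_sub, neg_smul, one_smul]
    linear_combination h0
  · simp only [Fin.sum_univ_three, hb, ← h', Nat.cast_zero, neg_zero, zero_sub, neg_smul, one_smul]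
    linear_combination h1

/-- The equations satisfied by the components of a singular vector. -/
theorem singular_components {z : SE} (hD : opD z = 0) (hE : opE z = 0) :
    (MvPolynomial.X 0 * vac (dEta 0 z) + MvPolynomial.X 1 * vac (dEta 1 z) = 0 ∧
      vac (dEta 0 (dEta 1 z)) = 0 ∧
      MvPolynomial.pderiv 2 (vac z) = -(MvPolynomial.X 0 * vac (dEta 0 (dEta 2 z))
        + MvPolynomial.X 1 * vac (dEta 1 (dEta 2 z))) ∧
      MvPolynomial.pderiv 2 (vac (dEta 0 z))
        = -(MvPolynomial.X 1 * vac (dEta 0 (dEta 1 (dEta 2 z)))) ∧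
      MvPolynomial.pderiv 2 (vac (dEta 1 z))
        = MvPolynomial.X 0 * vac (dEta 0 (dEta 1 (dEta 2 z)))) ∧
    (MvPolynomial.pderiv 2 (vac (dEta 2 z))
        = MvPolynomial.pderiv 1 (vac (dEta 0 z)) - MvPolynomial.pderiv 0 (vac (dEta 1 z)) ∧
      MvPolynomial.pderiv 2 (vac (dEta 0 (dEta 2 z))) = 0 ∧
      MvPolynomial.pderiv 2 (vac (dEta 1 (dEta 2 z))) = 0 ∧
      MvPolynomial.pderiv 1 (vac (dEta 0 (dEta 2 z)))
        = MvPolynomial.pderiv 0 (vac (dEta 1 (dEta 2 z))) ∧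
      ∀ i, MvPolynomial.pderiv i (vac (dEta 0 (dEta 1 (dEta 2 z)))) = 0) := by
  have e0 := congrArg vac hE
  have e1 := congrArg (fun w => vac (dEta 0 w)) hE
  have e2 := congrArg (fun w => vac (dEta 2 w)) hE
  have e3 := congrArg (fun w => vac (dEta 0 (dEta 2 w))) hE
  have e4 := congrArg (fun w => vac (dEta 1 (dEta 2 w))) hE
  have d0 := congrArg vac hD
  have d1 := congrArg (fun w => vac (dEta 0 w)) hD
  have d2 := congrArg (fun w => vac (dEta 1 w)) hD
  have d3 := congrArg (fun w => vac (dEta 2 w)) hD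
  have d4 := congrArg (fun w => vac (dEta 0 (dEta 1 w))) hD
  have d5 := congrArg (fun w => vac (dEta 0 (dEta 2 w))) hD
  have d6 := congrArg (fun w => vac (dEta 1 (dEta 2 w))) hD
  simp only [opE_apply, opD_apply, map_add, map_sub, map_neg, map_zero, neg_zero, normalOrder,
    Fin.reduceEq, if_true, if_false, add_zero, zero_add, sub_zero, zero_sub, vac_mulX, vac_dX,
    vac_mulEta, neg_neg] at e0 e1 e2 e3 e4 d0 d1 d2 d3 d4 d5 d6
  -- The η₁-component of E z = 0 says that x₂ times this polynomial vanishes.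
  have h12 : vac (dEta 0 (dEta 1 z)) = 0 :=
    (mul_eq_zero.1 e1).resolve_left (MvPolynomial.X_ne_zero 1)
  simp only [h12, map_zero, neg_zero, zero_sub, neg_eq_zero] at d1 d2
  refine ⟨⟨e0, h12, ?_, ?_, ?_⟩, ⟨?_, d1, d2, ?_, fun i => ?_⟩⟩
  · linear_combination -e2
  · linear_combination -e3
  · linear_combination -e4
  · linear_combination -d0
  · linear_combination -d3
  · fin_cases i
    · simpa using d5
    · simpa using d6
    · simpa using d4

/-- The exponent of the monomial `x₁^a x₂^b x₃^c`. -/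
def expo (a b c : ℕ) : Fin 3 →₀ ℕ := Finsupp.equivFunOnFinite.symm ![a, b, c]

theorem eq_expo (m : Fin 3 →₀ ℕ) : m = expo (m 0) (m 1) (m 2) := by
  ext i
  fin_cases i <;> rfl

theorem degree_eq_add (m : Fin 3 →₀ ℕ) : m.degree = m 0 + m 1 + m 2 := by
  rw [Finsupp.degree_eq_sum, Fin.sum_univ_three]

/-- The coefficients of the monomials of degree `n` not divisible by `x₃`. -/
def coeffs₀ (n : ℕ) : MvPolynomial (Fin 3) ℂ →ₗ[ℂ] Fin (n + 1) → ℂ :=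
  LinearMap.pi fun i => MvPolynomial.lcoeff ℂ (expo i (n - i) 0)

/-- The coefficients of the monomials of degree `n` divisible by `x₃` exactly once. -/
def coeffs₁ (n : ℕ) : MvPolynomial (Fin 3) ℂ →ₗ[ℂ] Fin n → ℂ :=
  LinearMap.pi fun i => MvPolynomial.lcoeff ℂ (expo i (n - 1 - i) 1)

/-- The second hypothesis forbids exponents of x₃ above 1. A homogeneous polynomial of degree n is
then given by n + 1 coefficients without x₃ and n coefficients with it. -/
theorem eq_zero_of_coeffs {p : MvPolynomial (Fin 3) ℂ} {n : ℕ}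
    (hp : ∑ i, MvPolynomial.X i * MvPolynomial.pderiv i p = (n : ℂ) • p)
    (hp' : MvPolynomial.pderiv 2 (MvPolynomial.pderiv 2 p) = 0) (h0 : coeffs₀ n p = 0)
    (h1 : coeffs₁ n p = 0) : p = 0 := by
  ext m
  by_contra hm
  have hd : m.degree = n :=
    (DFunLike.congr_fun Finsupp.degree_eq_weight_one m).trans (isHomogeneous_of_euler hp hm)
  rw [degree_eq_add] at hd
  rcases Nat.lt_or_ge (m 2) 2 with h | h
  · interval_cases h2 : m 2
    · refine hm ?_
      rw [eq_expo m, h2, show m 1 = n - m 0 by omega]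
      exact congrFun h0 ⟨m 0, by omega⟩
    · refine hm ?_
      rw [eq_expo m, h2, show m 1 = n - 1 - m 0 by omega]
      exact congrFun h1 ⟨m 0, by omega⟩
  · have hle : Finsupp.single 2 2 ≤ m := by simpa using h
    have := congrArg (MvPolynomial.coeff (m - Finsupp.single 2 2)) hp'
    rw [MvPolynomial.coeff_pderiv, MvPolynomial.coeff_pderiv, add_assoc, ← Finsupp.single_add,
      tsub_add_cancel_of_le hle] at this
    simp only [MvPolynomial.coeff_zero, mul_eq_zero, Nat.cast_add_one_ne_zero, or_false] at this
    exact hm this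

theorem deg_dEta {i : Fin 3} {c : ℂ} {z : SE} (hz : deg z = c • z) :
    deg (dEta i z) = (c - 1) • dEta i z := by
  have := dEta_deg i z
  rw [hz, map_smul] at this
  rw [eq_sub_of_add_eq this.symm]
  module

theorem euler_vac {c : ℂ} {z : SE} (hz : deg z = c • z) :
    ∑ i, MvPolynomial.X i * MvPolynomial.pderiv i (vac z) = c • vac z := by
  rw [← vac_deg, hz, map_smul]

/-- The top component of a singular vector vanishes except in degree `3`. -/
theorem vac_top_eq_zero {d : ℕ} (hd : d ≠ 3) {z : SE} (hz : z ∈ singular d) :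
    vac (dEta 0 (dEta 1 (dEta 2 z))) = 0 := by
  obtain ⟨hz, hD, hE⟩ := mem_singular.1 hz
  have h := euler_vac (deg_dEta (i := 0) (deg_dEta (i := 1) (deg_dEta (i := 2) hz)))
  simp only [(singular_components hD hE).2.2.2.2.2, mul_zero, Finset.sum_const_zero] at h
  -- All partial derivatives of the top component vanish, so the Euler operator kills it. Its
  -- eigenvalue there is also d - 3, since three odd derivations lower the degree by three.
  refine (smul_eq_zero.1 h.symm).resolve_left fun h' => hd ?_
  have : (d : ℂ) = 3 := by linear_combination h'
  exact_mod_cast this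

/-- A singular vector is determined by three of its components. -/
theorem singular_eq_zero {d : ℕ} {z : SE} (hz : z ∈ singular d) (h0 : vac z = 0)
    (h3 : vac (dEta 2 z) = 0) (h : vac (dEta 0 (dEta 1 (dEta 2 z))) = 0) : z = 0 := by
  obtain ⟨-, hD, hE⟩ := mem_singular.1 hz
  obtain ⟨⟨e1, e2, e3, e4, e5⟩, d1, d2, d3, d4, -⟩ := singular_components hD hE
  rw [h0, map_zero, eq_comm, neg_eq_zero] at e3
  rw [h, mul_zero] at e4 e5
  rw [neg_zero] at e4
  rw [h3, map_zero, eq_comm, sub_eq_zero] at d1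
  -- With the three given components zero, the components along η₁, η₂ and those along η₁η₃, η₂η₃
  -- each form a pair that satisfies the curl system.
  obtain ⟨a1, a2⟩ := eq_zero_of_curl e1 d1 e4 e5
  obtain ⟨b1, b2⟩ := eq_zero_of_curl e3 d4 d2 d3
  rw [← compSum_eq z, compSum_apply, h0, a1, a2, h3, e2, b1, b2, h]
  simp only [map_zero, add_zero, sub_zero]

theorem pderiv_two_vac {z : SE} (hD : opD z = 0) (hE : opE z = 0) :
    MvPolynomial.pderiv 2 (MvPolynomial.pderiv 2 (vac z)) = 0 := by
  obtain ⟨⟨-, -, e3, -, -⟩, -, d2, d3, -, -⟩ := singular_components hD hE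
  rw [e3]
  simp only [map_neg, map_add, Derivation.leibniz, d2, d3, smul_zero,
    MvPolynomial.pderiv_X_of_ne (show (1 : Fin 3) ≠ 2 by decide),
    MvPolynomial.pderiv_X_of_ne (show (0 : Fin 3) ≠ 2 by decide), add_zero, neg_zero]

theorem pderiv_two_vac_dEta {z : SE} (hD : opD z = 0) (hE : opE z = 0)
    (h : vac (dEta 0 (dEta 1 (dEta 2 z))) = 0) :
    MvPolynomial.pderiv 2 (MvPolynomial.pderiv 2 (vac (dEta 2 z))) = 0 := by
  obtain ⟨⟨-, -, -, e4, e5⟩, d1, -, -, -, -⟩ := singular_components hD hE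
  rw [d1, map_sub, pderiv_comm 2 1, pderiv_comm 2 0, e4, e5, h]
  simp

/-- The coordinates of a singular vector. -/
def coords (d : ℕ) : SE →ₗ[ℂ] ((Fin (d + 2) → ℂ) × (Fin (d + 1) → ℂ)) ×
    ((Fin (d + 1) → ℂ) × (Fin d → ℂ)) :=
  ((coeffs₀ (d + 1)).prod (coeffs₁ (d + 1)) ∘ₗ vac).prod
    ((coeffs₀ d).prod (coeffs₁ d) ∘ₗ vac ∘ₗ dEta 2)

theorem coords_apply (d : ℕ) (z : SE) : coords d z =
    ((coeffs₀ (d + 1) (vac z), coeffs₁ (d + 1) (vac z)),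
      (coeffs₀ d (vac (dEta 2 z)), coeffs₁ d (vac (dEta 2 z)))) := rfl

theorem singular_eq_zero_of_coords {d : ℕ} {z : SE} (hz : z ∈ singular (d + 1))
    (h : vac (dEta 0 (dEta 1 (dEta 2 z))) = 0) (h' : coords d z = 0) : z = 0 := by
  obtain ⟨hz', hD, hE⟩ := mem_singular.1 hz
  rw [coords_apply] at h'
  simp only [Prod.mk_eq_zero] at h'
  refine singular_eq_zero hz (eq_zero_of_coeffs (euler_vac hz') (pderiv_two_vac hD hE) h'.1.1
    h'.1.2)
    (eq_zero_of_coeffs (n := d) ?_ (pderiv_two_vac_dEta hD hE h) h'.2.1 h'.2.2) h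
  rw [euler_vac (deg_dEta hz')]
  push_cast
  rw [add_sub_cancel_right]

theorem finrank_le_of_coords {S M : Type*} [AddCommGroup S] [Module ℂ S] [AddCommGroup M]
    [Module ℂ M] [Module.Finite ℂ M] {U : Submodule ℂ S} (g : S →ₗ[ℂ] M) (h : ∀ z ∈ U,
      g z = 0 → z = 0) :
    Module.Finite ℂ U ∧ Module.finrank ℂ U ≤ Module.finrank ℂ M := by
  have hi : Function.Injective (g.domRestrict U) := by
    refine (injective_iff_map_eq_zero (g.domRestrict U)).2 fun z hz => ?_
    exact Subtype.ext (h z z.2 hz)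
  exact ⟨Module.Finite.of_injective _ hi, LinearMap.finrank_le_finrank_of_injective hi⟩

/-- The scalar component has degree d + 1 and the η₃-component degree d. Being at most linear in x₃,
they have 2d + 3 and 2d + 1 coefficients, together 4(d + 1). The excluded total degree is 3, where
the top component may survive. -/
theorem finrank_singular_le {d : ℕ} (hd : d ≠ 2) :
    Module.Finite ℂ (singular (d + 1)) ∧ Module.finrank ℂ (singular (d + 1)) ≤ 4 * (d + 1) := by
  have := finrank_le_of_coords (S := SE) (coords d) fun z hz h =>
    singular_eq_zero_of_coords hz (vac_top_eq_zero (by omega) hz) h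
  refine ⟨this.1, this.2.trans_eq ?_⟩
  simp only [Module.finrank_prod, Module.finrank_fin_fun]
  ring

/-- In degree 3 the top component is a constant. Its value is one more coordinate besides the 12
generic ones. -/
theorem finrank_singular_three_le :
    Module.Finite ℂ (singular 3) ∧ Module.finrank ℂ (singular 3) ≤ 13 := by
  have := finrank_le_of_coords (S := SE) (U := singular 3) ((coords 2).prod
    (MvPolynomial.lcoeff ℂ 0 ∘ₗ vac ∘ₗ dEta 0 ∘ₗ dEta 1 ∘ₗ dEta 2)) fun z hz h => by
      replace h := Prod.mk_eq_zero.1 h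
      refine singular_eq_zero_of_coords hz ?_ h.1
      obtain ⟨hz', hD, hE⟩ := mem_singular.1 hz
      have h1 := (singular_components hD hE).2.2.2.2.2
      ext m
      by_cases hm : m = 0
      · rw [hm]
        exact h.2
      · obtain ⟨i, hi⟩ := Finsupp.ne_iff.1 hm
        have h2 := congrArg (MvPolynomial.coeff (m - Finsupp.single i 1)) (h1 i)
        have hle : Finsupp.single i 1 ≤ m := by
          simpa [Nat.one_le_iff_ne_zero] using hi
        rw [MvPolynomial.coeff_pderiv, tsub_add_cancel_of_le hle] at h2
        exact (mul_eq_zero.1 h2).resolve_right (Nat.cast_add_one_ne_zero _)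
  refine ⟨this.1, this.2.trans_eq ?_⟩
  simp only [Module.finrank_prod, Module.finrank_fin_fun, Module.finrank_self]

/-- In degrees `0` and `1` the lowest component of a singular vector does not involve `x₃`. -/
theorem pderiv_two_eq_zero {d : ℕ} (hd : d ≤ 1) {z : SE} (hz : z ∈ singular d) :
    MvPolynomial.pderiv 2 (vac z) = 0 := by
  obtain ⟨hz', hD, hE⟩ := mem_singular.1 hz
  have h : ∀ i, vac (dEta i (dEta 2 z)) = 0 := fun i => by
    refine eq_zero_of_euler (n := 1 - d) ?_
    rw [euler_vac (deg_dEta (deg_dEta hz')), Nat.cast_sub hd]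
    push_cast
    module
  rw [(singular_components hD hE).1.2.2.1, h, h, mul_zero, mul_zero, add_zero, neg_zero]

theorem coeffs₁_eq_zero {p : MvPolynomial (Fin 3) ℂ} (n : ℕ) (hp : MvPolynomial.pderiv 2 p = 0) :
    coeffs₁ n p = 0 := by
  ext i
  have h := congrArg (MvPolynomial.coeff (expo i (n - 1 - i) 0)) hp
  have h1 : expo i (n - 1 - i) 0 + Finsupp.single 2 1 = expo i (n - 1 - i) 1 := by
    ext j
    fin_cases j <;> simp [expo]
  rw [MvPolynomial.coeff_pderiv, h1] at h
  change MvPolynomial.coeff (expo i (n - 1 - i) 1) p = 0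
  simpa [expo] using h

/-- The generic bound 4 is not sharp here. The equation for the x₃-derivative of the scalar
component involves only components of negative degree, so that component is free of x₃. -/
theorem finrank_singular_one_le :
    Module.Finite ℂ (singular 1) ∧ Module.finrank ℂ (singular 1) ≤ 3 := by
  have := finrank_le_of_coords (S := SE) (U := singular 1)
    ((coeffs₀ 1 ∘ₗ vac).prod (coeffs₀ 0 ∘ₗ vac ∘ₗ dEta 2)) fun z hz h => by
      replace h := Prod.mk_eq_zero.1 h
      refine singular_eq_zero_of_coords (d := 0) hz (vac_top_eq_zero (by decide) hz) ?_
      rw [coords_apply, coeffs₁_eq_zero _ (pderiv_two_eq_zero le_rfl hz)]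
      exact Prod.ext (Prod.ext h.1 rfl) (Prod.ext h.2 (Subsingleton.elim _ _))
  refine ⟨this.1, this.2.trans_eq ?_⟩
  simp only [Module.finrank_prod, Module.finrank_fin_fun]

theorem finrank_singular_zero_le :
    Module.Finite ℂ (singular 0) ∧ Module.finrank ℂ (singular 0) ≤ 1 := by
  have := finrank_le_of_coords (S := SE) (U := singular 0) (coeffs₀ 0 ∘ₗ vac) fun z hz h => by
    obtain ⟨hz', hD, hE⟩ := mem_singular.1 hz
    refine singular_eq_zero hz ?_ ?_ (vac_top_eq_zero (by decide) hz)
    · exact eq_zero_of_coeffs (euler_vac hz') (pderiv_two_vac hD hE) h (Subsingleton.elim _ _)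
    · refine eq_zero_of_euler (n := 0) ?_
      rw [euler_vac (deg_dEta hz')]
      push_cast
      module
  refine ⟨this.1, this.2.trans_eq ?_⟩
  simp only [Module.finrank_fin_fun]

/-! ### Highest weight modules of `spo(2|1)` -/

/-- The relations of `spo(2|1)` for the odd root vectors `P`, `N` and the Cartan element `H`. -/
structure SpoTriple {M : Type*} [AddCommGroup M] [Module ℂ M] (P N H : Module.End ℂ M) : Prop where
  PN : ∀ z, P (N z) = -N (P z) - H z
  HN : ∀ z, H (N z) = N (H z) - N z
  HP : ∀ z, H (P z) = P (H z) + P z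

/-- The coefficients in `P N^k h = c_k N^{k-1} h`, for `h` of highest weight `n`. -/
def lowerCoeff (n : ℕ) : ℕ → ℂ
  | 0 => 0
  | k + 1 => -lowerCoeff n k - (n - k)

/-- Two steps of the recursion raise the coefficient by 1. Hence it vanishes exactly at k = 0 and k
= 2n + 1, the only places where a chain of lowerings can break. -/
theorem lowerCoeff_even_odd (n j : ℕ) :
    lowerCoeff n (2 * j) = j ∧ lowerCoeff n (2 * j + 1) = j - n := by
  induction j with
  | zero => simp [lowerCoeff]
  | succ j ih =>
    have h : lowerCoeff n (2 * (j + 1)) = (j + 1 : ℕ) := by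
      rw [mul_add, mul_one, lowerCoeff, ih.2]
      push_cast
      ring
    refine ⟨h, ?_⟩
    rw [lowerCoeff, h]
    push_cast
    ring

theorem lowerCoeff_ne_zero {n k : ℕ} (h : k ≠ 0) (h' : k ≠ 2 * n + 1) : lowerCoeff n k ≠ 0 := by
  obtain ⟨j, rfl | rfl⟩ := Nat.even_or_odd' k
  · rw [(lowerCoeff_even_odd n j).1]
    exact_mod_cast fun hj => h (by omega)
  · rw [(lowerCoeff_even_odd n j).2, sub_ne_zero]
    exact_mod_cast fun hj => h' (by omega)

theorem lowerCoeff_last (n : ℕ) : lowerCoeff n (2 * n + 1) = 0 := by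
  rw [(lowerCoeff_even_odd n n).2, sub_self]

namespace SpoTriple

variable {M : Type*} [AddCommGroup M] [Module ℂ M] {P N H : Module.End ℂ M}

theorem H_pow (t : SpoTriple P N H) {n : ℕ} {h : M} (hH : H h = (n : ℂ) • h) (k : ℕ) :
    H ((N ^ k) h) = ((n : ℂ) - k) • (N ^ k) h := by
  induction k with
  | zero => simpa using hH
  | succ k ih =>
    rw [pow_succ', Module.End.mul_apply, t.HN, ih, map_smul]
    push_cast
    module

theorem P_pow_succ (t : SpoTriple P N H) {n : ℕ} {h : M} (hP : P h = 0) (hH : H h = (n : ℂ) • h)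
    (k : ℕ) : P ((N ^ (k + 1)) h) = lowerCoeff n (k + 1) • (N ^ k) h := by
  induction k with
  | zero =>
    rw [zero_add, pow_one, t.PN, hP, hH]
    simp [lowerCoeff]
  | succ k ih =>
    rw [pow_succ', Module.End.mul_apply, t.PN, ih, t.H_pow hH, map_smul, ← Module.End.mul_apply,
      ← pow_succ', lowerCoeff.eq_def n (k + 1 + 1)]
    push_cast
    module

/-- P takes the new vector back to a nonzero multiple of the previous one, so the chain can die only
at the zero of the coefficient. -/
theorem pow_succ_ne_zero (t : SpoTriple P N H) {n : ℕ} {h : M} (hP : P h = 0)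
    (hH : H h = (n : ℂ) • h) {k : ℕ} (hk : k ≠ 2 * n) (hne : (N ^ k) h ≠ 0) :
    (N ^ (k + 1)) h ≠ 0 := by
  intro h0
  have := t.P_pow_succ hP hH k
  rw [h0, map_zero] at this
  exact (smul_ne_zero (lowerCoeff_ne_zero (Nat.succ_ne_zero k) (by omega)) hne) this.symm

theorem pow_ne_zero (t : SpoTriple P N H) {n : ℕ} {h : M} (hP : P h = 0)
    (hH : H h = (n : ℂ) • h) (hne : h ≠ 0) {k : ℕ} (hk : k ≤ 2 * n) : (N ^ k) h ≠ 0 := by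
  induction k with
  | zero => simpa using hne
  | succ k ih => exact t.pow_succ_ne_zero hP hH (by omega) (ih (by omega))

theorem linearIndependent_pow (t : SpoTriple P N H) {n : ℕ} {h : M} (hH : H h = (n : ℂ) • h)
    {ι : Type*} (s : ι → ℕ) (hs : Function.Injective s) (hne : ∀ i, (N ^ s i) h ≠ 0) :
    LinearIndependent ℂ fun i => (N ^ s i) h := by
  refine Module.End.eigenvectors_linearIndependent' H (fun i => (n : ℂ) - s i) ?_ _ fun i =>
    ⟨Module.End.mem_eigenspace_iff.2 (t.H_pow hH _), hne i⟩
  intro i j hij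
  exact hs (by simpa using hij)

/-- A chain that survives step 2n + 1 meets no further vanishing coefficient and never ends. Its
members have distinct H-weights. This excludes survival inside a finite-dimensional stable space. -/
theorem linearIndependent_pow_of_ne (t : SpoTriple P N H) {n : ℕ} {h : M} (hP : P h = 0)
    (hH : H h = (n : ℂ) • h) (hne : (N ^ (2 * n + 1)) h ≠ 0) :
    LinearIndependent ℂ fun k : ℕ => (N ^ k) h := by
  refine t.linearIndependent_pow hH id Function.injective_id fun k => ?_
  have h0 : h ≠ 0 := fun h0 => hne (by rw [h0, map_zero])
  rcases Nat.lt_or_ge (2 * n) k with hk | hk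
  · induction k, hk using Nat.le_induction with
    | base => exact hne
    | succ k hk ih => exact t.pow_succ_ne_zero hP hH (by omega) ih
  · exact t.pow_ne_zero hP hH h0 hk

theorem pow_eq_zero_of_finite (t : SpoTriple P N H) {n : ℕ} {h : M} (hP : P h = 0)
    (hH : H h = (n : ℂ) • h) (U : Submodule ℂ M) [Module.Finite ℂ U] (hU : h ∈ U)
    (hN : ∀ z ∈ U, N z ∈ U) : (N ^ (2 * n + 1)) h = 0 := by
  by_contra hne
  have hmem : ∀ k, (N ^ k) h ∈ U := fun k => by
    induction k with
    | zero => simpa using hU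
    | succ k ih =>
      rw [pow_succ', Module.End.mul_apply]
      exact hN _ ih
  have : LinearIndependent ℂ fun k : ℕ => (⟨(N ^ k) h, hmem k⟩ : U) :=
    LinearIndependent.of_comp U.subtype (t.linearIndependent_pow_of_ne hP hH hne)
  have := this.finite
  exact not_finite ℕ

end SpoTriple

section Reps

variable {n : Type*} [Fintype n] {par : n → ZMod 2} {𝔰 : MatrixSuperalgebra par}
  {M : Type*} [AddCommGroup M] [Module ℂ M]

/-- The parity `r` and the element `Z` are tied to the bracket by equations only. This avoids the
dependence of the type of `act_bracket` on p + q and on a membership proof. -/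
theorem SuperRep.act_bracket_eq (ρ : SuperRep 𝔰 M) {p q r : ZMod 2} (X : 𝔰.part p) (Y : 𝔰.part q)
    (Z : 𝔰.part r) (h : p + q = r) (hZ : superBracket p q X.1 Y.1 = Z.1) (z : M) :
    ρ.act r Z z = ρ.act p X (ρ.act q Y z) - sgn (p * q) • ρ.act q Y (ρ.act p X z) := by
  subst h
  have := LinearMap.congr_fun (ρ.act_bracket X Y) z
  rw [show Z = ⟨superBracket p q X Y, 𝔰.bracket_mem X.2 Y.2⟩ from Subtype.ext hZ.symm]
  exact this

/-- A subspace spanned by homogeneous vectors is graded. -/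
theorem SuperRep.span_eq_iSup (ρ : SuperRep 𝔰 M) {ι : Type*} (b : ι → M) (s : ι → ZMod 2)
    (hb : ∀ i, b i ∈ ρ.grading (s i)) :
    Submodule.span ℂ (Set.range b) = ⨆ p, Submodule.span ℂ (Set.range b) ⊓ ρ.grading p := by
  refine le_antisymm (Submodule.span_le.2 ?_) (iSup_le fun p => inf_le_left)
  rintro _ ⟨i, rfl⟩
  exact Submodule.mem_iSup_of_mem (s i) ⟨Submodule.subset_span ⟨i, rfl⟩, hb i⟩

end Reps

theorem sgn_zero : sgn 0 = 1 := by simp [sgn]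

theorem sgn_one : sgn 1 = -1 := by simp [sgn, ZMod.val_one]

theorem map_mem_span_range {M ι : Type*} [AddCommGroup M] [Module ℂ M] (A : Module.End ℂ M)
    (b : ι → M) (h : ∀ i, A (b i) ∈ Submodule.span ℂ (Set.range b)) {z : M}
    (hz : z ∈ Submodule.span ℂ (Set.range b)) : A z ∈ Submodule.span ℂ (Set.range b) := by
  refine (Submodule.map_span_le A _ _).2 ?_ (Submodule.mem_map_of_mem hz)
  rintro _ ⟨i, rfl⟩
  exact h i

section SpoReps

variable {M : Type*} [AddCommGroup M] [Module ℂ M] (ρ : SuperRep spo21 M)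

theorem SuperRep.spoTriple : SpoTriple (ρ.act 1 spoQ) (ρ.act 1 spoN) (ρ.act 0 spoH) where
  PN z := by
    have := ρ.act_bracket_eq spoQ spoN (-spoH) rfl (by
      ext i j
      fin_cases i <;> fin_cases j <;>
        simp [superBracket, spoQ, spoN, spoH, sgn_one]) z
    rw [map_neg, LinearMap.neg_apply, mul_one, sgn_one] at this
    rw [sub_eq_add_neg, this]
    module
  HN z := by
    have := ρ.act_bracket_eq spoH spoN (-spoN) rfl (by
      ext i j
      fin_cases i <;> fin_cases j <;>
        simp [superBracket, spoN, spoH, sgn_zero]) z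
    rw [map_neg, LinearMap.neg_apply, zero_mul, sgn_zero, one_smul] at this
    rw [sub_eq_add_neg, this]
    abel
  HP z := by
    have := ρ.act_bracket_eq spoH spoQ spoQ rfl (by
      ext i j
      fin_cases i <;> fin_cases j <;>
        simp [superBracket, spoQ, spoH, sgn_zero]) z
    rw [zero_mul, sgn_zero, one_smul] at this
    rw [← sub_eq_iff_eq_add', ← this]

theorem SuperRep.act_spoE (z : M) : ρ.act 0 spoE z = ρ.act 1 spoQ (ρ.act 1 spoQ z) := by
  have := ρ.act_bracket_eq spoQ spoQ ((2 : ℂ) • spoE) rfl (by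
      ext i j
      fin_cases i <;> fin_cases j <;>
        simp [superBracket, spoQ, spoE, sgn_one]
      norm_num) z
  rw [map_smul, LinearMap.smul_apply, mul_one, sgn_one, neg_one_smul, sub_neg_eq_add,
    ← two_smul ℂ] at this
  exact smul_right_injective M two_ne_zero this

theorem SuperRep.act_spoF (z : M) : ρ.act 0 spoF z = -ρ.act 1 spoN (ρ.act 1 spoN z) := by
  have := ρ.act_bracket_eq spoN spoN ((-2 : ℂ) • spoF) rfl (by
      ext i j
      fin_cases i <;> fin_cases j <;>
        simp [superBracket, spoN, spoF, sgn_one]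
      norm_num) z
  rw [map_smul, LinearMap.smul_apply, mul_one, sgn_one, neg_one_smul, sub_neg_eq_add,
    ← two_smul ℂ, neg_smul, ← smul_neg] at this
  rw [← smul_right_injective M two_ne_zero this, neg_neg]

theorem SuperRep.act_spo_even (X : spo21.part 0) (z : M) : ρ.act 0 X z =
    X.1 0 0 • ρ.act 0 spoH z + X.1 0 1 • ρ.act 1 spoQ (ρ.act 1 spoQ z)
      - X.1 1 0 • ρ.act 1 spoN (ρ.act 1 spoN z) := by
  conv_lhs => rw [spo_even_eq X]
  simp only [map_add, map_smul, LinearMap.add_apply, LinearMap.smul_apply, ρ.act_spoE, ρ.act_spoF,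
    smul_neg, sub_eq_add_neg]

theorem SuperRep.act_spo_odd (X : spo21.part 1) (z : M) : ρ.act 1 X z =
    X.1 0 2 • ρ.act 1 spoQ z + X.1 1 2 • ρ.act 1 spoN z := by
  conv_lhs => rw [spo_odd_eq X]
  simp only [map_add, map_smul, LinearMap.add_apply, LinearMap.smul_apply]

/-- The odd root vectors generate spo(2|1): H = -NP - PN, while E₁₂ and E₂₁ act by P² and -N². -/
theorem SuperRep.spo_invariant {U : Submodule ℂ M} (hP : ∀ z ∈ U, ρ.act 1 spoQ z ∈ U)
    (hN : ∀ z ∈ U, ρ.act 1 spoN z ∈ U) (p : ZMod 2) (X : spo21.part p) (z : M) (hz : z ∈ U) :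
    ρ.act p X z ∈ U := by
  obtain rfl | rfl := parity_cases p
  · have hH : ρ.act 0 spoH z ∈ U := by
      have : ρ.act 0 spoH z
          = -ρ.act 1 spoN (ρ.act 1 spoQ z) - ρ.act 1 spoQ (ρ.act 1 spoN z) := by
        rw [ρ.spoTriple.PN]
        abel
      rw [this]
      exact U.sub_mem (U.neg_mem (hN _ (hP _ hz))) (hP _ (hN _ hz))
    rw [ρ.act_spo_even]
    exact U.sub_mem (U.add_mem (U.smul_mem _ hH) (U.smul_mem _ (hP _ (hP _ hz))))
      (U.smul_mem _ (hN _ (hN _ hz)))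
  · rw [ρ.act_spo_odd]
    exact U.add_mem (U.smul_mem _ (hP _ hz)) (U.smul_mem _ (hN _ hz))

/-- The structure of the irreducible module of highest weight `n`. -/
theorem exists_spo_basis {n : ℕ} (hρ : IsSpoIrrep ρ (n : ℂ)) :
    ∃ (s : ZMod 2) (v : M) (b : Module.Basis (Fin (2 * n + 1)) ℂ M),
      (∀ k, b k = (ρ.act 1 spoN ^ (k : ℕ)) v) ∧ (∀ k : Fin (2 * n + 1),
        b k ∈ ρ.grading ((k : ℕ) + s)) ∧
      ρ.act 1 spoQ v = 0 ∧ ρ.act 0 spoH v = (n : ℂ) • v ∧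
      (ρ.act 1 spoN ^ (2 * n + 1)) v = 0 := by
  obtain ⟨⟨-, hirr⟩, s, v, hv, hv0, -, hP, hH⟩ := hρ
  set N := ρ.act 1 spoN with hN
  have t := ρ.spoTriple
  have hgr : ∀ k : ℕ, (N ^ k) v ∈ ρ.grading (k + s) := fun k => by
    induction k with
    | zero => simpa using hv
    | succ k ih =>
      rw [pow_succ', Module.End.mul_apply]
      have := ρ.act_mem spoN ih
      rwa [← add_assoc, add_comm 1, ← Nat.cast_succ] at this
  -- A vanishing coefficient at a means that P kills N^a v, so the tail of the chain starting there
  -- is a submodule. It is used for a = 0 and a = 2n + 1.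
  have hspan : ∀ a : ℕ, lowerCoeff n a = 0 → (N ^ a) v ≠ 0 →
      Submodule.span ℂ (Set.range fun k => (N ^ (a + k)) v) = ⊤ := by
    intro a ha ha'
    refine (hirr _ (ρ.span_eq_iSup _ (fun k => ((a + k : ℕ) : ZMod 2) + s) fun k => hgr _)
      (ρ.spo_invariant (fun z hz => ?_) fun z hz => ?_)).resolve_left fun h => ?_
    · refine map_mem_span_range _ _ (fun k => ?_) hz
      cases k with
      | zero =>
        cases a with
        | zero => simp [hP]
        | succ a =>
          simp only [add_zero]
          rw [t.P_pow_succ hP hH, ha, zero_smul]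
          exact Submodule.zero_mem _
      | succ k =>
        simp only [← add_assoc]
        rw [t.P_pow_succ hP hH]
        exact Submodule.smul_mem _ _ (Submodule.subset_span ⟨k, rfl⟩)
    · refine map_mem_span_range _ _ (fun k => Submodule.subset_span ⟨k + 1, ?_⟩) hz
      simp only [← add_assoc]
      rw [pow_succ', Module.End.mul_apply]
    · exact ha' ((Submodule.mem_bot ℂ).1 (h ▸ Submodule.subset_span ⟨0, rfl⟩))
  -- Otherwise the tail starting at 2n + 1 would be the whole module by irreducibility, although v
  -- is linearly independent of it. No finiteness of the module is assumed.
  have hlast : (N ^ (2 * n + 1)) v = 0 := by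
    by_contra hne
    have h1 := hspan _ (lowerCoeff_last n) hne
    have h2 := (t.linearIndependent_pow_of_ne hP hH hne).notMem_span_image
      (s := Set.range fun k => 2 * n + 1 + k) (x := 0) (by simp)
    rw [← Set.range_comp] at h2
    exact h2 (h1 ▸ Submodule.mem_top)
  have hall : ∀ k, 2 * n + 1 ≤ k → (N ^ k) v = 0 := fun k hk => by
    obtain ⟨j, rfl⟩ := Nat.exists_eq_add_of_le' hk
    rw [pow_add, Module.End.mul_apply, hlast, map_zero]
  have hli : LinearIndependent ℂ fun k : Fin (2 * n + 1) => (N ^ (k : ℕ)) v :=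
    t.linearIndependent_pow hH _ Fin.val_injective fun k => t.pow_ne_zero hP hH hv0 (by omega)
  have htop : ⊤ ≤ Submodule.span ℂ (Set.range fun k : Fin (2 * n + 1) => (N ^ (k : ℕ)) v) := by
    rw [← hspan 0 rfl (by simpa using hv0), Submodule.span_le]
    rintro _ ⟨k, rfl⟩
    simp only [zero_add]
    rcases Nat.lt_or_ge k (2 * n + 1) with hk | hk
    · exact Submodule.subset_span ⟨⟨k, hk⟩, rfl⟩
    · rw [hall k hk]
      exact Submodule.zero_mem _
  refine ⟨s, v, Module.Basis.mk hli htop, fun k => Module.Basis.mk_apply hli htop k, fun k => ?_,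
    hP, hH, hlast⟩
  rw [Module.Basis.mk_apply]
  exact hgr k

end SpoReps

/-! ### Highest weight modules of `gl(1|1)` -/

/-- The relations of `gl(1|1)` for the matrix units `E = E₁₂`, `F = E₂₁`, `A = E₁₁`, `D = E₂₂`. -/
structure GlQuadruple {M : Type*} [AddCommGroup M] [Module ℂ M] (E F A D : Module.End ℂ M) :
    Prop where
  EF : ∀ z, E (F z) = -F (E z) + (A z + D z)
  EE : ∀ z, E (E z) = 0
  FF : ∀ z, F (F z) = 0
  AF : ∀ z, A (F z) = F (A z) - F z
  DF : ∀ z, D (F z) = F (D z) + F z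
  AE : ∀ z, A (E z) = E (A z) + E z
  DE : ∀ z, D (E z) = E (D z) - E z
  AD : ∀ z, A (D z) = D (A z)

section GlReps

variable {M : Type*} [AddCommGroup M] [Module ℂ M] (τ : SuperRep gl11 M)

theorem SuperRep.glQuadruple :
    GlQuadruple (τ.act 1 glE12) (τ.act 1 glE21) (τ.act 0 glE11) (τ.act 0 glE22) where
  EF z := by
    have := τ.act_bracket_eq glE12 glE21 (glE11 + glE22) rfl (by
      ext i j
      fin_cases i <;> fin_cases j <;>
        simp [superBracket, glE12, glE21, glE11, glE22, sgn_one]) z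
    rw [map_add, LinearMap.add_apply, mul_one, sgn_one] at this
    rw [this]
    module
  EE z := by
    have := τ.act_bracket_eq glE12 glE12 0 rfl (by
      ext i j
      fin_cases i <;> fin_cases j <;> simp [superBracket, glE12]) z
    rw [map_zero, LinearMap.zero_apply, mul_one, sgn_one, neg_one_smul, sub_neg_eq_add,
      ← two_smul ℂ, eq_comm] at this
    exact (smul_eq_zero.1 this).resolve_left two_ne_zero
  FF z := by
    have := τ.act_bracket_eq glE21 glE21 0 rfl (by
      ext i j
      fin_cases i <;> fin_cases j <;> simp [superBracket, glE21]) z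
    rw [map_zero, LinearMap.zero_apply, mul_one, sgn_one, neg_one_smul, sub_neg_eq_add,
      ← two_smul ℂ, eq_comm] at this
    exact (smul_eq_zero.1 this).resolve_left two_ne_zero
  AF z := by
    have := τ.act_bracket_eq glE11 glE21 (-glE21) rfl (by
      ext i j
      fin_cases i <;> fin_cases j <;> simp [superBracket, glE21, glE11, sgn_zero]) z
    rw [map_neg, LinearMap.neg_apply, zero_mul, sgn_zero, one_smul] at this
    rw [sub_eq_add_neg, this]
    abel
  DF z := by
    have := τ.act_bracket_eq glE22 glE21 glE21 rfl (by
      ext i j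
      fin_cases i <;> fin_cases j <;> simp [superBracket, glE21, glE22, sgn_zero]) z
    rw [zero_mul, sgn_zero, one_smul] at this
    rw [← sub_eq_iff_eq_add', ← this]
  AE z := by
    have := τ.act_bracket_eq glE11 glE12 glE12 rfl (by
      ext i j
      fin_cases i <;> fin_cases j <;> simp [superBracket, glE12, glE11, sgn_zero]) z
    rw [zero_mul, sgn_zero, one_smul] at this
    rw [← sub_eq_iff_eq_add', ← this]
  DE z := by
    have := τ.act_bracket_eq glE22 glE12 (-glE12) rfl (by
      ext i j
      fin_cases i <;> fin_cases j <;> simp [superBracket, glE12, glE22, sgn_zero]) z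
    rw [map_neg, LinearMap.neg_apply, zero_mul, sgn_zero, one_smul] at this
    rw [sub_eq_add_neg, this]
    abel
  AD z := by
    have := τ.act_bracket_eq glE11 glE22 0 rfl (by
      ext i j
      fin_cases i <;> fin_cases j <;> simp [superBracket, glE11, glE22]) z
    rw [map_zero, LinearMap.zero_apply, zero_mul, sgn_zero, one_smul] at this
    exact sub_eq_zero.1 this.symm

theorem SuperRep.act_gl_even (X : gl11.part 0) (z : M) :
    τ.act 0 X z = X.1 0 0 • τ.act 0 glE11 z + X.1 1 1 • τ.act 0 glE22 z := by
  conv_lhs => rw [gl_even_eq X]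
  simp only [map_add, map_smul, LinearMap.add_apply, LinearMap.smul_apply]

theorem SuperRep.act_gl_odd (X : gl11.part 1) (z : M) :
    τ.act 1 X z = X.1 0 1 • τ.act 1 glE12 z + X.1 1 0 • τ.act 1 glE21 z := by
  conv_lhs => rw [gl_odd_eq X]
  simp only [map_add, map_smul, LinearMap.add_apply, LinearMap.smul_apply]

theorem SuperRep.gl_invariant {U : Submodule ℂ M} (hE : ∀ z ∈ U, τ.act 1 glE12 z ∈ U)
    (hF : ∀ z ∈ U, τ.act 1 glE21 z ∈ U) (hA : ∀ z ∈ U, τ.act 0 glE11 z ∈ U)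
    (hD : ∀ z ∈ U, τ.act 0 glE22 z ∈ U) (p : ZMod 2) (X : gl11.part p) (z : M) (hz : z ∈ U) :
    τ.act p X z ∈ U := by
  obtain rfl | rfl := parity_cases p
  · rw [τ.act_gl_even]
    exact U.add_mem (U.smul_mem _ (hA _ hz)) (U.smul_mem _ (hD _ hz))
  · rw [τ.act_gl_odd]
    exact U.add_mem (U.smul_mem _ (hE _ hz)) (U.smul_mem _ (hF _ hz))

/-- The structure of the irreducible `gl(1|1)`-module of highest weight `(β, γ)`. -/
theorem exists_gl_basis {β γ : ℂ} {m : ℕ} (hm : m = 2 ∧ β + γ ≠ 0 ∨ m = 1 ∧ β + γ = 0)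
    (hτ : IsGlIrrep τ (β, γ)) :
    ∃ (s : ZMod 2) (w : M) (b : Module.Basis (Fin m) ℂ M),
      (∀ j, b j = (τ.act 1 glE21 ^ (j : ℕ)) w) ∧ (∀ j : Fin m, b j ∈ τ.grading ((j : ℕ) + s)) ∧
      τ.act 1 glE12 w = 0 ∧ τ.act 0 glE11 w = β • w ∧ τ.act 0 glE22 w = γ • w ∧
      (τ.act 1 glE21 ^ m) w = 0 := by
  obtain ⟨⟨-, hirr⟩, s, w, hw, hw0, hE, hA, hD⟩ := hτ
  set F := τ.act 1 glE21 with hF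
  have t := τ.glQuadruple
  have hgr : ∀ j : ℕ, (F ^ j) w ∈ τ.grading (j + s) := fun k => by
    induction k with
    | zero => simpa using hw
    | succ k ih =>
      rw [pow_succ', Module.End.mul_apply]
      have := τ.act_mem glE21 ih
      rwa [← add_assoc, add_comm 1, ← Nat.cast_succ] at this
  have hEF : τ.act 1 glE12 (F w) = (β + γ) • w := by
    rw [t.EF, hE, hA, hD]
    simp [add_smul]
  have hAF : τ.act 0 glE11 (F w) = (β - 1) • F w := by
    rw [t.AF, hA, map_smul, sub_smul, one_smul]
  have hDF : τ.act 0 glE22 (F w) = (γ + 1) • F w := by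
    rw [t.DF, hD, map_smul, add_smul, one_smul]
  have hli : ∀ k : ℕ, (F w ≠ 0 ∨ k = 1) → k ≤ 2 →
      LinearIndependent ℂ fun j : Fin k => (F ^ (j : ℕ)) w := by
    intro k hk hk2
    refine Module.End.eigenvectors_linearIndependent' (τ.act 0 glE22) 
      (fun j : Fin k => γ + (j : ℕ)) ?_ _ fun j => ?_
    · intro i j hij
      exact Fin.ext (by simpa using hij)
    · rw [Module.End.hasEigenvector_iff, Module.End.mem_eigenspace_iff]
      obtain ⟨_ | _ | j, hj⟩ := j
      · simpa using ⟨hD, hw0⟩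
      · simpa using ⟨hDF, hk.resolve_right (by omega)⟩
      · omega
  -- Two cases share one argument: a = 0, k = 2 is the span of w and Fw; a = 1, k = 1 is the line of
  -- Fw, which is invariant because E F w = (β+γ) w = 0.
  have hspan : ∀ a k : ℕ, (a = 0 ∧ k = 2 ∨ a = 1 ∧ k = 1 ∧ β + γ = 0) → (F ^ a) w ≠ 0 →
      Submodule.span ℂ (Set.range fun j : Fin k => (F ^ (a + j : ℕ)) w) = ⊤ := by
    intro a k hak ha
    have hFF : ∀ j, 2 ≤ j → (F ^ j) w = 0 := fun j hj => by
      obtain ⟨i, rfl⟩ := Nat.exists_eq_add_of_le' hj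
      rw [pow_add, Module.End.mul_apply, pow_two, Module.End.mul_apply, t.FF, map_zero]
    have hmem : ∀ j, a ≤ j → (F ^ j) w ∈
        Submodule.span ℂ (Set.range fun j : Fin k => (F ^ (a + j : ℕ)) w) := fun j hj => by
      rcases Nat.lt_or_ge j 2 with h | h
      · exact Submodule.subset_span ⟨⟨j - a, by omega⟩, by simp [Nat.add_sub_cancel' hj]⟩
      · rw [hFF j h]
        exact Submodule.zero_mem _
    have hcase : ∀ j : Fin k, a + (j : ℕ) = 0 ∨ a + (j : ℕ) = 1 := fun j => by omega
    refine (hirr _ (τ.span_eq_iSup _ (fun j : Fin k => ((a + j : ℕ) : ZMod 2) + s) fun k => hgr _)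
      (τ.gl_invariant (fun z hz => map_mem_span_range _ _ (fun j => ?_) hz)
      (fun z hz => map_mem_span_range _ _ (fun j => ?_) hz)
      (fun z hz => map_mem_span_range _ _ (fun j => ?_) hz)
      (fun z hz => map_mem_span_range _ _ (fun j => ?_) hz))).resolve_left fun h => ?_
    · rcases hcase j with h | h <;> rw [h]
      · simp [hE]
      · rw [pow_one, hEF]
        rcases hak with ⟨h0, -⟩ | ⟨-, -, h0⟩
        · exact Submodule.smul_mem _ _ (by simpa using hmem 0 h0.le)
        · rw [h0, zero_smul]
          exact Submodule.zero_mem _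
    · rw [← Module.End.mul_apply, ← pow_succ']
      exact hmem _ (by omega)
    · rcases hcase j with h | h <;> rw [h]
      · rw [pow_zero, Module.End.one_apply, hA]
        exact Submodule.smul_mem _ _ (by simpa using hmem 0 (by omega))
      · rw [pow_one, hAF]
        exact Submodule.smul_mem _ _ (by simpa using hmem 1 (by omega))
    · rcases hcase j with h | h <;> rw [h]
      · rw [pow_zero, Module.End.one_apply, hD]
        exact Submodule.smul_mem _ _ (by simpa using hmem 0 (by omega))
      · rw [pow_one, hDF]
        exact Submodule.smul_mem _ _ (by simpa using hmem 1 (by omega))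
    · exact ha ((Submodule.mem_bot ℂ).1 (h ▸ hmem a le_rfl))
  -- If Fw were nonzero its line would be the whole module, yet w and Fw have different weights for
  -- E₂₂.
  have hFw : β + γ = 0 → F w = 0 := by
    intro h0
    by_contra hne
    have h1 := hspan 1 1 (Or.inr ⟨rfl, rfl, h0⟩) (by simpa using hne)
    have h2 := (hli 2 (Or.inl hne) le_rfl).notMem_span_image (s := {1}) (x := 0) (by simp)
    refine h2 ?_
    rw [Set.image_singleton]
    have h3 : w ∈ (⊤ : Submodule ℂ M) := Submodule.mem_top
    rw [← h1, Set.range_unique] at h3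
    simpa using h3
  have hne : β + γ ≠ 0 → F w ≠ 0 := by
    intro h2 h0
    rw [h0, map_zero, eq_comm] at hEF
    exact smul_ne_zero h2 hw0 hEF
  have hli' : LinearIndependent ℂ fun j : Fin m => (F ^ (j : ℕ)) w := by
    rcases hm with ⟨h, h'⟩ | ⟨h, -⟩
    · exact hli m (Or.inl (hne h')) h.le
    · exact hli m (Or.inr h) (by omega)
  have htop : ⊤ ≤ Submodule.span ℂ (Set.range fun j : Fin m => (F ^ (j : ℕ)) w) := by
    rw [← hspan 0 2 (Or.inl ⟨rfl, rfl⟩) (by simpa using hw0), Submodule.span_le]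
    rintro _ ⟨j, rfl⟩
    simp only [zero_add]
    by_cases hj : (j : ℕ) < m
    · exact Submodule.subset_span ⟨⟨j, hj⟩, rfl⟩
    · rw [show (j : ℕ) = 1 by omega, pow_one, hFw ((hm.resolve_left (by omega)).2)]
      exact Submodule.zero_mem _
  refine ⟨s, w, Module.Basis.mk hli' htop, fun k => Module.Basis.mk_apply hli' htop k, fun k => ?_,
    hE, hA, hD, ?_⟩
  · rw [Module.Basis.mk_apply]
    exact hgr k
  · rcases hm with ⟨rfl, -⟩ | ⟨rfl, h⟩
    · rw [pow_two, Module.End.mul_apply, t.FF]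
    · rw [pow_one, hFw h]

end GlReps

/-! ### Construction of representations -/

/-- The grading of `ℂ^κ` for which the `i`-th basis vector has parity `s i`. -/
def coordGrading {κ : Type*} (s : κ → ZMod 2) (p : ZMod 2) : Submodule ℂ (κ → ℂ) where
  carrier := {g | ∀ i, s i ≠ p → g i = 0}
  add_mem' hg hg' i hi := by simp [hg i hi, hg' i hi]
  zero_mem' _ _ := rfl
  smul_mem' c g hg i hi := by simp [hg i hi]

theorem coordGrading_isInternal {κ : Type*} (s : κ → ZMod 2) :
    DirectSum.IsInternal (coordGrading s) := by
  rw [DirectSum.isInternal_submodule_iff_isCompl (coordGrading s) (i := 0) (j := 1) (by decide)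
    (by ext p; simpa using parity_cases p)]
  refine ⟨Submodule.disjoint_def.2 fun g h0 h1 => ?_, codisjoint_iff_le_sup.2 fun g _ => ?_⟩
  · ext i
    rcases parity_cases (s i) with h | h
    · exact h1 i (by simp [h])
    · exact h0 i (by simp [h])
  · refine Submodule.mem_sup.2 ⟨fun i => if s i = 0 then g i else 0, fun i hi => if_neg hi,
      fun i => if s i = 1 then g i else 0, fun i hi => if_neg hi, ?_⟩
    ext i
    rcases parity_cases (s i) with h | h <;> simp [h]

section Construct

variable {M : Type*} [AddCommGroup M] [Module ℂ M]

/-- The linear map that gives the action of `spo(2|1)` in terms of the odd root vectors. -/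
def spoLinear (P N H : Module.End ℂ M) : Matrix (Fin 3) (Fin 3) ℂ →ₗ[ℂ] Module.End ℂ M where
  toFun X := X 0 0 • H + X 0 1 • (P * P) - X 1 0 • (N * N) + X 0 2 • P + X 1 2 • N
  map_add' X Y := by
    simp only [Matrix.add_apply]
    module
  map_smul' c X := by
    simp only [Matrix.smul_apply, smul_eq_mul, RingHom.id_apply]
    module

theorem spoLinear_apply (P N H : Module.End ℂ M) (X : Matrix (Fin 3) (Fin 3) ℂ) (z : M) :
    spoLinear P N H X z = X 0 0 • H z + X 0 1 • P (P z) - X 1 0 • N (N z) + X 0 2 • P z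
      + X 1 2 • N z := rfl

theorem spo_even_matrix (X : spo21.part 0) :
    X.1 = !![X.1 0 0, X.1 0 1, 0; X.1 1 0, -X.1 0 0, 0; 0, 0, 0] := by
  conv_lhs => rw [spo_even_eq X]
  ext i j
  fin_cases i <;> fin_cases j <;> simp [spoH, spoE, spoF]

theorem spo_odd_matrix (X : spo21.part 1) :
    X.1 = !![0, 0, X.1 0 2; 0, 0, X.1 1 2; -X.1 1 2, X.1 0 2, 0] := by
  conv_lhs => rw [spo_odd_eq X]
  ext i j
  fin_cases i <;> fin_cases j <;> simp [spoQ, spoN]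

/-- The three relations suffice to bring every word to the order N, H, P. In each of the four parity
cases the bracket relation is then a linear identity between ordered words. -/
theorem SpoTriple.bracket {P N H : Module.End ℂ M} (t : SpoTriple P N H) {p q : ZMod 2}
    (X : spo21.part p) (Y : spo21.part q) (z : M) :
    spoLinear P N H (superBracket p q X.1 Y.1) z
      = spoLinear P N H X.1 (spoLinear P N H Y.1 z)
        - sgn (p * q) • spoLinear P N H Y.1 (spoLinear P N H X.1 z) := by
  have PH : ∀ z, P (H z) = H (P z) - P z := fun z => by rw [t.HP, add_sub_cancel_right]
  obtain rfl | rfl := parity_cases p <;> obtain rfl | rfl := parity_cases q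
  · rw [spo_even_matrix X, spo_even_matrix Y]
    generalize X.1 0 0 = a, X.1 0 1 = b, X.1 1 0 = c, Y.1 0 0 = a', Y.1 0 1 = b', Y.1 1 0 = c'
    simp [spoLinear_apply, superBracket, sgn_zero, t.PN, t.HN, PH]
    module
  · rw [spo_even_matrix X, spo_odd_matrix Y]
    generalize X.1 0 0 = a, X.1 0 1 = b, X.1 1 0 = c, Y.1 0 2 = a', Y.1 1 2 = b'
    simp [spoLinear_apply, superBracket, sgn_zero, t.PN, t.HN, PH]
    module
  · rw [spo_odd_matrix X, spo_even_matrix Y]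
    generalize X.1 0 2 = a, X.1 1 2 = b, Y.1 0 0 = a', Y.1 0 1 = b', Y.1 1 0 = c'
    simp [spoLinear_apply, superBracket, sgn_zero, t.PN, t.HN, PH]
    module
  · rw [spo_odd_matrix X, spo_odd_matrix Y]
    generalize X.1 0 2 = a, X.1 1 2 = b, Y.1 0 2 = a', Y.1 1 2 = b'
    simp [spoLinear_apply, superBracket, sgn_one, t.PN, t.HN, PH]
    module

/-- The representation of `spo(2|1)` given by its odd root vectors. -/
def SpoTriple.toSuperRep {P N H : Module.End ℂ M} (t : SpoTriple P N H) (gr : ZMod 2 → Submodule ℂ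
  M)
    (hgr : DirectSum.IsInternal gr) (hP : ∀ q, ∀ z ∈ gr q, P z ∈ gr (1 + q))
    (hN : ∀ q, ∀ z ∈ gr q, N z ∈ gr (1 + q)) (hH : ∀ q, ∀ z ∈ gr q, H z ∈ gr q) :
    SuperRep spo21 M where
  grading := gr
  isInternal := hgr
  act p := (spoLinear P N H).domRestrict (spo21.part p)
  act_mem := by
    intro p q X z hz
    have h2 : ∀ q : ZMod 2, 1 + (1 + q) = q := by decide
    change spoLinear P N H X.1 z ∈ _
    rw [spoLinear_apply]
    obtain rfl | rfl := parity_cases p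
    · rw [spo_even_matrix X]
      have hPP := hP _ _ (hP _ _ hz)
      have hNN := hN _ _ (hN _ _ hz)
      rw [h2] at hPP hNN
      simpa using Submodule.sub_mem _ (Submodule.add_mem _ (Submodule.smul_mem _ _ (hH _ _ hz))
        (Submodule.smul_mem _ _ hPP)) (Submodule.smul_mem _ _ hNN)
    · rw [spo_odd_matrix X]
      simpa using Submodule.add_mem _ (Submodule.smul_mem _ _ (hP _ _ hz))
        (Submodule.smul_mem _ _ (hN _ _ hz))
  act_bracket X Y := LinearMap.ext fun z => t.bracket X Y z

/-- The linear map that gives the action of `gl(1|1)` in terms of the matrix units. -/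
def glLinear (E F A D : Module.End ℂ M) : Matrix (Fin 2) (Fin 2) ℂ →ₗ[ℂ] Module.End ℂ M where
  toFun X := X 0 0 • A + X 1 1 • D + X 0 1 • E + X 1 0 • F
  map_add' X Y := by
    simp only [Matrix.add_apply]
    module
  map_smul' c X := by
    simp only [Matrix.smul_apply, smul_eq_mul, RingHom.id_apply]
    module

theorem glLinear_apply (E F A D : Module.End ℂ M) (X : Matrix (Fin 2) (Fin 2) ℂ) (z : M) :
    glLinear E F A D X z = X 0 0 • A z + X 1 1 • D z + X 0 1 • E z + X 1 0 • F z := rfl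

theorem gl_even_matrix (X : gl11.part 0) : X.1 = !![X.1 0 0, 0; 0, X.1 1 1] := by
  conv_lhs => rw [gl_even_eq X]
  ext i j
  fin_cases i <;> fin_cases j <;> simp [glE11, glE22]

theorem gl_odd_matrix (X : gl11.part 1) : X.1 = !![0, X.1 0 1; X.1 1 0, 0] := by
  conv_lhs => rw [gl_odd_eq X]
  ext i j
  fin_cases i <;> fin_cases j <;> simp [glE12, glE21]

theorem GlQuadruple.bracket {E F A D : Module.End ℂ M} (t : GlQuadruple E F A D) {p q : ZMod 2}
    (X : gl11.part p) (Y : gl11.part q) (z : M) :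
    glLinear E F A D (superBracket p q X.1 Y.1) z
      = glLinear E F A D X.1 (glLinear E F A D Y.1 z)
        - sgn (p * q) • glLinear E F A D Y.1 (glLinear E F A D X.1 z) := by
  obtain rfl | rfl := parity_cases p <;> obtain rfl | rfl := parity_cases q
  · rw [gl_even_matrix X, gl_even_matrix Y]
    generalize X.1 0 0 = a, X.1 1 1 = b, Y.1 0 0 = a', Y.1 1 1 = b'
    simp [glLinear_apply, superBracket, sgn_zero, t.AD]
    module
  · rw [gl_even_matrix X, gl_odd_matrix Y]
    generalize X.1 0 0 = a, X.1 1 1 = b, Y.1 0 1 = a', Y.1 1 0 = b'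
    simp [glLinear_apply, superBracket, sgn_zero, t.AE, t.AF, t.DE, t.DF]
    module
  · rw [gl_odd_matrix X, gl_even_matrix Y]
    generalize X.1 0 1 = a, X.1 1 0 = b, Y.1 0 0 = a', Y.1 1 1 = b'
    simp [glLinear_apply, superBracket, sgn_zero, t.AE, t.AF, t.DE, t.DF]
    module
  · rw [gl_odd_matrix X, gl_odd_matrix Y]
    generalize X.1 0 1 = a, X.1 1 0 = b, Y.1 0 1 = a', Y.1 1 0 = b'
    simp [glLinear_apply, superBracket, sgn_one, t.EF, t.EE, t.FF]
    module

/-- The representation of `gl(1|1)` given by the actions of the matrix units. -/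
def GlQuadruple.toSuperRep {E F A D : Module.End ℂ M} (t : GlQuadruple E F A D)
    (gr : ZMod 2 → Submodule ℂ M) (hgr : DirectSum.IsInternal gr)
    (hE : ∀ q, ∀ z ∈ gr q, E z ∈ gr (1 + q)) (hF : ∀ q, ∀ z ∈ gr q, F z ∈ gr (1 + q))
    (hA : ∀ q, ∀ z ∈ gr q, A z ∈ gr q) (hD : ∀ q, ∀ z ∈ gr q, D z ∈ gr q) :
    SuperRep gl11 M where
  grading := gr
  isInternal := hgr
  act p := (glLinear E F A D).domRestrict (gl11.part p)
  act_mem := by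
    intro p q X z hz
    change glLinear E F A D X.1 z ∈ _
    rw [glLinear_apply]
    obtain rfl | rfl := parity_cases p
    · rw [gl_even_matrix X]
      simpa using Submodule.add_mem _ (Submodule.smul_mem _ _ (hA _ _ hz))
        (Submodule.smul_mem _ _ (hD _ _ hz))
    · rw [gl_odd_matrix X]
      simpa using Submodule.add_mem _ (Submodule.smul_mem _ _ (hE _ _ hz))
        (Submodule.smul_mem _ _ (hF _ _ hz))
  act_bracket X Y := LinearMap.ext fun z => t.bracket X Y z

end Construct

/-! ### Existence of the irreducible modules -/

/-- Extension by zero of a finite sequence. -/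
def extend {m : ℕ} (j : ℕ) : (Fin m → ℂ) →ₗ[ℂ] ℂ :=
  if h : j < m then LinearMap.proj ⟨j, h⟩ else 0

theorem extend_of_lt {m j : ℕ} (h : j < m) (g : Fin m → ℂ) : extend j g = g ⟨j, h⟩ := by
  simp [extend, h]

theorem extend_of_ge {m j : ℕ} (h : m ≤ j) (g : Fin m → ℂ) : extend j g = 0 := by
  simp [extend, not_lt.2 h]

theorem extend_fin {m : ℕ} (k : Fin m) (g : Fin m → ℂ) : extend k g = g k := extend_of_lt k.2 g

/-- The raising operator of the model of the irreducible `spo(2|1)`-module. -/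
def modelP (n : ℕ) : Module.End ℂ (Fin (2 * n + 1) → ℂ) :=
  LinearMap.pi fun k => lowerCoeff n (k + 1) • extend (k + 1)

/-- The lowering operator of the model of the irreducible `spo(2|1)`-module. -/
def modelN (n : ℕ) : Module.End ℂ (Fin (2 * n + 1) → ℂ) :=
  LinearMap.pi fun k => if (k : ℕ) = 0 then 0 else extend (k - 1)

/-- The Cartan operator of the model of the irreducible `spo(2|1)`-module. -/
def modelH (n : ℕ) : Module.End ℂ (Fin (2 * n + 1) → ℂ) :=
  LinearMap.pi fun k => ((n : ℂ) - (k : ℕ)) • LinearMap.proj k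

theorem modelP_apply (n : ℕ) (g : Fin (2 * n + 1) → ℂ) (k : Fin (2 * n + 1)) :
    modelP n g k = lowerCoeff n (k + 1) * extend (k + 1) g := rfl

theorem modelN_apply (n : ℕ) (g : Fin (2 * n + 1) → ℂ) (k : Fin (2 * n + 1)) :
    modelN n g k = if (k : ℕ) = 0 then 0 else extend (k - 1) g := by
  simp only [modelN, LinearMap.pi_apply]
  split_ifs <;> rfl

theorem modelH_apply (n : ℕ) (g : Fin (2 * n + 1) → ℂ) (k : Fin (2 * n + 1)) :
    modelH n g k = ((n : ℂ) - (k : ℕ)) * g k := rfl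

theorem model_spoTriple (n : ℕ) : SpoTriple (modelP n) (modelN n) (modelH n) where
  PN g := by
    ext k
    have h1 : modelP n (modelN n g) k = lowerCoeff n (k + 1) * g k := by
      rw [modelP_apply]
      by_cases hk : (k : ℕ) + 1 < 2 * n + 1
      · rw [extend_of_lt hk, modelN_apply]
        simp [extend_fin]
      -- At the last index N shifts the coordinate out of range. The truncation is consistent
      -- because the coefficient at 2n + 1 vanishes.
      · rw [show (k : ℕ) + 1 = 2 * n + 1 by omega, lowerCoeff_last, zero_mul, zero_mul]
    have h2 : modelN n (modelP n g) k = lowerCoeff n k * g k := by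
      rw [modelN_apply]
      split_ifs with hk
      · rw [hk, lowerCoeff, zero_mul]
      · rw [extend_of_lt (by omega), modelP_apply]
        simp only [Nat.sub_add_cancel (Nat.pos_of_ne_zero hk), extend_fin]
    simp only [Pi.sub_apply, Pi.neg_apply, h1, h2, modelH_apply, lowerCoeff]
    ring
  HN g := by
    ext k
    simp only [Pi.sub_apply, modelH_apply, modelN_apply]
    split_ifs with hk
    · simp
    · rw [extend_of_lt (by omega), extend_of_lt (by omega), modelH_apply,
        Nat.cast_sub (Nat.pos_of_ne_zero hk)]
      push_cast
      ring
  HP g := by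
    ext k
    simp only [Pi.add_apply, modelH_apply, modelP_apply]
    by_cases hk : (k : ℕ) + 1 < 2 * n + 1
    · rw [extend_of_lt hk, extend_of_lt hk, modelH_apply]
      push_cast
      ring
    · rw [extend_of_ge (not_lt.1 hk), extend_of_ge (not_lt.1 hk)]
      ring

/-- The model of the irreducible `spo(2|1)`-module of highest weight `n`. -/
def modelSpo (n : ℕ) : SuperRep spo21 (Fin (2 * n + 1) → ℂ) :=
  (model_spoTriple n).toSuperRep (coordGrading fun k => ((k : ℕ) : ZMod 2))
    (coordGrading_isInternal _)
    (by
      intro q g hg k hk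
      rw [modelP_apply]
      by_cases hk' : (k : ℕ) + 1 < 2 * n + 1
      · rw [extend_of_lt hk', hg, mul_zero]
        intro h
        refine hk ?_
        have h2 : ∀ a b : ZMod 2, a + 1 = b → a = 1 + b := by decide
        exact h2 _ _ (by simpa using h)
      · rw [extend_of_ge (not_lt.1 hk'), mul_zero])
    (by
      intro q g hg k hk
      rw [modelN_apply]
      split_ifs with hk'
      · rfl
      · rw [extend_of_lt (by omega), hg]
        intro h
        refine hk ?_
        have h3 : ((k : ℕ) : ZMod 2) = 1 + (((k : ℕ) - 1 : ℕ) : ZMod 2) := by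
          rw [add_comm (1 : ZMod 2), ← Nat.cast_add_one,
            Nat.sub_add_cancel (Nat.pos_of_ne_zero hk')]
        rw [← h]
        exact h3)
    (by
      intro q g hg k hk
      rw [modelH_apply, hg k hk, mul_zero])

theorem modelSpo_act (n : ℕ) : (modelSpo n).act 1 spoQ = modelP n ∧
    (modelSpo n).act 1 spoN = modelN n ∧ (modelSpo n).act 0 spoH = modelH n := by
  refine ⟨LinearMap.ext fun g => ?_, LinearMap.ext fun g => ?_, LinearMap.ext fun g => ?_⟩
  · refine (spoLinear_apply (modelP n) (modelN n) (modelH n) spoQ.1 g).trans ?_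
    simp [spoQ]
  · refine (spoLinear_apply (modelP n) (modelN n) (modelH n) spoN.1 g).trans ?_
    simp [spoN]
  · refine (spoLinear_apply (modelP n) (modelN n) (modelH n) spoH.1 g).trans ?_
    simp [spoH]

/-- Each application of P moves the highest nonzero coordinate down by one and multiplies it by a
nonzero coefficient. After finitely many steps only a multiple of the highest weight vector is left.
-/
theorem single_zero_mem_of_invariant {n : ℕ} {U : Submodule ℂ (Fin (2 * n + 1) → ℂ)}
    (hP : ∀ g ∈ U, modelP n g ∈ U) (k : ℕ) (g : Fin (2 * n + 1) → ℂ) (hg : g ∈ U) (hg0 : g ≠ 0)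
    (hk : ∀ j : Fin (2 * n + 1), k < j → g j = 0) : Pi.single 0 1 ∈ U := by
  induction k generalizing g with
  | zero =>
    have h : g = g 0 • Pi.single 0 1 := by
      ext j
      rcases eq_or_ne j 0 with rfl | hj
      · simp
      · simp [hj, hk j (Fin.pos_iff_ne_zero.2 hj)]
    have h0 : g 0 ≠ 0 := fun h0 => hg0 (by rw [h, h0, zero_smul])
    rw [h] at hg
    exact (U.smul_mem_iff h0).1 hg
  | succ k ih =>
    by_cases h : extend (k + 1) g = 0
    · refine ih g hg hg0 fun j hj => ?_
      rcases Nat.lt_or_eq_of_le (Nat.succ_le_of_lt hj) with h' | h'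
      · exact hk j h'
      · rw [← extend_fin j g, ← h']
        exact h
    · have hlt : k + 1 < 2 * n + 1 := by
        by_contra h'
        exact h (extend_of_ge (not_lt.1 h') g)
      refine ih _ (hP g hg) (fun h0 => ?_) fun j hj => ?_
      · have := congrFun h0 ⟨k, by omega⟩
        rw [modelP_apply] at this
        exact mul_ne_zero (lowerCoeff_ne_zero (Nat.succ_ne_zero k) (by omega)) h this
      · rw [modelP_apply]
        by_cases hj' : (j : ℕ) + 1 < 2 * n + 1
        · rw [extend_of_lt hj', hk _ (by simpa using hj), mul_zero]
        · rw [extend_of_ge (not_lt.1 hj'), mul_zero]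

theorem single_mem_of_invariant {n : ℕ} {U : Submodule ℂ (Fin (2 * n + 1) → ℂ)}
    (hN : ∀ g ∈ U, modelN n g ∈ U) (h0 : Pi.single 0 1 ∈ U) (k : ℕ) (hk : k < 2 * n + 1) :
    Pi.single ⟨k, hk⟩ 1 ∈ U := by
  induction k with
  | zero => exact h0
  | succ k ih =>
    have h : modelN n (Pi.single ⟨k, by omega⟩ 1) = Pi.single ⟨k + 1, hk⟩ 1 := by
      ext j
      rw [modelN_apply]
      split_ifs with hj
      · rw [Pi.single_eq_of_ne]
        intro h
        simp [h] at hj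
      · rw [extend_of_lt (by omega), Pi.single_apply, Pi.single_apply]
        simp only [Fin.ext_iff]
        exact if_congr (by omega) rfl rfl
    rw [← h]
    exact hN _ (ih (by omega))

theorem eq_top_of_single_mem {m : ℕ} {U : Submodule ℂ (Fin m → ℂ)}
    (h : ∀ k, Pi.single k 1 ∈ U) : U = ⊤ := by
  refine eq_top_iff.2 fun g _ => ?_
  have : g = ∑ k, g k • Pi.single k 1 := by
    ext j
    simp [Finset.sum_apply, Pi.single_apply]
  rw [this]
  exact U.sum_mem fun k _ => U.smul_mem _ (h k)

theorem isSpoIrrep_model (n : ℕ) : IsSpoIrrep (modelSpo n) (n : ℂ) := by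
  obtain ⟨hQ, hN, hH⟩ := modelSpo_act n
  have hP0 : modelP n (Pi.single 0 1) = 0 := by
    ext k
    rw [modelP_apply]
    by_cases hk : (k : ℕ) + 1 < 2 * n + 1
    · rw [extend_of_lt hk, Pi.single_eq_of_ne (Fin.ne_of_val_ne (Nat.succ_ne_zero _)), mul_zero,
        Pi.zero_apply]
    · rw [extend_of_ge (not_lt.1 hk), mul_zero, Pi.zero_apply]
  refine ⟨⟨inferInstance, fun U _ hU => ?_⟩, 0, Pi.single 0 1, ?_, ?_, ?_, ?_, ?_⟩
  · refine or_iff_not_imp_left.2 fun hne => ?_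
    obtain ⟨g, hg, hg0⟩ := Submodule.exists_mem_ne_zero_of_ne_bot hne
    have h0 := single_zero_mem_of_invariant (fun g hg => hQ ▸ hU 1 spoQ g hg) (2 * n) g hg hg0
      fun j hj => by omega
    exact eq_top_of_single_mem fun k =>
      single_mem_of_invariant (fun g hg => hN ▸ hU 1 spoN g hg) h0 k k.2
  · intro k hk
    rw [Pi.single_eq_of_ne]
    rintro rfl
    simp at hk
  · exact fun h => one_ne_zero (α := ℂ) (by simpa using congrFun h 0)
  · rw [(modelSpo n).act_spoE, hQ, hP0, map_zero]
  · rw [hQ, hP0]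
  · rw [hH]
    ext k
    rw [modelH_apply]
    rcases eq_or_ne k 0 with rfl | hk
    · simp
    · simp [hk]

theorem typical_glQuadruple (β γ : ℂ) : GlQuadruple
    (Matrix.toLin' !![0, β + γ; 0, 0]) (Matrix.toLin' !![0, 0; 1, 0])
    (Matrix.toLin' !![β, 0; 0, β - 1]) (Matrix.toLin' !![γ, 0; 0, γ + 1]) := by
  constructor <;> intro g <;> ext k <;> fin_cases k <;> simp <;> ring

/-- The model of the irreducible `gl(1|1)`-module of highest weight `(β, γ)`, `β + γ ≠ 0`. -/
def typicalGl (β γ : ℂ) : SuperRep gl11 (Fin 2 → ℂ) := by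
  refine (typical_glQuadruple β γ).toSuperRep (coordGrading fun k => ((k : ℕ) : ZMod 2))
    (coordGrading_isInternal _) ?_ ?_ ?_ ?_ <;>
  · intro q g hg k hk
    have h0 := hg 0
    have h1 := hg 1
    obtain rfl | rfl := parity_cases q <;> fin_cases k <;>
      simp_all [Matrix.vecHead, Matrix.vecTail, CharTwo.add_self_eq_zero]

theorem isGlIrrep_typical {β γ : ℂ} (h : β + γ ≠ 0) : IsGlIrrep (typicalGl β γ) (β, γ) := by
  have act : ∀ (p : ZMod 2) (X : gl11.part p) (g : Fin 2 → ℂ), (typicalGl β γ).act p X g =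
      X.1 0 0 • ![β * g 0, (β - 1) * g 1] + X.1 1 1 • ![γ * g 0, (γ + 1) * g 1]
        + X.1 0 1 • ![(β + γ) * g 1, 0] + X.1 1 0 • ![0, g 0] := by
    intro p X g
    refine (glLinear_apply _ _ _ _ X.1 g).trans ?_
    ext k
    fin_cases k <;> simp [Matrix.vecHead, Matrix.vecTail]
  refine ⟨⟨inferInstance, fun U _ hU => ?_⟩, 0, Pi.single 0 1, ?_, ?_, ?_, ?_, ?_⟩
  · refine or_iff_not_imp_left.2 fun hne => ?_
    obtain ⟨g, hg, hg0⟩ := Submodule.exists_mem_ne_zero_of_ne_bot hne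
    have h0 : Pi.single 0 1 ∈ U := by
      by_cases h1 : g 1 = 0
      · have h2 : g = g 0 • Pi.single 0 1 := by
          ext k
          fin_cases k <;> simp [h1]
        have h3 : g 0 ≠ 0 := fun h3 => hg0 (by rw [h2, h3, zero_smul])
        rw [h2] at hg
        exact (U.smul_mem_iff h3).1 hg
      -- Here typicality enters: E recovers the highest weight vector from g with the factor β + γ.
      · have h2 : (typicalGl β γ).act 1 glE12 g = ((β + γ) * g 1) • Pi.single 0 1 := by
          rw [act]
          ext k
          fin_cases k <;> simp [glE12]
        have h3 := hU 1 glE12 g hg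
        rw [h2] at h3
        exact (U.smul_mem_iff (mul_ne_zero h h1)).1 h3
    have h1 : Pi.single 1 1 ∈ U := by
      have h2 : (typicalGl β γ).act 1 glE21 (Pi.single 0 1) = Pi.single 1 1 := by
        rw [act]
        ext k
        fin_cases k <;> simp [glE21]
      exact h2 ▸ hU 1 glE21 _ h0
    exact eq_top_of_single_mem (Fin.forall_fin_two.2 ⟨h0, h1⟩)
  · intro k hk
    rw [Pi.single_eq_of_ne]
    rintro rfl
    simp at hk
  · exact fun h => one_ne_zero (α := ℂ) (by simpa using congrFun h 0)
  · rw [act]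
    ext k
    fin_cases k <;> simp [glE12]
  · rw [act]
    ext k
    fin_cases k <;> simp [glE11]
  · rw [act]
    ext k
    fin_cases k <;> simp [glE22]

theorem atypical_glQuadruple {β γ : ℂ} (h : β + γ = 0) :
    GlQuadruple (M := Fin 1 → ℂ) 0 0 (β • 1) (γ • 1) := by
  constructor <;> intro g <;> simp [← add_smul, h, smul_comm β γ]

/-- The one-dimensional `gl(1|1)`-module of weight `(β, γ)`, `β + γ = 0`. -/
def atypicalGl {β γ : ℂ} (h : β + γ = 0) : SuperRep gl11 (Fin 1 → ℂ) :=
  (atypical_glQuadruple h).toSuperRep (coordGrading fun _ => 0) (coordGrading_isInternal _)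
    (fun _ _ _ => Submodule.zero_mem _) (fun _ _ _ => Submodule.zero_mem _)
    (fun _ _ hz => Submodule.smul_mem _ _ hz) (fun _ _ hz => Submodule.smul_mem _ _ hz)

theorem isGlIrrep_atypical {β γ : ℂ} (h : β + γ = 0) : IsGlIrrep (atypicalGl h) (β, γ) := by
  have act : ∀ (p : ZMod 2) (X : gl11.part p) (g : Fin 1 → ℂ), (atypicalGl h).act p X g =
      X.1 0 0 • β • g + X.1 1 1 • γ • g := by
    intro p X g
    refine (glLinear_apply _ _ _ _ X.1 g).trans ?_
    simp
  refine ⟨⟨inferInstance, fun U _ hU => ?_⟩, 0, Pi.single 0 1, ?_, ?_, ?_, ?_, ?_⟩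
  · refine or_iff_not_imp_left.2 fun hne => ?_
    obtain ⟨g, hg, hg0⟩ := Submodule.exists_mem_ne_zero_of_ne_bot hne
    have h2 : g = g 0 • Pi.single 0 1 := by
      ext k
      fin_cases k
      simp
    have h3 : g 0 ≠ 0 := fun h3 => hg0 (by rw [h2, h3, zero_smul])
    rw [h2] at hg
    exact eq_top_of_single_mem (Fin.forall_fin_one.2 ((U.smul_mem_iff h3).1 hg))
  · intro k hk
    exact absurd rfl hk
  · exact fun h => one_ne_zero (α := ℂ) (by simpa using congrFun h 0)
  · rw [act]
    simp [glE12]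
  · rw [act]
    simp [glE11]
  · rw [act]
    simp [glE22]

theorem exists_isGlIrrep (β γ : ℂ) :
    ∃ (M : Type) (_ : AddCommGroup M) (_ : Module ℂ M) (τ : SuperRep gl11 M),
      IsGlIrrep τ (β, γ) := by
  by_cases h : β + γ = 0
  · exact ⟨_, _, _, _, isGlIrrep_atypical h⟩
  · exact ⟨_, _, _, _, isGlIrrep_typical h⟩

/-! ### Joint highest weight vectors -/

theorem opTriple : SpoTriple (M := SE) opP opN opH := ⟨opP_opN, opH_opN, opH_opP⟩

theorem opH_eq (z : SE) : opH z = -opN (opP z) - opP (opN z) := by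
  rw [opP_opN]
  abel

theorem opH_opF (z : SE) : opH (opF z) = opF (opH z) := by
  simp only [opH_eq, map_sub, map_neg, opF_opN, opF_opP, neg_neg]

/-- A vector of `S^d(E)` of highest weight `n` for `spo(2|1)` and of highest weight
`(d - i + 1/2, i - 1/2)` for `gl(1|1)`. -/
structure IsJointHighest (d n i : ℕ) (h : SE) : Prop where
  mem : h ∈ singular d
  ne_zero : h ≠ 0
  opP_eq : opP h = 0
  opH_eq : opH h = (n : ℂ) • h
  deg₂_eq : deg₂ h = (i : ℂ) • h

/-- The vectors generated by a joint highest weight vector. -/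
def descend (h : SE) (k j : ℕ) : SE := (opN ^ k) ((opF ^ j) h)

theorem descend_zero_zero (h : SE) : descend h 0 0 = h := rfl

theorem descend_succ (h : SE) (k j : ℕ) : descend h (k + 1) j = opN (descend h k j) := by
  rw [descend, pow_succ', Module.End.mul_apply, descend]

theorem descend_zero_succ (h : SE) (j : ℕ) : descend h 0 (j + 1) = opF (descend h 0 j) := by
  rw [descend, descend, pow_zero, Module.End.one_apply, pow_succ', Module.End.mul_apply,
    Module.End.one_apply]

/-- F is odd and anticommutes with each of the k factors N. This sign corresponds to the Koszul sign
in the action of gl(1|1) on the tensor product. -/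
theorem opF_descend (h : SE) (k j : ℕ) :
    opF (descend h k j) = (-1 : ℂ) ^ k • descend h k (j + 1) := by
  induction k with
  | zero => rw [pow_zero, one_smul, descend_zero_succ]
  | succ k ih =>
    rw [descend_succ, opF_opN, ih, map_smul, descend_succ, pow_succ]
    module

/-- E F + F E is the total degree, which acts by d on h, while h itself is killed by E and F² = 0.
-/
theorem opE_descend_zero {d n i : ℕ} {h : SE} (hh : IsJointHighest d n i h) (j : ℕ) :
    opE (descend h 0 j) = if j = 1 then (d : ℂ) • h else 0 := by
  obtain ⟨hd, -, hE⟩ := mem_singular.1 hh.mem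
  match j with
  | 0 => simpa [descend_zero_zero] using hE
  | 1 =>
    rw [descend_zero_succ, descend_zero_zero, opE_opF, hE, ← deg_apply, hd]
    simp
  | j + 2 => simp [descend_zero_succ, opF_opF]

theorem opE_descend {d n i : ℕ} {h : SE} (hh : IsJointHighest d n i h) (k j : ℕ) :
    opE (descend h k j) = if j = 1 then ((-1 : ℂ) ^ k * d) • descend h k 0 else 0 := by
  induction k with
  | zero => rw [opE_descend_zero hh, pow_zero, one_mul, descend_zero_zero]
  | succ k ih =>
    rw [descend_succ, opE_opN, ih]
    split_ifs
    · rw [map_smul, descend_succ, pow_succ]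
      module
    · simp

theorem deg_descend {d n i : ℕ} {h : SE} (hh : IsJointHighest d n i h) (k j : ℕ) :
    deg (descend h k j) = (d : ℂ) • descend h k j := by
  induction k with
  | zero =>
    induction j with
    | zero => exact (mem_singular.1 hh.mem).1
    | succ j ih => rw [descend_zero_succ, deg_opF, ih, map_smul]
  | succ k ih => rw [descend_succ, deg_opN, ih, map_smul]

theorem deg₂_descend {d n i : ℕ} {h : SE} (hh : IsJointHighest d n i h) (k j : ℕ) :
    deg₂ (descend h k j) = ((i : ℂ) + j) • descend h k j := by
  induction k with
  | zero =>
    induction j with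
    | zero => simpa [descend_zero_zero] using hh.deg₂_eq
    | succ j ih =>
      rw [descend_zero_succ, deg₂_opF, ih, map_smul]
      push_cast
      module
  | succ k ih => rw [descend_succ, deg₂_opN, ih, map_smul]

theorem deg₁_descend {d n i : ℕ} {h : SE} (hh : IsJointHighest d n i h) (k j : ℕ) :
    deg₁ (descend h k j) = ((d : ℂ) - i - j) • descend h k j := by
  have h1 := deg_descend hh k j
  rw [deg_apply, deg₂_descend hh] at h1
  rw [eq_sub_of_add_eq h1]
  module

theorem opP_descend_zero {d n i : ℕ} {h : SE} (hh : IsJointHighest d n i h) (j : ℕ) :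
    opP ((opF ^ j) h) = 0 := by
  induction j with
  | zero => exact hh.opP_eq
  | succ j ih =>
    rw [pow_succ', Module.End.mul_apply, ← neg_eq_zero, ← opF_opP, ih, map_zero]

theorem opH_descend_zero {d n i : ℕ} {h : SE} (hh : IsJointHighest d n i h) (j : ℕ) :
    opH ((opF ^ j) h) = (n : ℂ) • (opF ^ j) h := by
  induction j with
  | zero => exact hh.opH_eq
  | succ j ih => rw [pow_succ', Module.End.mul_apply, opH_opF, ih, map_smul]

theorem opP_descend_succ {d n i : ℕ} {h : SE} (hh : IsJointHighest d n i h) (k j : ℕ) :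
    opP (descend h (k + 1) j) = lowerCoeff n (k + 1) • descend h k j :=
  opTriple.P_pow_succ (opP_descend_zero hh j) (opH_descend_zero hh j) k

theorem opH_descend {d n i : ℕ} {h : SE} (hh : IsJointHighest d n i h) (k j : ℕ) :
    opH (descend h k j) = ((n : ℂ) - k) • descend h k j :=
  opTriple.H_pow (opH_descend_zero hh j) k

theorem descend_mem_harmonics {d n i : ℕ} {h : SE} (hh : IsJointHighest d n i h) (k j : ℕ) :
    descend h k j ∈ harmonics d := by
  induction k with
  | zero =>
    induction j with
    | zero => exact hh.mem.1
    | succ j ih =>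
      rw [descend_zero_succ]
      exact opF_mem_harmonics ih
  | succ k ih =>
    rw [descend_succ]
    exact opN_mem_harmonics ih

theorem descend_mem_parityPart {h : SE} {ε : ZMod 2} (hh : h ∈ parityPart ε) (k j : ℕ) :
    descend h k j ∈ parityPart (k + j + ε) := by
  induction k with
  | zero =>
    induction j with
    | zero => simpa [descend_zero_zero] using hh
    | succ j ih =>
      rw [descend_zero_succ]
      convert opF_mem ih using 2
      push_cast
      ring
  | succ k ih =>
    rw [descend_succ]
    convert opN_mem ih using 2
    push_cast
    ring

/-- For j = 0 the chain lies in the finite-dimensional singular space, which N preserves, so it must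
stop at 2n + 1. Since F passes N up to sign, this carries over to F^j h. -/
theorem descend_last {d n i : ℕ} {h : SE} (hh : IsJointHighest d n i h)
    [Module.Finite ℂ (singular d)] {k : ℕ} (hk : 2 * n + 1 ≤ k) (j : ℕ) : descend h k j = 0 := by
  have h0 : ∀ j, descend h (2 * n + 1) j = 0 := fun j => by
    induction j with
    | zero =>
      exact opTriple.pow_eq_zero_of_finite hh.opP_eq hh.opH_eq (singular d) hh.mem
        fun z hz => opN_mem_singular hz
    | succ j ih =>
      have h1 := opF_descend h (2 * n + 1) j
      rw [ih, map_zero, eq_comm] at h1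
      exact (smul_eq_zero.1 h1).resolve_left (pow_ne_zero _ (neg_ne_zero.2 one_ne_zero))
  obtain ⟨l, rfl⟩ := Nat.exists_eq_add_of_le' hk
  have h1 := h0 j
  rw [descend] at h1 ⊢
  rw [pow_add, Module.End.mul_apply, h1, map_zero]

/-- If d ≠ 0 then Fh is nonzero because E F h = d h. Each F^j h is again a highest weight vector for
spo(2|1), so its chain survives up to k = 2n. -/
theorem descend_ne_zero {d n i m : ℕ} (hm : m = 2 ∧ d ≠ 0 ∨ m = 1 ∧ d = 0) {h : SE}
    (hh : IsJointHighest d n i h) {k j : ℕ} (hk : k < 2 * n + 1) (hj : j < m) :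
    descend h k j ≠ 0 := by
  refine opTriple.pow_ne_zero (opP_descend_zero hh j) (opH_descend_zero hh j) ?_ (by omega)
  intro h0
  have h1 := opE_descend hh 0 j
  match j with
  | 0 => exact hh.ne_zero h0
  | 1 =>
    rw [descend, pow_zero, Module.End.one_apply, h0, map_zero] at h1
    simp only [if_true, pow_zero, one_mul, descend_zero_zero] at h1
    have hd : (d : ℂ) ≠ 0 := Nat.cast_ne_zero.2 (by omega)
    exact smul_ne_zero hd hh.ne_zero h1.symm
  | j + 2 => omega

/-- The degree i + j alone would confuse Fh for one generator with the next generator. As F E has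
eigenvalue d at j = 1 and 0 at j = 0, adding 3/d times F E replaces i + j by i + 4j. For d = 0 only
j = 0 occurs, where E vanishes, so the value of 3/0 is irrelevant. -/
theorem descend_eigenvalue {d n i m : ℕ} (hm : m = 2 ∧ d ≠ 0 ∨ m = 1 ∧ d = 0) {h : SE}
    (hh : IsJointHighest d n i h) (k : ℕ) {j : ℕ} (hj : j < m) :
    (opH + (2 * d + 1 : ℂ) • (deg₂ + (3 / d : ℂ) • (opF * opE))) (descend h k j)
      = (((n : ℤ) - k + (2 * d + 1) * (i + 4 * j) : ℤ) : ℂ) • descend h k j := by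
  simp only [LinearMap.add_apply, LinearMap.smul_apply, Module.End.mul_apply, opH_descend hh,
    deg₂_descend hh, opE_descend hh]
  match j with
  | 0 =>
    simp only [zero_ne_one, if_false, map_zero, smul_zero]
    push_cast
    module
  | 1 =>
    have hd : (d : ℂ) ≠ 0 := Nat.cast_ne_zero.2 (by omega)
    simp only [if_true, map_smul, opF_descend, smul_smul, zero_add]
    rw [show (3 / d : ℂ) * ((-1) ^ k * d * (-1) ^ k) = 3 by
      rw [mul_right_comm, ← pow_add, ← two_mul, pow_mul]
      field_simp
      simp]
    push_cast
    module
  | j + 2 => omega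

theorem linearIndependent_descend {d r m : ℕ} (hr : r ≤ 4)
    (hm : m = 2 ∧ d ≠ 0 ∨ m = 1 ∧ d = 0) {n : Fin r → ℕ} (hn : ∀ i, n i ≤ d) {h : Fin r → SE}
    (hh : ∀ i, IsJointHighest d (n i) i (h i)) :
    LinearIndependent ℂ fun a : (Σ i : Fin r, Fin (2 * n i + 1) × Fin m) =>
      descend (h a.1) a.2.1 a.2.2 := by
  refine Module.End.eigenvectors_linearIndependent' (M := SE)
    (opH + (2 * d + 1 : ℂ) • (deg₂ + (3 / d : ℂ) • (opF * opE)))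
    (fun a : (Σ i : Fin r, Fin (2 * n i + 1) × Fin m) => (((n a.1 : ℤ) - (a.2.1 : ℕ)
      + (2 * d + 1) * ((a.1 : ℕ) + 4 * (a.2.2 : ℕ)) : ℤ) : ℂ)) ?_ _ fun a =>
    ⟨Module.End.mem_eigenspace_iff.2 (descend_eigenvalue hm (hh _) _ a.2.2.2),
      descend_ne_zero hm (hh _) a.2.1.2 a.2.2.2⟩
  rintro ⟨i, k, j⟩ ⟨i', k', j'⟩ heq
  have heq : ((n i : ℤ) - (k : ℕ) + (2 * d + 1) * ((i : ℕ) + 4 * (j : ℕ)))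
      = ((n i' : ℤ) - (k' : ℕ) + (2 * d + 1) * ((i' : ℕ) + 4 * (j' : ℕ))) := by
    exact Int.cast_injective (α := ℂ) heq
  have h1 := hn i
  have h2 := hn i'
  have hk := k.2
  have hk' := k'.2
  -- The weights n - k lie between -d and d, so two of them differ by less than 2d + 1 and the
  -- multiple of 2d + 1 can be read off. Since i < 4, the number i + 4j then determines both i and
  -- j.
  have hb : ((i : ℕ) + 4 * (j : ℕ) : ℤ) = (i' : ℕ) + 4 * (j' : ℕ) := by
    by_contra hne
    rcases lt_or_gt_of_ne hne with hlt | hlt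
    · nlinarith
    · nlinarith
  have hi : i = i' := Fin.ext (by omega)
  subst hi
  have hj : j = j' := Fin.ext (by omega)
  subst hj
  have hk : k = k' := Fin.ext (by omega)
  subst hk
  rfl

/-! ### The decomposition -/

/-- A homogeneous vector is a combination of the basis vectors of the same parity. -/
theorem SuperRep.mem_span_of_mem_grading {n : Type*} [Fintype n] {par : n → ZMod 2}
    {𝔰 : MatrixSuperalgebra par} {M : Type*} [AddCommGroup M] [Module ℂ M] (ρ : SuperRep 𝔰 M)
    {ι : Type*} [Fintype ι] (b : Module.Basis ι ℂ M) (s : ι → ZMod 2)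
    (hb : ∀ i, b i ∈ ρ.grading (s i)) {p : ZMod 2} {v : M} (hv : v ∈ ρ.grading p) :
    v ∈ Submodule.span ℂ (b '' {i | s i = p}) := by
  classical
  have hle : ∀ q, Submodule.span ℂ (b '' {i | s i = q}) ≤ ρ.grading q := fun q => by
    rw [Submodule.span_le]
    rintro _ ⟨i, rfl, rfl⟩
    exact hb i
  have hmem : ∀ q, ∑ i ∈ Finset.univ.filter (fun i => s i = q), b.repr v i • b i
      ∈ Submodule.span ℂ (b '' {i | s i = q}) := fun q =>
    Submodule.sum_mem _ fun i hi => Submodule.smul_mem _ _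
      (Submodule.subset_span ⟨i, (Finset.mem_filter.1 hi).2, rfl⟩)
  have hsum : v = ∑ i ∈ Finset.univ.filter (fun i => s i = p), b.repr v i • b i
      + ∑ i ∈ Finset.univ.filter (fun i => s i = p + 1), b.repr v i • b i := by
    conv_lhs => rw [← b.sum_repr v, ← Finset.sum_filter_add_sum_filter_not _ (fun i => s i = p)]
    congr 2
    ext i
    have : ∀ a c : ZMod 2, ¬a = c ↔ a = c + 1 := by decide
    simp [this]
  -- This part of the expansion has parity p + 1 by its terms and parity p as a difference of
  -- vectors of parity p.
  have h0 : ∑ i ∈ Finset.univ.filter (fun i => s i = p + 1), b.repr v i • b i = 0 := by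
    have hd : Disjoint (ρ.grading p) (ρ.grading (p + 1)) :=
      ρ.isInternal.submodule_iSupIndep.pairwiseDisjoint (by simp)
    refine Submodule.disjoint_def.1 hd _ ?_ (hle _ (hmem _))
    rw [← sub_eq_iff_eq_add'.2 hsum]
    exact Submodule.sub_mem _ hv (hle _ (hmem _))
  rw [h0, add_zero] at hsum
  rw [hsum]
  exact hmem p

theorem sgn_natCast (k : ℕ) : sgn (k : ZMod 2) = (-1) ^ k := by
  rw [sgn, ZMod.val_natCast, ← neg_one_pow_eq_pow_mod_two]

theorem tmul_eq_of_basis {V W S : Type*} [AddCommGroup V] [Module ℂ V] [AddCommGroup W]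
    [Module ℂ W] [AddCommGroup S] [Module ℂ S] {κ κ' : Type*}
    (b : Module.Basis κ ℂ V) (c : Module.Basis κ' ℂ W) {A B : V ⊗[ℂ] W →ₗ[ℂ] S}
    (h : ∀ k j, A (b k ⊗ₜ c j) = B (b k ⊗ₜ c j)) (x : V ⊗[ℂ] W) : A x = B x := by
  refine LinearMap.congr_fun ((b.tensorProduct c).ext fun a => ?_) x
  rw [Module.Basis.tensorProduct_apply']
  exact h a.1 a.2

/-- Bases of a `spo(2|1)`-module and of a `gl(1|1)`-module generated by highest weight vectors of
the weights of the joint highest weight vector `h`. -/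
structure Matching {V W : Type*} [AddCommGroup V] [Module ℂ V] [AddCommGroup W] [Module ℂ W]
    (ρ : SuperRep spo21 V) (τ : SuperRep gl11 W) (d n i m : ℕ) (h : SE) where
  s : ZMod 2
  s' : ZMod 2
  v : V
  w : W
  b : Module.Basis (Fin (2 * n + 1)) ℂ V
  c : Module.Basis (Fin m) ℂ W
  joint : IsJointHighest d n i h
  b_eq : ∀ k, b k = (ρ.act 1 spoN ^ (k : ℕ)) v
  b_mem : ∀ k : Fin (2 * n + 1), b k ∈ ρ.grading ((k : ℕ) + s)
  Pv : ρ.act 1 spoQ v = 0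
  Hv : ρ.act 0 spoH v = (n : ℂ) • v
  v_last : (ρ.act 1 spoN ^ (2 * n + 1)) v = 0
  c_eq : ∀ j, c j = (τ.act 1 glE21 ^ (j : ℕ)) w
  c_mem : ∀ j : Fin m, c j ∈ τ.grading ((j : ℕ) + s')
  Ew : τ.act 1 glE12 w = 0
  Aw : τ.act 0 glE11 w = ((d : ℂ) - i + 1 / 2) • w
  Dw : τ.act 0 glE22 w = ((i : ℂ) - 1 / 2) • w
  w_last : (τ.act 1 glE21 ^ m) w = 0

namespace Matching

variable {V W : Type*} [AddCommGroup V] [Module ℂ V] [AddCommGroup W] [Module ℂ W]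
  {ρ : SuperRep spo21 V} {τ : SuperRep gl11 W} {d n i m : ℕ} {h : SE}
  (μ : Matching ρ τ d n i m h) {Ψ : V ⊗[ℂ] W →ₗ[ℂ] SE}

/-- The linear map `Ψ` sends the basis of the tensor product to the vectors generated by `h`. -/
def Sends (Ψ : V ⊗[ℂ] W →ₗ[ℂ] SE) : Prop :=
  ∀ k j : ℕ, Ψ ((ρ.act 1 spoN ^ k) μ.v ⊗ₜ (τ.act 1 glE21 ^ j) μ.w)
    -- An odd element of gl(1|1) passes N^k v with the sign (-1)^(k+s), while anticommuting F past
    -- N^k accounts for (-1)^k only. The missing (-1)^s for each factor F is put in here.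
    = sgn (μ.s * j) • descend h k j

/-- Beyond the range of the bases both sides vanish. Allowing all k and j lets N and F be applied
without treating the ends of the chains separately. -/
theorem sends_of_basis [Module.Finite ℂ (singular d)] (hF : (opF ^ m) h = 0)
    (hΨ : ∀ k j, Ψ (μ.b k ⊗ₜ μ.c j) = sgn (μ.s * (j : ℕ)) • descend h k j) : μ.Sends Ψ := by
  intro k j
  rcases Nat.lt_or_ge k (2 * n + 1) with hk | hk
  · rcases Nat.lt_or_ge j m with hj | hj
    · have := hΨ ⟨k, hk⟩ ⟨j, hj⟩
      rwa [μ.b_eq, μ.c_eq] at this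
    · obtain ⟨l, rfl⟩ := Nat.exists_eq_add_of_le' hj
      rw [pow_add _ l, Module.End.mul_apply, μ.w_last, map_zero, TensorProduct.tmul_zero, map_zero,
        descend, pow_add _ l, Module.End.mul_apply, hF, map_zero, map_zero, smul_zero]
  · obtain ⟨l, rfl⟩ := Nat.exists_eq_add_of_le' hk
    rw [pow_add _ l, Module.End.mul_apply, μ.v_last, map_zero, TensorProduct.zero_tmul, map_zero,
      descend_last μ.joint hk, smul_zero]

theorem opN_comm (hΨ : μ.Sends Ψ) (x : V) (y : W) :
    opN (Ψ (x ⊗ₜ y)) = Ψ (ρ.act 1 spoN x ⊗ₜ y) := by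
  refine tmul_eq_of_basis μ.b μ.c (S := SE) (A := opN ∘ₗ Ψ)
    (B := Ψ ∘ₗ TensorProduct.map (ρ.act 1 spoN) LinearMap.id) (fun k j => ?_) (x ⊗ₜ y)
  simp only [LinearMap.comp_apply, TensorProduct.map_tmul, LinearMap.id_apply, μ.b_eq, μ.c_eq]
  rw [← Module.End.mul_apply (ρ.act 1 spoN), ← pow_succ', hΨ, hΨ, descend_succ, map_smul]

theorem opP_comm (hΨ : μ.Sends Ψ) (x : V) (y : W) :
    opP (Ψ (x ⊗ₜ y)) = Ψ (ρ.act 1 spoQ x ⊗ₜ y) := by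
  refine tmul_eq_of_basis μ.b μ.c (S := SE) (A := opP ∘ₗ Ψ)
    (B := Ψ ∘ₗ TensorProduct.map (ρ.act 1 spoQ) LinearMap.id) (fun k j => ?_) (x ⊗ₜ y)
  simp only [LinearMap.comp_apply, TensorProduct.map_tmul, LinearMap.id_apply, μ.b_eq, μ.c_eq]
  rw [hΨ, map_smul]
  generalize (k : ℕ) = k
  cases k with
  | zero =>
    rw [pow_zero, Module.End.one_apply, μ.Pv, TensorProduct.zero_tmul, map_zero, descend, pow_zero,
      Module.End.one_apply, opP_descend_zero μ.joint, smul_zero]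
  | succ k =>
    rw [ρ.spoTriple.P_pow_succ μ.Pv μ.Hv, opP_descend_succ μ.joint, ← TensorProduct.smul_tmul',
      map_smul, hΨ, smul_comm]

theorem spo_comm (hΨ : μ.Sends Ψ) (p : ZMod 2) (X : spo21.part p) (x : V) (y : W) :
    omega (actG X) (Ψ (x ⊗ₜ y)) = Ψ (ρ.act p X x ⊗ₜ y) := by
  have hN := μ.opN_comm hΨ
  have hP := μ.opP_comm hΨ
  obtain rfl | rfl := parity_cases p
  · have hH : ρ.act 0 spoH x = -ρ.act 1 spoN (ρ.act 1 spoQ x) - ρ.act 1 spoQ (ρ.act 1 spoN x) := by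
      rw [ρ.spoTriple.PN]
      abel
    rw [omega_spo_even, ρ.act_spo_even, hH]
    simp only [LinearMap.add_apply, LinearMap.sub_apply, LinearMap.smul_apply, Module.End.mul_apply,
      opH_eq, hN, hP, TensorProduct.add_tmul, TensorProduct.sub_tmul, TensorProduct.neg_tmul,
      ← TensorProduct.smul_tmul', map_add, map_sub, map_neg, map_smul]
  · rw [omega_spo_odd, ρ.act_spo_odd]
    simp only [LinearMap.add_apply, LinearMap.smul_apply, hN, hP, TensorProduct.add_tmul,
      ← TensorProduct.smul_tmul', map_add, map_smul]

theorem gl_pow (j : ℕ) :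
    τ.act 0 glE11 ((τ.act 1 glE21 ^ j) μ.w)
        = ((d : ℂ) - i - j + 1 / 2) • (τ.act 1 glE21 ^ j) μ.w ∧
      τ.act 0 glE22 ((τ.act 1 glE21 ^ j) μ.w)
        = ((i : ℂ) + j - 1 / 2) • (τ.act 1 glE21 ^ j) μ.w ∧
      τ.act 1 glE12 ((τ.act 1 glE21 ^ j) μ.w) = if j = 1 then (d : ℂ) • μ.w else 0 := by
  have t := τ.glQuadruple
  refine ⟨?_, ?_, ?_⟩
  · induction j with
    | zero => simpa using μ.Aw
    | succ j ih =>
      rw [pow_succ', Module.End.mul_apply, t.AF, ih, map_smul]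
      push_cast
      module
  · induction j with
    | zero => simpa using μ.Dw
    | succ j ih =>
      rw [pow_succ', Module.End.mul_apply, t.DF, ih, map_smul]
      push_cast
      module
  · match j with
    | 0 => simpa using μ.Ew
    | 1 =>
      rw [pow_one, t.EF, μ.Ew, μ.Aw, μ.Dw, if_pos rfl, map_zero]
      module
    | j + 2 => simp [pow_succ', t.FF]

theorem gl_even_comm (hΨ : μ.Sends Ψ) (A : gl11.part 0) {T : Matrix (Fin 4) (Fin 4) ℂ}
    (hT : T ∈ kPart 0) (hA : restrictX T = A.1) (x : V) (y : W) :
    omega (actG' 0 T) (Ψ (x ⊗ₜ y)) = Ψ (x ⊗ₜ τ.act 0 A y) := by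
  have h00 : A.1 0 0 = T 0 0 := hA ▸ rfl
  have h11 : A.1 1 1 = T 2 2 := hA ▸ rfl
  rw [omega_k_even hT, τ.act_gl_even, h00, h11]
  generalize T 0 0 = a
  generalize T 2 2 = e
  have key := tmul_eq_of_basis μ.b μ.c (S := SE)
    (A := (a • (deg₁ + (1 / 2 : ℂ) • LinearMap.id) + e • (deg₂ - (1 / 2 : ℂ) • LinearMap.id)) ∘ₗ Ψ)
    (B := Ψ ∘ₗ TensorProduct.map LinearMap.id (a • τ.act 0 glE11 + e • τ.act 0 glE22))
    (fun k j => ?_) (x ⊗ₜ y)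
  · simpa only [LinearMap.comp_apply, TensorProduct.map_tmul, LinearMap.id_apply,
      LinearMap.add_apply, LinearMap.sub_apply, LinearMap.smul_apply] using key
  · simp only [LinearMap.comp_apply, TensorProduct.map_tmul, LinearMap.id_apply,
      LinearMap.add_apply, LinearMap.sub_apply, LinearMap.smul_apply, μ.b_eq, μ.c_eq,
      (μ.gl_pow j).1, (μ.gl_pow j).2.1, TensorProduct.tmul_add, TensorProduct.tmul_smul, map_add,
      map_smul, hΨ (k : ℕ) (j : ℕ), deg₁_descend μ.joint, deg₂_descend μ.joint]
    module

theorem gl_odd_comm_basis (hΨ : μ.Sends Ψ) (A : gl11.part 1) {T : Matrix (Fin 4) (Fin 4) ℂ}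
    (hT : T ∈ kPart 1) (hA : restrictX T = A.1) (k : Fin (2 * n + 1)) (y : W) :
    omega (actG' 1 T) (Ψ (μ.b k ⊗ₜ y)) = sgn ((k : ℕ) + μ.s) • Ψ (μ.b k ⊗ₜ τ.act 1 A y) := by
  have h01 : A.1 0 1 = T 0 2 := hA ▸ rfl
  have h10 : A.1 1 0 = T 2 0 := hA ▸ rfl
  rw [omega_k_odd hT, τ.act_gl_odd, h01, h10]
  generalize T 0 2 = a
  generalize T 2 0 = e
  have hs := sgn_mul_self μ.s
  have hlin : ((a • opE + e • opF) ∘ₗ Ψ ∘ₗ TensorProduct.mk ℂ V W (μ.b k) : W →ₗ[ℂ] SE)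
      = sgn ((k : ℕ) + μ.s) • (Ψ ∘ₗ TensorProduct.mk ℂ V W (μ.b k) ∘ₗ
        (a • τ.act 1 glE12 + e • τ.act 1 glE21)) := by
    refine μ.c.ext fun j => ?_
    have h1 : sgn (μ.s * ((j : ℕ) + 1 : ℕ)) = sgn (μ.s * (j : ℕ)) * sgn μ.s := by
      rw [Nat.cast_add, Nat.cast_one, mul_add, mul_one, sgn_add]
    have hF : Ψ ((ρ.act 1 spoN ^ (k : ℕ)) μ.v ⊗ₜ τ.act 1 glE21 ((τ.act 1 glE21 ^ (j : ℕ)) μ.w))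
        = (sgn (μ.s * (j : ℕ)) * sgn μ.s) • descend h k (j + 1) := by
      rw [← Module.End.mul_apply (τ.act 1 glE21), ← pow_succ', hΨ, h1]
    have hE : Ψ ((ρ.act 1 spoN ^ (k : ℕ)) μ.v ⊗ₜ τ.act 1 glE12 ((τ.act 1 glE21 ^ (j : ℕ)) μ.w))
        = if (j : ℕ) = 1 then (d : ℂ) • descend h k 0 else 0 := by
      have h0 := hΨ k 0
      simp only [pow_zero, Module.End.one_apply, Nat.cast_zero, mul_zero, sgn_zero, one_smul] at h0
      rw [(μ.gl_pow j).2.2]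
      split_ifs
      · rw [TensorProduct.tmul_smul, map_smul, h0]
      · rw [TensorProduct.tmul_zero, map_zero]
    simp only [LinearMap.comp_apply, LinearMap.add_apply, LinearMap.smul_apply,
      TensorProduct.mk_apply, map_add, map_smul, μ.b_eq, μ.c_eq, hΨ (k : ℕ) (j : ℕ), hE, hF,
        opE_descend μ.joint, opF_descend, sgn_add,
      sgn_natCast]
    -- For j = 1 the term with E contributes as well. In both cases the sign of s occurs squared in
    -- the term with F, which is where `hs` is needed.
    split_ifs with hj
    · rw [hj, Nat.cast_one, mul_one]
      generalize descend h k 0 = z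
      generalize descend h k (1 + 1) = z'
      match_scalars
      · ring
      · linear_combination -(e * (-1) ^ (k : ℕ) * sgn μ.s) * hs
    · generalize descend h k (j + 1) = z
      match_scalars
      linear_combination -(e * (-1) ^ (k : ℕ) * sgn (μ.s * (j : ℕ))) * hs
  have := LinearMap.congr_fun hlin y
  simpa only [LinearMap.comp_apply, LinearMap.add_apply, LinearMap.smul_apply,
      TensorProduct.mk_apply] using this

theorem gl_odd_comm (hΨ : μ.Sends Ψ) (A : gl11.part 1) {T : Matrix (Fin 4) (Fin 4) ℂ}
    (hT : T ∈ kPart 1) (hA : restrictX T = A.1) {q : ZMod 2} {x : V} (hx : x ∈ ρ.grading q)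
    (y : W) : omega (actG' 1 T) (Ψ (x ⊗ₜ y)) = sgn q • Ψ (x ⊗ₜ τ.act 1 A y) := by
  replace hx := ρ.mem_span_of_mem_grading μ.b (fun k => (k : ℕ) + μ.s) μ.b_mem hx
  induction hx using Submodule.span_induction with
  | mem x hx =>
    obtain ⟨k, hk, rfl⟩ := hx
    rw [μ.gl_odd_comm_basis hΨ A hT hA k y, ← show ((k : ℕ) : ZMod 2) + μ.s = q from hk]
  | zero => simp only [TensorProduct.zero_tmul, map_zero, smul_zero]
  | add x x' _ _ hx hx' => simp only [TensorProduct.add_tmul, map_add, hx, hx', smul_add]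
  | smul a x _ hx =>
    simp only [← TensorProduct.smul_tmul', map_smul, hx]
    exact smul_comm _ _ _

theorem mem_parityPart (hΨ : μ.Sends Ψ) {ε : ZMod 2} (hh : h ∈ parityPart ε) {p q : ZMod 2}
    {x : V} (hx : x ∈ ρ.grading p) {y : W} (hy : y ∈ τ.grading q) :
    Ψ (x ⊗ₜ y) ∈ parityPart (p + q + (ε + μ.s + μ.s')) := by
  replace hx := ρ.mem_span_of_mem_grading μ.b (fun k => (k : ℕ) + μ.s) μ.b_mem hx
  replace hy := τ.mem_span_of_mem_grading μ.c (fun j => (j : ℕ) + μ.s') μ.c_mem hy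
  induction hx using Submodule.span_induction with
  | mem x hx =>
    obtain ⟨k, rfl, rfl⟩ := hx
    induction hy using Submodule.span_induction with
    | mem y hy =>
      obtain ⟨j, rfl, rfl⟩ := hy
      rw [μ.b_eq, μ.c_eq, hΨ]
      have hp : ∀ a e s s' ε : ZMod 2, a + s + (e + s') + (ε + s + s') = a + e + ε := by decide
      rw [hp]
      exact Submodule.smul_mem _ _ (descend_mem_parityPart hh k j)
    | zero => simp only [TensorProduct.tmul_zero, map_zero, Submodule.zero_mem]
    | add y y' _ _ hy hy' =>
      rw [TensorProduct.tmul_add, map_add]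
      exact Submodule.add_mem _ hy hy'
    | smul a y _ hy =>
      rw [TensorProduct.tmul_smul, map_smul]
      exact Submodule.smul_mem _ _ hy
  | zero => simp only [TensorProduct.zero_tmul, map_zero, Submodule.zero_mem]
  | add x x' _ _ hx hx' =>
    rw [TensorProduct.add_tmul, map_add]
    exact Submodule.add_mem _ hx hx'
  | smul a x _ hx =>
    rw [← TensorProduct.smul_tmul', map_smul]
    exact Submodule.smul_mem _ _ hx

end Matching

-- Assembling the isomorphism from the bases.

universe u

theorem exists_basis_of_finrank_le {S : Type*} [AddCommGroup S] [Module ℂ S] (U : Submodule ℂ S)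
    [Module.Finite ℂ U] {κ : Type*} [Fintype κ] {f : κ → S} (hf : LinearIndependent ℂ f)
    (hU : ∀ a, f a ∈ U) (hc : Module.finrank ℂ U ≤ Fintype.card κ) :
    ∃ B : Module.Basis κ ℂ U, ∀ a, (B a : S) = f a := by
  have hli : LinearIndependent ℂ fun a => (⟨f a,
    hU a⟩ : U) := LinearIndependent.of_comp U.subtype hf
  exact ⟨Module.Basis.mk hli (hli.span_eq_top_of_card_eq_finrank'
    (le_antisymm hli.fintype_card_le_finrank hc)).ge, fun a => by rw [Module.Basis.mk_apply]⟩

/-- The independent vectors are as many as the upper bound for the dimension allows, hence they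
span. Rescaling by the signs required in `Matching.Sends` keeps them a basis. -/
theorem exists_basis_harmonics {d r m : ℕ} [Module.Finite ℂ (singular d)] {n : Fin r → ℕ}
    {h : Fin r → SE} (hr : r ≤ 4) (hm : m = 2 ∧ d ≠ 0 ∨ m = 1 ∧ d = 0) (hn : ∀ i, n i ≤ d)
    (hh : ∀ i : Fin r, IsJointHighest d (n i) i (h i))
    (hdim : Module.finrank ℂ (harmonics d) ≤ ∑ i, (2 * n i + 1) * m) (s : Fin r → ZMod 2) :
    ∃ B : Module.Basis (Σ i : Fin r, Fin (2 * n i + 1) × Fin m) ℂ (harmonics d),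
      ∀ a, (B a : SE) = sgn (s a.1 * (a.2.2 : ℕ)) • descend (h a.1) a.2.1 a.2.2 := by
  have hu : ∀ p, IsUnit (sgn p) := fun p => IsUnit.of_mul_eq_one _ (sgn_mul_self p)
  have hli := (linearIndependent_descend hr hm hn hh).units_smul
    (fun a => (hu (s a.1 * (a.2.2 : ℕ))).unit)
  have hfin := finite_harmonics (d := d)
  refine exists_basis_of_finrank_le (S := SE) (harmonics d) hli (fun a =>
    Submodule.smul_mem _ _ (descend_mem_harmonics (hh a.1) _ _)) ?_
  simpa using hdim

theorem exists_directSum_equiv {ι : Type*} [DecidableEq ι] {V W : ι → Type*} {H : Type*}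
    [∀ i, AddCommGroup (V i)] [∀ i, Module ℂ (V i)] [∀ i, AddCommGroup (W i)]
    [∀ i, Module ℂ (W i)] [AddCommMonoid H] [Module ℂ H] {κ κ' : ι → Type*}
    (b : ∀ i, Module.Basis (κ i) ℂ (V i)) (c : ∀ i, Module.Basis (κ' i) ℂ (W i))
    (B : Module.Basis (Σ i, κ i × κ' i) ℂ H) :
    ∃ Φ : (⨁ i, V i ⊗[ℂ] W i) ≃ₗ[ℂ] H, ∀ i k j,
      Φ (DirectSum.lof ℂ _ (fun i => V i ⊗[ℂ] W i) i (b i k ⊗ₜ c i j)) = B ⟨i, k, j⟩ := by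
  let C : Module.Basis (Σ i, κ i × κ' i) ℂ (⨁ i, V i ⊗[ℂ] W i) :=
    DFinsupp.basis fun i => (b i).tensorProduct (c i)
  refine ⟨C.equiv B (Equiv.refl _), fun i k j => ?_⟩
  have hC : DirectSum.lof ℂ _ (fun i => V i ⊗[ℂ] W i) i (b i k ⊗ₜ c i j) = C ⟨i, k, j⟩ := by
    rw [← Module.Basis.tensorProduct_apply]
    refine C.repr.injective ?_
    have hrepr : ∀ x a, C.repr x a = ((b a.1).tensorProduct (c a.1)).repr (x a.1) a.2 :=
      fun _ _ => rfl
    ext ⟨i', a⟩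
    rw [C.repr_self, hrepr, DirectSum.lof_eq_of]
    by_cases hi : i = i'
    · subst hi
      rw [DirectSum.of_eq_same, Module.Basis.repr_self]
      classical
      simp [Finsupp.single_apply]
    · rw [DirectSum.of_eq_of_ne _ _ _ (Ne.symm hi), map_zero, Finsupp.zero_apply,
        Finsupp.single_eq_of_ne]
      rintro ⟨⟩
      exact hi rfl
  rw [hC, Module.Basis.equiv_apply, Equiv.refl_apply]

/-- Joint highest weight vectors which generate a subspace of the right dimension determine the
decomposition of the harmonics. -/
theorem harmonicsDecomposeAs_of_isJointHighest {d r m : ℕ} [Module.Finite ℂ (singular d)]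
    {n : Fin r → ℕ} {h : Fin r → SE} (hr : r ≤ 4) (hm : m = 2 ∧ d ≠ 0 ∨ m = 1 ∧ d = 0)
    (hn : ∀ i, n i ≤ d) (hh : ∀ i : Fin r, IsJointHighest d (n i) i (h i)) {η : Fin r → ZMod 2}
    (hη : ∀ i, h i ∈ parityPart (η i)) (hF : ∀ i, (opF ^ m) (h i) = 0)
    (hdim : Module.finrank ℂ (harmonics d) ≤ ∑ i, (2 * n i + 1) * m) :
    HarmonicsDecomposeAs.{u} d (fun i => (n i : ℂ))
      (fun i : Fin r => ((d : ℂ) - (i : ℕ) + 1 / 2, ((i : ℕ) : ℂ) - 1 / 2)) := by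
  refine ⟨fun i => ⟨_, _, _, modelSpo (n i), isSpoIrrep_model (n i)⟩,
    fun i => exists_isGlIrrep _ _, ?_⟩
  intro V W _ _ _ _ ρ τ hρ hτ
  -- The two entries of each gl(1|1)-weight add up to d. All summands are therefore two-dimensional
  -- over gl(1|1) if d ≠ 0 and one-dimensional if d = 0.
  have hm' : ∀ i : Fin r, m = 2 ∧ ((d : ℂ) - (i : ℕ) + 1 / 2) + (((i : ℕ) : ℂ) - 1 / 2) ≠ 0 ∨
      m = 1 ∧ ((d : ℂ) - (i : ℕ) + 1 / 2) + (((i : ℕ) : ℂ) - 1 / 2) = 0 := fun i => by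
    have : ((d : ℂ) - (i : ℕ) + 1 / 2) + (((i : ℕ) : ℂ) - 1 / 2) = d := by ring
    rw [this]
    simpa using hm
  have key : ∀ i, Nonempty (Matching (ρ i) (τ i) d (n i) i m (h i)) := fun i => by
    obtain ⟨s, v, b, h1, h2, h3, h4, h5⟩ := exists_spo_basis (ρ i) (hρ i)
    obtain ⟨s', w, c, k1, k2, k3, k4, k5, k6⟩ := exists_gl_basis (τ i) (hm' i) (hτ i)
    exact ⟨⟨s, s', v, w, b, c, hh i, h1, h2, h3, h4, h5, k1, k2, k3, k4, k5, k6⟩⟩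
  have μ : ∀ i, Matching (ρ i) (τ i) d (n i) i m (h i) := fun i => (key i).some
  obtain ⟨B, hB⟩ := exists_basis_harmonics hr hm hn hh hdim (fun i => (μ i).s)
  obtain ⟨Φ, hΦ⟩ := exists_directSum_equiv (fun i => (μ i).b) (fun i => (μ i).c) B
  obtain ⟨Ψ, hΦΨ⟩ : ∃ Ψ : ∀ i, V i ⊗[ℂ] W i →ₗ[ℂ] SE,
      ∀ i x, (Φ (DirectSum.lof ℂ _ (fun i => V i ⊗[ℂ] W i) i x) : SE) = Ψ i x :=
    ⟨fun i => (harmonics d).subtype ∘ₗ Φ.toLinearMap ∘ₗ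
      DirectSum.lof ℂ _ (fun i => V i ⊗[ℂ] W i) i, fun _ _ => rfl⟩
  have hΨ : ∀ i, (μ i).Sends (Ψ i) := fun i =>
    (μ i).sends_of_basis (hF i) fun k j => by rw [← hΦΨ, hΦ, hB]
  refine ⟨Φ, fun i p X v w => ?_, fun i p A T hT hA q v hv w => ?_,
    fun i => ⟨η i + (μ i).s + (μ i).s', fun p q v hv w hw => ?_⟩⟩
  · rw [hΦΨ, hΦΨ, (μ i).spo_comm (hΨ i)]
  · rw [hΦΨ, hΦΨ]
    obtain rfl | rfl := parity_cases p
    · rw [zero_mul, sgn_zero, one_smul, (μ i).gl_even_comm (hΨ i) A hT hA]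
    · rw [one_mul, (μ i).gl_odd_comm (hΨ i) A hT hA hv]
  · rw [hΦΨ]
    exact (μ i).mem_parityPart (hΨ i) (hη i) hv hw

/-! ### The joint highest weight vectors -/

/-- The vector `x₁ᵏ`. -/
def xPow (k : ℕ) : SE := ofPoly (MvPolynomial.X 0 ^ k)

theorem dEta_xPow (i : Fin 3) (k : ℕ) : dEta i (xPow k) = 0 := dEta_ofPoly _ _

theorem dX_one_xPow (k : ℕ) : dX 1 (xPow k) = 0 := by
  simp [xPow, dX_ofPoly, Derivation.leibniz_pow]

theorem dX_two_xPow (k : ℕ) : dX 2 (xPow k) = 0 := by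
  simp [xPow, dX_ofPoly, Derivation.leibniz_pow]

theorem mulX_dX_xPow (k : ℕ) : mulX 0 (dX 0 (xPow k)) = (k : ℂ) • xPow k := by
  rw [xPow, dX_ofPoly, mulX_ofPoly, ← map_smul]
  congr 1
  cases k with
  | zero => simp
  | succ k =>
    rw [Derivation.leibniz_pow, MvPolynomial.pderiv_X_self, MvPolynomial.smul_eq_C_mul, map_natCast]
    simp
    ring

theorem mulX_mulX_dX_xPow (k : ℕ) :
    mulX 0 (mulX 0 (mulX 2 (dX 0 (xPow k)))) = (k : ℂ) • mulX 0 (mulX 2 (xPow k)) := by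
  rw [mulX_comm 0 2, mulX_dX_xPow, map_smul, map_smul]

theorem mulX_mulEta_dX_xPow (k : ℕ) :
    mulX 0 (mulEta 0 (mulEta 2 (dX 0 (xPow k)))) = (k : ℂ) • mulEta 0 (mulEta 2 (xPow k)) := by
  rw [← mulEta_mulX, ← mulEta_mulX, mulX_dX_xPow, map_smul, map_smul]

theorem vac_xPow (k : ℕ) : vac (xPow k) = MvPolynomial.X 0 ^ k := vac_ofPoly _

theorem isJointHighest_xPow (d : ℕ) : IsJointHighest d d 0 (xPow d) where
  mem := mem_singular.2 ⟨by
    simp only [deg_apply, deg₁_apply, deg₂_apply, dEta_xPow, dX_one_xPow, dX_two_xPow, mulX_dX_xPow,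
      map_zero, add_zero], by
    simp only [opD_apply, dEta_xPow, map_zero, sub_zero], by
    simp only [opE_apply, dEta_xPow, dX_two_xPow, map_zero, sub_zero, add_zero]⟩
  ne_zero h := by
    have := congrArg vac h
    rw [vac_xPow, map_zero] at this
    exact pow_ne_zero _ (MvPolynomial.X_ne_zero _) this
  opP_eq := by simp only [opP_apply, dEta_xPow, dX_one_xPow, dX_two_xPow, map_zero, add_zero]
  opH_eq := by
    simp only [opH_apply, dEta_xPow, dX_one_xPow, mulX_dX_xPow, map_zero, add_zero, sub_zero]
  deg₂_eq := by
    simp only [deg₂_apply, dEta_xPow, dX_two_xPow, map_zero, add_zero, Nat.cast_zero, zero_smul]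

/-- The vector `x₁^(e+1) x₃ + x₁^e η₁ η₃`. -/
def secondHighest (e : ℕ) : SE := mulX 0 (mulX 2 (xPow e)) + mulEta 0 (mulEta 2 (xPow e))

set_option linter.unusedSimpArgs false in
theorem isJointHighest_secondHighest (e : ℕ) :
    IsJointHighest (e + 2) (e + 1) 1 (secondHighest e) where
  -- The correction term is dictated by E: it sends x₁^(e+1) x₃ to -x₁^(e+1) η₃ and x₁^e η₁η₃ to
  -- x₁^(e+1) η₃.
  mem := mem_singular.2 ⟨by
    simp only [secondHighest, deg_apply, deg₁_apply, deg₂_apply, map_add, map_sub, map_neg,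
      map_zero, neg_zero,
      normalOrder, Fin.reduceEq, if_true, if_false, add_zero, sub_zero, dEta_xPow, dX_one_xPow,
        dX_two_xPow,
      mulX_mulX_dX_xPow, mulX_mulEta_dX_xPow]
    push_cast
    module, by
    simp only [secondHighest, opD_apply, map_add, map_sub, map_neg, map_zero, neg_zero,
      normalOrder, Fin.reduceEq, if_true, if_false, add_zero, sub_zero, dEta_xPow, dX_one_xPow,
        dX_two_xPow], by
    simp only [secondHighest, opE_apply, map_add, map_sub, map_neg, map_zero, neg_zero,
      normalOrder, Fin.reduceEq, if_true, if_false, add_zero, sub_zero, dEta_xPow, dX_one_xPow,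
        dX_two_xPow]
    abel⟩
  ne_zero h := by
    have := congrArg vac h
    rw [secondHighest, map_add, vac_mulEta, vac_mulX, vac_mulX, vac_xPow, map_zero,
      add_zero] at this
    exact mul_ne_zero (MvPolynomial.X_ne_zero _) (mul_ne_zero (MvPolynomial.X_ne_zero _)
      (pow_ne_zero _ (MvPolynomial.X_ne_zero _))) this
  opP_eq := by
    simp only [secondHighest, opP_apply, map_add, map_sub, map_neg, map_zero, neg_zero,
      normalOrder, Fin.reduceEq, if_true, if_false, add_zero, sub_zero, dEta_xPow, dX_one_xPow,
        dX_two_xPow]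
    abel
  opH_eq := by
    simp only [secondHighest, opH_apply, map_add, map_sub, map_neg, map_zero, neg_zero,
      normalOrder, Fin.reduceEq, if_true, if_false, add_zero, sub_zero, dEta_xPow, dX_one_xPow,
        dX_two_xPow,
      mulX_mulX_dX_xPow, mulX_mulEta_dX_xPow]
    push_cast
    module
  deg₂_eq := by
    simp only [secondHighest, deg₂_apply, map_add, map_sub, map_neg, map_zero, neg_zero,
      normalOrder, Fin.reduceEq, if_true, if_false, add_zero, sub_zero, dEta_xPow, dX_one_xPow,
        dX_two_xPow,
      mulX_mulX_dX_xPow, mulX_mulEta_dX_xPow]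
    push_cast
    module

theorem dX_one (i : Fin 3) : dX i (ofPoly 1) = 0 := by simp [dX_ofPoly]

/-- The vector `η₁ η₂ η₃ + x₂ x₃ η₁ - x₁ x₃ η₂ + x₃² η₃`. -/
def thirdHighest : SE :=
  mulEta 0 (mulEta 1 (mulEta 2 (ofPoly 1))) + mulX 1 (mulX 2 (mulEta 0 (ofPoly 1)))
    - mulX 0 (mulX 2 (mulEta 1 (ofPoly 1))) + mulX 2 (mulX 2 (mulEta 2 (ofPoly 1)))

set_option linter.unusedSimpArgs false in
-- This vector realizes the exceptional constant top component of degree 3. Its spo-weight is 0, so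
-- it generates the extra trivial spo(2|1)-module.
theorem isJointHighest_thirdHighest : IsJointHighest 3 0 2 thirdHighest where
  mem := mem_singular.2 ⟨by
    simp only [thirdHighest, deg_apply, deg₁_apply, deg₂_apply, map_add, map_sub, map_neg,
      map_zero, neg_zero,
      normalOrder, Fin.reduceEq, if_true, if_false, add_zero, zero_add, neg_neg, sub_zero,
        dEta_ofPoly, dX_one]
    push_cast
    module, by
    simp only [thirdHighest, opD_apply, map_add, map_sub, map_neg, map_zero, neg_zero,
      normalOrder, Fin.reduceEq, if_true, if_false, add_zero, zero_add, neg_neg, sub_zero,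
        dEta_ofPoly, dX_one]
    abel, by
    simp only [thirdHighest, opE_apply, map_add, map_sub, map_neg, map_zero, neg_zero,
      normalOrder, Fin.reduceEq, if_true, if_false, add_zero, zero_add, neg_neg, sub_zero,
        dEta_ofPoly, dX_one]
    abel⟩
  ne_zero h := by
    have := congrArg (fun z => vac (dEta 2 z)) h
    simp only [thirdHighest, map_add, map_sub, map_neg, map_zero, neg_zero,
      normalOrder, Fin.reduceEq, if_true, if_false, add_zero, zero_add, neg_neg, sub_zero,
        dEta_ofPoly, dX_one,
      vac_mulEta, vac_mulX, vac_ofPoly, mul_one, mul_zero] at this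
    exact mul_ne_zero (MvPolynomial.X_ne_zero _) (MvPolynomial.X_ne_zero _) this
  opP_eq := by
    simp only [thirdHighest, opP_apply, map_add, map_sub, map_neg, map_zero, neg_zero,
      normalOrder, Fin.reduceEq, if_true, if_false, add_zero, zero_add, neg_neg, sub_zero,
        dEta_ofPoly, dX_one]
    abel
  opH_eq := by
    simp only [thirdHighest, opH_apply, map_add, map_sub, map_neg, map_zero, neg_zero,
      normalOrder, Fin.reduceEq, if_true, if_false, add_zero, zero_add, neg_neg, sub_zero,
        dEta_ofPoly, dX_one]
    push_cast
    module
  deg₂_eq := by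
    simp only [thirdHighest, deg₂_apply, map_add, map_sub, map_neg, map_zero, neg_zero,
      normalOrder, Fin.reduceEq, if_true, if_false, add_zero, zero_add, neg_neg, sub_zero,
        dEta_ofPoly, dX_one]
    push_cast
    module

theorem xPow_mem (k : ℕ) : xPow k ∈ parityPart 0 := ofPoly_mem _

theorem mulEta_mulEta_mem {p : ZMod 2} (i j : Fin 3) {z : SE} (hz : z ∈ parityPart p) :
    mulEta i (mulEta j z) ∈ parityPart p := by
  have h := mulEta_mem i (mulEta_mem j hz)
  rwa [← add_assoc, CharTwo.add_self_eq_zero, zero_add] at h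

theorem secondHighest_mem (e : ℕ) : secondHighest e ∈ parityPart 0 :=
  Submodule.add_mem _ (mulX_mem _ (mulX_mem _ (xPow_mem e))) (mulEta_mulEta_mem _ _ (xPow_mem e))

theorem thirdHighest_mem : thirdHighest ∈ parityPart (1 + 0) := by
  have h : ∀ i, mulEta i (ofPoly 1) ∈ parityPart (1 + 0) := fun i => mulEta_mem i (ofPoly_mem 1)
  exact Submodule.add_mem _ (Submodule.sub_mem _ (Submodule.add_mem _
    (mulEta_mulEta_mem _ _ (h 2)) (mulX_mem _ (mulX_mem _ (h 0))))
    (mulX_mem _ (mulX_mem _ (h 1)))) (mulX_mem _ (mulX_mem _ (h 2)))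

/-! ### The decomposition in each degree. -/

theorem degreePart_zero_le : degreePart 0 ≤ Submodule.span ℂ {ofPoly 1} := by
  refine iSup_le fun i => iSup_le fun j => iSup_le fun h => Submodule.map₂_le.2 fun p hp y hy => ?_
  obtain ⟨rfl, rfl⟩ := Nat.add_eq_zero_iff.1 h
  rw [ExteriorAlgebra.exteriorPower, pow_zero] at hy
  obtain ⟨b, rfl⟩ := Submodule.mem_one.1 hy
  rw [MvPolynomial.mem_homogeneousSubmodule] at hp
  rw [MvPolynomial.totalDegree_eq_zero_iff_eq_C.1 (Nat.le_zero.1 hp.totalDegree_le)]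
  refine Submodule.mem_span_singleton.2 ⟨b * MvPolynomial.coeff 0 p, ?_⟩
  rw [TensorProduct.mk_apply, Algebra.algebraMap_eq_smul_one, ofPoly_apply,
    ← mul_one (MvPolynomial.C _),
    ← MvPolynomial.smul_eq_C_mul, TensorProduct.tmul_smul, ← TensorProduct.smul_tmul', smul_smul]

/-- Twice the singular dimension would only give 2. In degree 0, however, all of S⁰(E) is the line
of constants. -/
theorem finrank_harmonics_zero_le : Module.finrank ℂ (harmonics 0) ≤ 1 :=
  (Submodule.finrank_mono (inf_le_left.trans degreePart_zero_le)).trans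
    (finrank_span_le_card (R := ℂ) (M := SE) {ofPoly 1} |>.trans (by simp))

theorem opF_sq (z : SE) : (opF ^ 2) z = 0 := by rw [pow_two, Module.End.mul_apply, opF_opF]

theorem harmonicsDecomposeAs_zero : HarmonicsDecomposeAs.{u} 0 ![0] ![(1 / 2, -1 / 2)] := by
  have := finrank_singular_zero_le.1
  have key := harmonicsDecomposeAs_of_isJointHighest.{u} (d := 0) (r := 1) (m := 1) (n := fun _ =>
    0)
    (h := fun _ => xPow 0) (by norm_num) (Or.inr ⟨rfl, rfl⟩) (fun _ => le_rfl)
    (fun i => by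
      rw [Subsingleton.elim i 0]
      exact isJointHighest_xPow 0) (η := fun _ => 0) (fun _ => xPow_mem 0)
    (fun _ => by simp [xPow, opF_apply, dEta_ofPoly, dX_one])
    (by simpa using finrank_harmonics_zero_le)
  convert key using 1
  · ext i
    fin_cases i
    simp
  · ext i <;> fin_cases i <;> norm_num

theorem harmonicsDecomposeAs_one : HarmonicsDecomposeAs.{u} 1 ![1] ![(3 / 2, -1 / 2)] := by
  have := finrank_singular_one_le.1
  have key := harmonicsDecomposeAs_of_isJointHighest.{u} (d := 1) (r := 1) (m := 2) (n := fun _ =>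
    1)
    (h := fun _ => xPow 1) (by norm_num) (Or.inl ⟨rfl, one_ne_zero⟩) (fun _ => le_rfl)
    (fun i => by
      rw [Subsingleton.elim i 0]
      exact isJointHighest_xPow 1) (η := fun _ => 0) (fun _ => xPow_mem 1)
    (fun _ => opF_sq _) (by
      have h1 := finrank_harmonics_le (d := 1)
      have h2 := finrank_singular_one_le.2
      simp only [Finset.univ_unique, Finset.sum_singleton]
      omega)
  convert key using 1
  · ext i
    fin_cases i
    simp
  · ext i <;> fin_cases i <;> norm_num

/-- The dimensions agree: 2(2(e+2)+1) + 2(2(e+1)+1) = 8(e+2), which is twice the bound 4(e+2) for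
singular vectors. The hypothesis excludes degree 3. -/
theorem harmonicsDecomposeAs_add_two {e : ℕ} (he : e ≠ 1) :
    HarmonicsDecomposeAs.{u} (e + 2) ![(e : ℂ) + 2, (e : ℂ) + 1]
      ![((e : ℂ) + 5 / 2, -1 / 2), ((e : ℂ) + 3 / 2, 1 / 2)] := by
  obtain ⟨_, hs⟩ : Module.Finite ℂ (singular (e + 2)) ∧
      Module.finrank ℂ (singular (e + 2)) ≤ 4 * (e + 2) := finrank_singular_le (by omega)
  have key := harmonicsDecomposeAs_of_isJointHighest.{u} (d := e + 2) (r := 2) (m := 2)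
    (n := ![e + 2, e + 1]) (h := ![xPow (e + 2), secondHighest e]) (by norm_num)
    (Or.inl ⟨rfl, by omega⟩) (fun i => by fin_cases i <;> simp)
    (fun i => by
      fin_cases i
      · exact isJointHighest_xPow (e + 2)
      · exact isJointHighest_secondHighest e) (η := fun _ => 0)
    (fun i => by
      fin_cases i
      · exact xPow_mem (e + 2)
      · exact secondHighest_mem e)
    (fun _ => opF_sq _) (by
      have h1 := finrank_harmonics_le (d := e + 2)
      rw [Fin.sum_univ_two]
      simp only [Matrix.cons_val_zero, Matrix.cons_val_one]
      omega)
  convert key using 1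
  · ext i
    fin_cases i <;> simp
  · ext i <;> fin_cases i <;> norm_num <;> ring

/-- The dimensions agree: 2(7 + 5 + 1) = 26 = 2 · 13. -/
theorem harmonicsDecomposeAs_three : HarmonicsDecomposeAs.{u} 3 ![3, 2, 0]
    ![(7 / 2, -1 / 2), (5 / 2, 1 / 2), (3 / 2, 3 / 2)] := by
  obtain ⟨_, hs⟩ := finrank_singular_three_le
  have key := harmonicsDecomposeAs_of_isJointHighest.{u} (d := 3) (r := 3) (m := 2)
    (n := ![3, 2, 0]) (h := ![xPow 3, secondHighest 1, thirdHighest]) (by norm_num)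
    (Or.inl ⟨rfl, by omega⟩) (fun i => by fin_cases i <;> simp)
    (fun i => by
      fin_cases i
      · exact isJointHighest_xPow 3
      · exact isJointHighest_secondHighest 1
      · exact isJointHighest_thirdHighest) (η := ![0, 0, 1 + 0])
    (fun i => by
      fin_cases i
      · exact xPow_mem 3
      · exact secondHighest_mem 1
      · exact thirdHighest_mem)
    (fun _ => opF_sq _) (by
      have h1 := finrank_harmonics_le (d := 3)
      simp only [Fin.sum_univ_three, Matrix.cons_val]
      omega)
  convert key using 1
  · ext i
    fin_cases i <;> simp
  · ext i <;> fin_cases i <;> norm_num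

end SpoOsp

end

theorem mainTheorem3 :
    (∀ d : ℕ, 4 ≤ d → SpoOsp.HarmonicsDecomposeAs d
      ![(d : ℂ), (d : ℂ) - 1]
      ![((d : ℂ) + 1 / 2, -1 / 2), ((d : ℂ) - 1 / 2, 1 / 2)]) ∧
    SpoOsp.HarmonicsDecomposeAs 0 ![0] ![(1 / 2, -1 / 2)] ∧
    SpoOsp.HarmonicsDecomposeAs 1 ![1] ![(3 / 2, -1 / 2)] ∧
    SpoOsp.HarmonicsDecomposeAs 2 ![2, 1] ![(5 / 2, -1 / 2), (3 / 2, 1 / 2)] ∧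
    SpoOsp.HarmonicsDecomposeAs 3 ![3, 2, 0]
      ![(7 / 2, -1 / 2), (5 / 2, 1 / 2), (3 / 2, 3 / 2)] := by
  refine ⟨fun d hd => ?_, SpoOsp.harmonicsDecomposeAs_zero, SpoOsp.harmonicsDecomposeAs_one, ?_,
    SpoOsp.harmonicsDecomposeAs_three⟩
  · obtain ⟨e, rfl⟩ := Nat.exists_eq_add_of_le' (show 2 ≤ d by omega)
    convert SpoOsp.harmonicsDecomposeAs_add_two (e := e) (by omega) using 1
    · ext i
      fin_cases i
      · simp
      · simp only [Fin.mk_one, Matrix.cons_val_one, Matrix.cons_val_zero]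
        push_cast
        ring
    · ext i <;> fin_cases i <;> norm_num <;> ring
  · convert SpoOsp.harmonicsDecomposeAs_add_two (e := 0) (by omega) using 1
    · ext i
      fin_cases i <;> norm_num
    · ext i <;> fin_cases i <;> norm_num
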